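/- Let $n\ge 2$ and $p$ be integers with $p-n-1>0$. Let $X_1,\dots,X_n$ be i.i.d. $N_p(0,\Sigma)$ with $\Sigma$ an unknown $p\times p$ positive definite matrix, and let $S=\sum_{i=1}^n X_iX_i^t\sim W_p(n,\Sigma)$. An estimator $\delta=\delta(S)$ of $\Sigma$ is evaluated by its risk $R(\delta,\Sigma)=E[L(\delta,\Sigma)]$ under the Stein loss $L(\delta,\Sigma)=\operatorname{tr}\Sigma^{-1}\delta-\log\det(\Sigma^{-1}\delta)-p$. Say that $\delta_1$ dominates $\delta_2$ if both risks are finite and $R(\delta_1,\Sigma)\le R(\delta_2,\Sigma)$ for every positive definite $\Sigma$, with strict inequality for at least one $\Sigma$. Almost surely $S=HLH^t$ with $H^tH=I_n$ ($H$ of size $p\times n$) and $L=\operatorname{diag}(\ell_1,\dots,\ell_n)$, $\ell_1>\cdots>\ell_n>0$; let $\mathcal D$ be the set of all $p\times p$ matrices $S$ of this form. Let $b=b(S)$ be a real function that is differentiable on $\mathcal D$, and let $\partial b/\partial\ell_i$ be the derivative of $b(H\operatorname{diag}(\ell_1,\dots,\ell_n)H^t)$ in $\ell_i$ with $H$ and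 the other $\ell_j$ fixed. For $0\le b(S)<n$ let $\hat\lambda_b=\hat\lambda_b(S)\ge 0$ be the unique solution of $$\sum_{j=1}^n\frac{\hat\lambda_b}{\ell_j+\hat\lambda_b}=b(S),$$ and define $$\delta^{EB}(b)=\frac1p\,(S+\hat\lambda_b I_p),\qquad \delta^{SH}(b)=\delta^{EB}(b)-\frac1p\,\hat\lambda_b\,HH^t .$$ Let $c_*=2(n-1)/(p-n+1)$ and $b_*=c_*/(1+c_*)$. If there is a constant $C_0>0$ such that $C_0\le b\le b_*$ on $\mathcal D$, and $\sum_{i=1}^n\partial b/\partial\ell_i\le 0$ on $\mathcal D$, then $\delta^{EB}(b)$ dominates $\delta^{SH}(b)$. -/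

import Mathlib

open MeasureTheory ProbabilityTheory Matrix

namespace SteinCov

/-- The scatter matrix `S = ∑ i, X i * (X i)ᵗ` of a sample of `n` vectors in `ℝᵖ`. -/
noncomputable def scatter {p n : ℕ} (X : Fin n → EuclideanSpace ℝ (Fin p)) :
    Matrix (Fin p) (Fin p) ℝ :=
  ∑ i, vecMulVec (X i).ofLp (X i).ofLp

/-- The joint law of `n` independent `N_p(0, Sig)` vectors. -/
noncomputable def sampleLaw (n : ℕ) {p : ℕ} (Sig : Matrix (Fin p) (Fin p) ℝ) :
    Measure (Fin n → EuclideanSpace ℝ (Fin p)) :=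
  Measure.pi fun _ => multivariateGaussian 0 Sig

/-- The Stein loss. -/
noncomputable def steinLoss {p : ℕ} (δ Sig : Matrix (Fin p) (Fin p) ℝ) : ℝ :=
  (Sig⁻¹ * δ).trace - Real.log (Sig⁻¹ * δ).det - p

/-- The risk of the estimator `δ = δ(S)` at `Sig` is finite. -/
def HasFiniteRisk (n : ℕ) {p : ℕ} (δ : Matrix (Fin p) (Fin p) ℝ → Matrix (Fin p) (Fin p) ℝ)
    (Sig : Matrix (Fin p) (Fin p) ℝ) : Prop :=
  Integrable (fun X => steinLoss (δ (scatter X)) Sig) (sampleLaw n Sig)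

/-- The risk of the estimator `δ = δ(S)` at `Sig`. -/
noncomputable def risk (n : ℕ) {p : ℕ}
    (δ : Matrix (Fin p) (Fin p) ℝ → Matrix (Fin p) (Fin p) ℝ)
    (Sig : Matrix (Fin p) (Fin p) ℝ) : ℝ :=
  ∫ X, steinLoss (δ (scatter X)) Sig ∂(sampleLaw n Sig)

/-- `δ₁` dominates `δ₂`: both have finite risk, the risk of `δ₁` is nowhere larger than that of
`δ₂`, and it is smaller somewhere. -/
def Dominates (n : ℕ) {p : ℕ}
    (δ₁ δ₂ : Matrix (Fin p) (Fin p) ℝ → Matrix (Fin p) (Fin p) ℝ) : Prop :=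
  (∀ Sig : Matrix (Fin p) (Fin p) ℝ, Sig.PosDef →
    HasFiniteRisk n δ₁ Sig ∧ HasFiniteRisk n δ₂ Sig ∧ risk n δ₁ Sig ≤ risk n δ₂ Sig) ∧
  ∃ Sig : Matrix (Fin p) (Fin p) ℝ, Sig.PosDef ∧ risk n δ₁ Sig < risk n δ₂ Sig

/-- `S = H L Hᵗ` with `Hᵗ H = 1` and `L = diag(ℓ₁, …, ℓₙ)`, `ℓ₁ > ⋯ > ℓₙ > 0`. -/
structure IsEigDecomp {p n : ℕ} (S : Matrix (Fin p) (Fin p) ℝ)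
    (H : Matrix (Fin p) (Fin n) ℝ) (l : Fin n → ℝ) : Prop where
  orthonormal : Hᵀ * H = 1
  strictAnti : StrictAnti l
  pos : ∀ i, 0 < l i
  eq : S = H * diagonal l * Hᵀ

/-- The matrices having such a decomposition; when `n ≤ p`, the scatter matrix is almost surely
one of them. -/
def scatterDomain (n p : ℕ) : Set (Matrix (Fin p) (Fin p) ℝ) :=
  {S | ∃ (H : Matrix (Fin p) (Fin n) ℝ) (l : Fin n → ℝ), IsEigDecomp S H l}

open Classical in
/-- An eigenvalue decomposition `(H, ℓ)` of `S` (the value is junk off `scatterDomain n p`).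
The vector `ℓ` is unique and `H` is unique up to the signs of its columns. -/
noncomputable def eigDecomp (n : ℕ) {p : ℕ} (S : Matrix (Fin p) (Fin p) ℝ) :
    Matrix (Fin p) (Fin n) ℝ × (Fin n → ℝ) :=
  if h : ∃ d : Matrix (Fin p) (Fin n) ℝ × (Fin n → ℝ), IsEigDecomp S d.1 d.2 then h.choose
  else (0, 0)

/-- The partial derivative `∂b/∂ℓᵢ` at `S = H diag(ℓ) Hᵗ`, with `H` and the other `ℓⱼ` fixed. -/
noncomputable def partialEig {p n : ℕ} (b : Matrix (Fin p) (Fin p) ℝ → ℝ)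
    (H : Matrix (Fin p) (Fin n) ℝ) (l : Fin n → ℝ) (i : Fin n) : ℝ :=
  deriv (fun t => b (H * diagonal (Function.update l i t) * Hᵀ)) (l i)

/-- The solution `lam ≥ 0` of `∑ j, lam / (ℓⱼ + lam) = β`. -/
noncomputable def lamSol {n : ℕ} (l : Fin n → ℝ) (β : ℝ) : ℝ :=
  sInf {lam : ℝ | 0 ≤ lam ∧ ∑ j, lam / (l j + lam) = β}

/-- The equation defining `lamSol` has exactly one solution. -/
theorem existsUnique_lam {n : ℕ} {l : Fin n → ℝ} (hl : ∀ j, 0 < l j) {β : ℝ} (h0 : 0 ≤ β)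
    (hn : β < n) : ∃! lam : ℝ, 0 ≤ lam ∧ ∑ j, lam / (l j + lam) = β := by
  have hne : (Finset.univ : Finset (Fin n)).Nonempty := by
    rw [← Finset.card_pos, Finset.card_univ, Fintype.card_fin]
    exact_mod_cast lt_of_le_of_lt h0 hn
  have hmono : StrictMonoOn (fun x : ℝ => ∑ j, x / (l j + x)) (Set.Ici 0) := by
    intro x hx y hy hxy
    refine Finset.sum_lt_sum_of_nonempty hne fun j _ => ?_
    have hx' : (0 : ℝ) ≤ x := hx
    have hy' : (0 : ℝ) ≤ y := hy
    have := hl j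
    rw [div_lt_div_iff₀ (by linarith) (by linarith)]
    nlinarith
  have hcont : ContinuousOn (fun x : ℝ => ∑ j, x / (l j + x)) (Set.Ici 0) := by
    refine continuousOn_finsetSum _ fun j _ => ?_
    refine continuousOn_id.div (by fun_prop) fun x hx => ?_
    have hx' : (0 : ℝ) ≤ x := hx
    have := hl j
    positivity
  have hlim : Filter.Tendsto (fun x : ℝ => ∑ j, x / (l j + x)) Filter.atTop (nhds (n : ℝ)) := by
    have h1 : ∀ j : Fin n, Filter.Tendsto (fun x : ℝ => x / (l j + x)) Filter.atTop
        (nhds 1) := by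
      intro j
      have h2 : Filter.Tendsto (fun x : ℝ => 1 - l j / (l j + x)) Filter.atTop
          (nhds (1 - 0)) :=
        tendsto_const_nhds.sub
          ((Filter.tendsto_atTop_add_const_left _ _ Filter.tendsto_id).const_div_atTop _)
      rw [sub_zero] at h2
      refine h2.congr' ?_
      filter_upwards [Filter.eventually_ge_atTop 0] with x hx
      have := hl j
      field_simp
      ring
    simpa using tendsto_finsetSum Finset.univ fun j _ => h1 j
  obtain ⟨M, hM, hM0⟩ :=
    ((hlim.eventually (lt_mem_nhds hn)).and (Filter.eventually_ge_atTop 0)).exists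
  obtain ⟨x, hx, hxe⟩ := intermediate_value_Icc hM0 (hcont.mono fun y hy => hy.1)
    (show β ∈ Set.Icc _ _ from ⟨by simpa using h0, hM.le⟩)
  exact ⟨x, ⟨hx.1, hxe⟩, fun y hy => hmono.injOn hy.1 hx.1 (hy.2.trans hxe.symm)⟩

/-- The random quantity `λ̂_b`, as a function of `S`. -/
noncomputable def lamHat (n : ℕ) {p : ℕ} (b : Matrix (Fin p) (Fin p) ℝ → ℝ)
    (S : Matrix (Fin p) (Fin p) ℝ) : ℝ :=
  lamSol (eigDecomp n S).2 (b S)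

/-- The empirical Bayes estimator `p⁻¹ (S + λ̂_b I)`. -/
noncomputable def deltaEB (n : ℕ) {p : ℕ} (b : Matrix (Fin p) (Fin p) ℝ → ℝ)
    (S : Matrix (Fin p) (Fin p) ℝ) : Matrix (Fin p) (Fin p) ℝ :=
  (p : ℝ)⁻¹ • (S + lamHat n b S • (1 : Matrix (Fin p) (Fin p) ℝ))

/-- The shrinkage estimator `δ^EB(b) - p⁻¹ λ̂_b H Hᵗ`. -/
noncomputable def deltaSH (n : ℕ) {p : ℕ} (b : Matrix (Fin p) (Fin p) ℝ → ℝ)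
    (S : Matrix (Fin p) (Fin p) ℝ) : Matrix (Fin p) (Fin p) ℝ :=
  deltaEB n b S - ((p : ℝ)⁻¹ * lamHat n b S) • ((eigDecomp n S).1 * ((eigDecomp n S).1)ᵀ)

/-- The constant `c_* = 2 (n - 1) / (p - n + 1)`. -/
noncomputable def cStar (n p : ℕ) : ℝ := 2 * ((n : ℝ) - 1) / ((p : ℝ) - n + 1)

/-- The constant `b_* = c_* / (1 + c_*)`. -/
noncomputable def bStar (n p : ℕ) : ℝ := cStar n p / (1 + cStar n p)

end SteinCov

namespace SteinCov

open Filter Topology Set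
open scoped ENNReal

/-! ### Antitone weights against a derivative on a half-line. -/

section RealLine

variable {w w' h : ℝ → ℝ} {a : ℝ}

/-! In `p (L(δ^EB) - L(δ^SH))` only the term `λ̂ tr Σ⁻¹HHᵗ` involves `Σ`; the rest is `-p ∑ log (1 +
λ̂/ℓⱼ)`. A Stein–Haff inequality `E[λ̂ tr Σ⁻¹HHᵗ] ≤ (p-n+1) E[λ̂ ∑ 1/ℓⱼ]` trades that term for a
function of the eigenvalues. The bound `b ≤ b_*` forces `λ̂/ℓⱼ ≤ c_*`, and `log (1+y) > 2y/(y+2)`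
gives `(p-n+1) y < p log (1+y)` for `0 < y ≤ c_*`. Hence the risk difference is negative at every
`Σ` (`steinLoss_sub_add_haffTerm_neg`, `risk_interEst_lt`).

The Stein–Haff inequality is proved without differentiating `λ̂`. Write the data matrix as `X = AZ`
with `A² = Σ` and `Z` standard Gaussian. By `loewnerMass_mul_lintegral_gauss`, up to a finite
positive factor, a Gaussian integral is an integral over frames `Z` in a compact shell and positive
definite `N`, with weight `exp(-tr ZᵗZN/2) det N^((p-n-1)/2)`, evaluated at `X = T√N`, `T = AZ`.
Then `XXᵗ = TNTᵗ`, and moving `N` in the direction `(TᵗT)⁻¹` shifts all eigenvalues by a common `s`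
while `H` stays fixed (`isEigDecomp_line`).

On such a line the integrand is `h w'`. Here `w ≥ 0` is a multiple of the exponential times `det
N^((p-n+1)/2)`, vanishing where the line leaves the cone, and `h = λ̂/∏(ℓⱼ+s)`. The condition on the
partial derivatives makes `b` decrease along the shift, so `h` is antitone (`lamSol_div_prod_le`).
By the layer-cake formula `∫ h w' ≥ 0`: superlevel sets of `h` are initial segments, on which `w'`
has nonnegative total mass. Everything is phrased as "negative part ≤ positive part" for
`lintegral`, so Tonelli applies with no integrability to check.

For finite risk, the logarithms are bounded by `∑ ℓⱼ` and `(∏ ℓⱼ)^(-ε)/ε` with `ε = (p-n-1)/2 > 0`;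
this negative moment is finite because it exactly cancels the determinant in the weight. The lower
bound `C₀` keeps `λ̂` above a multiple of the smallest eigenvalue, which controls `log λ̂`. -/

theorem lintegral_neg_le_lintegral_add_of_hasDerivAt {c d : ℝ} (hcd : c ≤ d)
    (hw : ∀ s ∈ Icc c d, HasDerivAt w (w' s) s) (hc : ContinuousOn w' (Icc c d))
    (hd : 0 ≤ w d) :
    ∫⁻ s in Ioc c d, .ofReal (-w' s) ≤ (∫⁻ s in Ioc c d, .ofReal (w' s)) + .ofReal (w c) := by
  have hint : IntegrableOn w' (Ioc c d) :=
    (hc.integrableOn_Icc).mono_set Ioc_subset_Icc_self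
  have h1 : ∫ s in Ioc c d, w' s = w d - w c := by
    rw [← intervalIntegral.integral_of_le hcd]
    refine intervalIntegral.integral_eq_sub_of_hasDerivAt (fun s hs => hw s ?_) ?_
    · rwa [uIcc_of_le hcd] at hs
    · rwa [intervalIntegrable_iff_integrableOn_Ioc_of_le hcd]
  have hfin : ∀ f : ℝ → ℝ, IntegrableOn f (Ioc c d) →
      ∫⁻ s in Ioc c d, .ofReal (f s) ≠ ∞ := fun f hf =>
    (lt_of_le_of_lt (lintegral_mono fun s => Real.ofReal_le_enorm (f s)) hf.2).ne
  rw [integral_eq_lintegral_pos_part_sub_lintegral_neg_part hint] at h1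
  rw [← ENNReal.ofReal_toReal (hfin _ hint),
    ← ENNReal.ofReal_toReal (hfin (fun s => -w' s) hint.neg)]
  exact (ENNReal.ofReal_le_ofReal (by linarith)).trans ENNReal.ofReal_add_le

/-- Exhaust by compact intervals: on `[u, v]` the total mass of `w'` is `w v - w u ≥ -w u`, and `w u
→ 0` as `u ↓ a`. Neither part of `w'` need be integrable up to the ends. -/
theorem lintegral_neg_Ioo_le_of_hasDerivAt {R : ℝ} (hw : ∀ s ∈ Ioi a, HasDerivAt w (w' s) s)
    (hc : ContinuousOn w' (Ioi a)) (hm : Measurable w') (hpos : ∀ s ∈ Ioi a, 0 ≤ w s)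
    (hlim : Tendsto w (𝓝[>] a) (𝓝 0)) :
    ∫⁻ s in Ioo a R, .ofReal (-w' s) ≤ ∫⁻ s in Ioo a R, .ofReal (w' s) := by
  rcases le_or_gt R a with hR | hR
  · simp [Ioo_eq_empty_of_le hR]
  obtain ⟨u, -, huR, hu⟩ := exists_seq_strictAnti_tendsto' hR
  obtain ⟨v, -, hvR, hv⟩ := exists_seq_strictMono_tendsto' hR
  have hcov : AECover (volume.restrict (Ioo a R)) atTop fun k => Ioc (u k) (v k) :=
    aecover_Ioo_of_Ioc hu hv
  have hu' : Tendsto u atTop (𝓝[>] a) :=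
    tendsto_nhdsWithin_iff.2 ⟨hu, .of_forall fun k => (huR k).1⟩
  have h1 := hcov.lintegral_tendsto_of_countably_generated
    (f := fun s => ENNReal.ofReal (-w' s)) (by fun_prop)
  have h2 := hcov.lintegral_tendsto_of_countably_generated
    (f := fun s => ENNReal.ofReal (w' s)) (by fun_prop)
  have h3 : Tendsto (fun k => ENNReal.ofReal (w (u k))) atTop (𝓝 0) := by
    simpa using ENNReal.tendsto_ofReal (hlim.comp hu')
  have h4 := h2.add h3
  rw [add_zero] at h4
  refine le_of_tendsto_of_tendsto h1 h4 ?_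
  have hlt : ∀ᶠ k in atTop, u k < v k := hu.eventually_lt hv hR
  filter_upwards [hlt] with k hk
  have hsub : Ioc (u k) (v k) ⊆ Ioo a R := fun s hs =>
    ⟨(huR k).1.trans hs.1, hs.2.trans_lt (hvR k).2⟩
  have hsub' : Icc (u k) (v k) ⊆ Ioi a := fun s hs => (huR k).1.trans_le hs.1
  rw [Measure.restrict_restrict measurableSet_Ioc, inter_eq_left.2 hsub]
  exact lintegral_neg_le_lintegral_add_of_hasDerivAt hk.le (fun s hs => hw s (hsub' hs))
    (hc.mono hsub') (hpos _ (hvR k).1)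

theorem lintegral_neg_Ioi_le_of_hasDerivAt (hw : ∀ s ∈ Ioi a, HasDerivAt w (w' s) s)
    (hc : ContinuousOn w' (Ioi a)) (hm : Measurable w') (hpos : ∀ s ∈ Ioi a, 0 ≤ w s)
    (hlim : Tendsto w (𝓝[>] a) (𝓝 0)) :
    ∫⁻ s in Ioi a, .ofReal (-w' s) ≤ ∫⁻ s in Ioi a, .ofReal (w' s) := by
  have hcov : AECover (volume.restrict (Ioi a)) atTop fun k : ℕ => Iio (k : ℝ) :=
    aecover_Iio tendsto_natCast_atTop_atTop
  refine le_of_tendsto_of_tendsto'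
    (hcov.lintegral_tendsto_of_countably_generated
      (f := fun s => ENNReal.ofReal (-w' s)) (by fun_prop))
    (hcov.lintegral_tendsto_of_countably_generated
      (f := fun s => ENNReal.ofReal (w' s)) (by fun_prop)) fun k => ?_
  rw [Measure.restrict_restrict measurableSet_Iio, inter_comm, Ioi_inter_Iio]
  exact lintegral_neg_Ioo_le_of_hasDerivAt hw hc hm hpos hlim

/-- An initial segment of the half-line is, up to a null set, a bounded interval starting at `a` or
the whole half-line. Superlevel sets of antitone functions have this form. -/
theorem lintegral_neg_initialSegment_le_of_hasDerivAt
    (hw : ∀ s ∈ Ioi a, HasDerivAt w (w' s) s)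
    (hc : ContinuousOn w' (Ioi a)) (hm : Measurable w') (hpos : ∀ s ∈ Ioi a, 0 ≤ w s)
    (hlim : Tendsto w (𝓝[>] a) (𝓝 0)) {U : Set ℝ} (hU : U ⊆ Ioi a)
    (hU' : ∀ s ∈ U, Ioo a s ⊆ U) :
    ∫⁻ s in U, .ofReal (-w' s) ≤ ∫⁻ s in U, .ofReal (w' s) := by
  rcases U.eq_empty_or_nonempty with rfl | hne
  · simp
  by_cases hb : BddAbove U
  · have h1 : Ioo a (sSup U) ⊆ U := fun s hs => by
      obtain ⟨t, ht, hst⟩ := exists_lt_of_lt_csSup hne hs.2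
      exact hU' t ht ⟨hs.1, hst⟩
    have h2 : U ⊆ Ioc a (sSup U) := fun s hs => ⟨hU hs, le_csSup hb hs⟩
    have h3 : U =ᵐ[volume] Ioo a (sSup U) :=
      (h2.eventuallyLE.trans Ioo_ae_eq_Ioc.symm.le).antisymm h1.eventuallyLE
    rw [setLIntegral_congr h3, setLIntegral_congr h3]
    exact lintegral_neg_Ioo_le_of_hasDerivAt hw hc hm hpos hlim
  · have h1 : U = Ioi a := hU.antisymm fun s hs => by
      obtain ⟨t, ht, hst⟩ := not_bddAbove_iff.1 hb s
      exact hU' t ht ⟨hs, hst⟩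
    rw [h1]
    exact lintegral_neg_Ioi_le_of_hasDerivAt hw hc hm hpos hlim

/-- If `h ≥ 0` is antitone and `w ≥ 0` vanishes at the left end point, then the negative part of
`h * w'` has at most the mass of its positive part. -/
theorem lintegral_neg_antitone_mul_deriv_le
    (hw : ∀ s ∈ Ioi a, HasDerivAt w (w' s) s)
    (hc : ContinuousOn w' (Ioi a)) (hpos : ∀ s ∈ Ioi a, 0 ≤ w s)
    (hlim : Tendsto w (𝓝[>] a) (𝓝 0)) (hh : AntitoneOn h (Ioi a)) (h0 : ∀ s ∈ Ioi a, 0 ≤ h s) :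
    ∫⁻ s in Ioi a, .ofReal (-(h s * w' s)) ≤ ∫⁻ s in Ioi a, .ofReal (h s * w' s) := by
  -- Nothing is known off the half-line, so both functions are cut off there to become globally
  -- measurable; for `h` this comes from monotonicity alone.
  set f : ℝ → ℝ := (Ioi a).indicator w' with hf
  set k : ℝ → ℝ := (Ioi a).indicator h with hk
  have hfm : Measurable f := by
    have := hc.measurable_piecewise (continuousOn_const (c := (0 : ℝ))) measurableSet_Ioi
    rwa [show (Ioi a).piecewise w' (fun _ => 0) = f from piecewise_eq_indicator] at this
  have hk0 : ∀ s, 0 ≤ k s := indicator_nonneg h0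
  have hfw : ∀ s ∈ Ioi a, f s = w' s := fun s hs => indicator_of_mem hs _
  have hkh : ∀ s ∈ Ioi a, k s = h s := fun s hs => indicator_of_mem hs _
  have hkm : Measurable k := by
    refine measurable_of_Ioi fun y => ?_
    by_cases hy : y < 0
    · rw [show k ⁻¹' Ioi y = univ from eq_univ_of_forall fun s => hy.trans_le (hk0 s)]
      exact .univ
    refine OrdConnected.measurableSet ⟨fun s hs t ht u hu => ?_⟩
    have has : ∀ s ∈ k ⁻¹' Ioi y, s ∈ Ioi a := fun s hs => by
      by_contra hn
      exact hy (lt_of_lt_of_eq hs (indicator_of_notMem hn _))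
    have hua : u ∈ Ioi a := lt_of_lt_of_le (has s hs) hu.1
    change y < k u
    refine lt_of_lt_of_le ht ?_
    rw [hkh u hua, hkh t (has t ht)]
    exact hh hua (has t ht) hu.2
  -- Layer cake: `k s` is the length of `(0, k s)`, and Tonelli exchanges level and position.
  have hlayer : ∀ g : ℝ → ℝ, Measurable g →
      ∫⁻ s in Ioi a, .ofReal (k s * g s) =
        ∫⁻ y in Ioi 0, ∫⁻ s in {s | s ∈ Ioi a ∧ y < k s}, .ofReal (g s) := by
    intro g hg
    have h1 : ∀ s, ENNReal.ofReal (k s * g s) =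
        ∫⁻ y in Ioi (0 : ℝ), {y | y < k s}.indicator (fun _ => ENNReal.ofReal (g s)) y := by
      intro s
      rw [show {y | y < k s} = Iio (k s) from rfl, lintegral_indicator_const measurableSet_Iio,
        Measure.restrict_apply measurableSet_Iio, ENNReal.ofReal_mul (hk0 s), mul_comm]
      congr 1
      rw [show Iio (k s) ∩ Ioi 0 = Ioo 0 (k s) by ext y; simp [and_comm], Real.volume_Ioo,
        sub_zero]
    simp_rw [h1]
    rw [lintegral_lintegral_swap]
    · refine lintegral_congr fun y => ?_
      rw [show {s | s ∈ Ioi a ∧ y < k s} = {s | y < k s} ∩ Ioi a by ext; simp [and_comm],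
        ← Measure.restrict_restrict (measurableSet_lt measurable_const hkm),
        ← lintegral_indicator (measurableSet_lt measurable_const hkm)]
      rfl
    · refine Measurable.aemeasurable ?_
      exact (hg.ennreal_ofReal.comp measurable_fst).indicator
        (measurableSet_lt measurable_snd (hkm.comp measurable_fst))
  have e1 : ∫⁻ s in Ioi a, ENNReal.ofReal (-(h s * w' s)) =
      ∫⁻ s in Ioi a, .ofReal (k s * -f s) :=
    setLIntegral_congr_fun measurableSet_Ioi fun s hs => by
      simp only [hfw s hs, hkh s hs, mul_neg]
  have e2 : ∫⁻ s in Ioi a, ENNReal.ofReal (h s * w' s) =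
      ∫⁻ s in Ioi a, .ofReal (k s * f s) :=
    setLIntegral_congr_fun measurableSet_Ioi fun s hs => by
      simp only [hfw s hs, hkh s hs]
  rw [e1, e2, hlayer (fun s => -f s) hfm.neg, hlayer _ hfm]
  -- At each level `y` the superlevel set is an initial segment, so the unweighted inequality
  -- applies.
  refine lintegral_mono fun y => ?_
  refine lintegral_neg_initialSegment_le_of_hasDerivAt (a := a) (w := w) (w' := f)
    (fun s hs => by rw [hfw s hs]; exact hw s hs) (hc.congr hfw) hfm hpos hlim
    (fun s hs => hs.1) ?_
  rintro s ⟨hs, hys⟩ t ht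
  refine ⟨ht.1, hys.trans_le ?_⟩
  rw [hkh s hs, hkh t ht.1]
  exact hh ht.1 hs ht.2.le

end RealLine

/-! ### Integration along parallel lines; zero sets of polynomials. -/

section Lines

variable {V : Type*} [NormedAddCommGroup V] [NormedSpace ℝ V] [FiniteDimensional ℝ V]
  [MeasurableSpace V] [BorelSpace V] (μ : Measure V) [μ.IsAddHaarMeasure]

/-- A nonnegative integral over `V` as an average of integrals over lines. -/
theorem lintegral_eq_lintegral_lines (φ : V →L[ℝ] ℝ) {k : V} (hk : φ k = 1) {q : V → ℝ≥0∞}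
    (hq : Measurable q) :
    ∫⁻ v, q v ∂μ = ∫⁻ v, (Ioo (0 : ℝ) 1).indicator 1 (φ v) * (∫⁻ s : ℝ, q (v + s • k)) ∂μ := by
  have hη : Measurable ((Ioo (0 : ℝ) 1).indicator (1 : ℝ → ℝ≥0∞)) :=
    measurable_one.indicator measurableSet_Ioo
  have h1 : ∀ v, (Ioo (0 : ℝ) 1).indicator 1 (φ v) * ∫⁻ s : ℝ, q (v + s • k) =
      ∫⁻ s : ℝ, (Ioo (0 : ℝ) 1).indicator 1 (φ v) * q (v + s • k) := fun v =>
    (lintegral_const_mul _ (by fun_prop)).symm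
  simp_rw [h1]
  rw [lintegral_lintegral_swap (by fun_prop)]
  -- Translation invariance moves the shift from `q` to the cutoff, whose integral over `s` is then
  -- the length of `(0, 1)`, since `φ k = 1`.
  have h2 : ∀ s : ℝ, ∫⁻ v, (Ioo (0 : ℝ) 1).indicator 1 (φ v) * q (v + s • k) ∂μ =
      ∫⁻ v, (Ioo (0 : ℝ) 1).indicator 1 (φ v - s) * q v ∂μ := fun s => by
    rw [← lintegral_add_right_eq_self
      (fun v => (Ioo (0 : ℝ) 1).indicator (1 : ℝ → ℝ≥0∞) (φ v - s) * q v) (s • k)]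
    simp [hk]
  simp_rw [h2]
  rw [lintegral_lintegral_swap (by fun_prop)]
  refine lintegral_congr fun v => ?_
  rw [lintegral_mul_const _ (by fun_prop)]
  have h3 : ∫⁻ s : ℝ, (Ioo (0 : ℝ) 1).indicator (1 : ℝ → ℝ≥0∞) (φ v - s) = 1 := by
    rw [lintegral_sub_left_eq_self (fun s => (Ioo (0 : ℝ) 1).indicator (1 : ℝ → ℝ≥0∞) s) (φ v),
      lintegral_indicator_one measurableSet_Ioo]
    simp
  rw [h3, one_mul]

theorem lintegral_mono_of_lines {k : V} (hk : k ≠ 0) {q₁ q₂ : V → ℝ≥0∞}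
    (h₁ : Measurable q₁) (h₂ : Measurable q₂)
    (h : ∀ v, ∫⁻ s : ℝ, q₁ (v + s • k) ≤ ∫⁻ s : ℝ, q₂ (v + s • k)) :
    ∫⁻ v, q₁ v ∂μ ≤ ∫⁻ v, q₂ v ∂μ := by
  obtain ⟨φ, hφ⟩ := SeparatingDual.exists_eq_one (R := ℝ) hk
  rw [lintegral_eq_lintegral_lines μ φ hφ h₁, lintegral_eq_lintegral_lines μ φ hφ h₂]
  exact lintegral_mono fun v => mul_le_mul' le_rfl (h v)

open Polynomial in
/-- A function which is a polynomial along each line through a point where it does not vanish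
is almost everywhere nonzero. -/
theorem ae_ne_zero_of_polynomial_lines {f : V → ℝ} (hf : Measurable f) {x₀ : V} (hx₀ : f x₀ ≠ 0)
    (hpoly : ∀ y, ∃ q : ℝ[X], ∀ t, q.eval t = f (x₀ + t • y)) : ∀ᵐ x ∂μ, f x ≠ 0 := by
  set B : Set V := {y | f (x₀ + y) = 0} with hB
  have hBm : MeasurableSet B :=
    (measurableSet_singleton 0).preimage (hf.comp (measurable_const_add x₀))
  have hline : ∀ y, volume {t : ℝ | t • y ∈ B} = 0 := by
    intro y
    obtain ⟨q, hq⟩ := hpoly y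
    have hq0 : q ≠ 0 := by
      rintro rfl
      exact hx₀ (by simpa using (hq 0).symm)
    refine (Set.Finite.subset q.roots.toFinset.finite_toSet fun t ht => ?_).measure_zero _
    simp only [Finset.mem_coe, Multiset.mem_toFinset, mem_roots hq0, IsRoot.def, hq]
    exact ht
  -- By Tonelli, rays meeting `B` in null sets make almost all dilates of `B` null on average over
  -- `t`. Each dilate has measure at least `2^(-dim) μ B`, which forces `μ B = 0`.
  have hint : ∫⁻ t in Ioo (1 : ℝ) 2, μ ((fun y => t • y) ⁻¹' B) = 0 := by
    have h1 : ∀ t : ℝ, μ ((fun y => t • y) ⁻¹' B) = ∫⁻ y, B.indicator 1 (t • y) ∂μ := fun t => by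
      rw [← lintegral_indicator_one (hBm.preimage (measurable_const_smul t))]
      rfl
    simp_rw [h1]
    have hBi : Measurable (B.indicator (1 : V → ℝ≥0∞)) := measurable_one.indicator hBm
    rw [lintegral_lintegral_swap (by fun_prop)]
    refine (lintegral_congr fun y => ?_).trans lintegral_zero
    refine le_antisymm ?_ (zero_le)
    refine (setLIntegral_le_lintegral _ _).trans ?_
    have : (fun t : ℝ => B.indicator (1 : V → ℝ≥0∞) (t • y)) =
        {t : ℝ | t • y ∈ B}.indicator 1 := rfl
    rw [this, lintegral_indicator_one (s := {t : ℝ | t • y ∈ B})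
      (hBm.preimage (measurable_id.smul_const y)), hline]
  have hB0 : μ B = 0 := by
    have h1 : ∫⁻ _ in Ioo (1 : ℝ) 2, ENNReal.ofReal ((2 ^ Module.finrank ℝ V)⁻¹) * μ B ≤
        ∫⁻ t in Ioo (1 : ℝ) 2, μ ((fun y => t • y) ⁻¹' B) := by
      refine setLIntegral_mono' measurableSet_Ioo fun t ht => ?_
      have ht0 : 0 < t := by linarith [ht.1]
      rw [Measure.addHaar_preimage_smul μ ht0.ne', abs_of_pos (by positivity)]
      gcongr
      exact ht.2.le
    rw [hint, setLIntegral_const, Real.volume_Ioo] at h1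
    norm_num at h1
    exact h1
  have h1 : μ ((fun y => -x₀ + y) ⁻¹' B) = 0 := by rw [measure_preimage_add, hB0]
  rw [ae_iff]
  convert h1 using 2
  ext x
  simp [hB]

end Lines

/-! ### Lebesgue measure on matrices. -/

section MatrixMeasure

instance matrixMeasurableSpace (m n : Type*) : MeasurableSpace (Matrix m n ℝ) :=
  inferInstanceAs (MeasurableSpace (m → n → ℝ))

instance matrixBorelSpace (m n : Type*) [Fintype m] [Fintype n] : BorelSpace (Matrix m n ℝ) :=
  inferInstanceAs (BorelSpace (m → n → ℝ))

noncomputable instance matrixMeasureSpace (m n : Type*) [Fintype m] [Fintype n] :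
    MeasureSpace (Matrix m n ℝ) :=
  inferInstanceAs (MeasureSpace (m → n → ℝ))

instance matrixIsAddHaarMeasure (m n : Type*) [Fintype m] [Fintype n] :
    (volume : Measure (Matrix m n ℝ)).IsAddHaarMeasure :=
  Measure.pi.isAddHaarMeasure fun _ : m => (volume : Measure (n → ℝ))

instance matrixSigmaFinite (m n : Type*) [Fintype m] [Fintype n] :
    SigmaFinite (volume : Measure (Matrix m n ℝ)) :=
  inferInstanceAs (SigmaFinite (volume : Measure (m → n → ℝ)))

end MatrixMeasure

/-! ### Real positive definite matrices. -/

section RealPosDef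

variable {ι κ : Type*} [Fintype ι] [Fintype κ]

theorem posDef_real_iff {N : Matrix ι ι ℝ} :
    N.PosDef ↔ Nᵀ = N ∧ ∀ x : ι → ℝ, x ≠ 0 → 0 < x ⬝ᵥ N *ᵥ x := by
  simp [posDef_iff_dotProduct_mulVec, IsHermitian, conjTranspose_eq_transpose_of_trivial]

theorem posSemidef_real_iff {N : Matrix ι ι ℝ} :
    N.PosSemidef ↔ Nᵀ = N ∧ ∀ x : ι → ℝ, 0 ≤ x ⬝ᵥ N *ᵥ x := by
  simp [posSemidef_iff_dotProduct_mulVec, IsHermitian, conjTranspose_eq_transpose_of_trivial]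

theorem _root_.Matrix.PosDef.transpose_eq {N : Matrix ι ι ℝ} (hN : N.PosDef) : Nᵀ = N :=
  (posDef_real_iff.1 hN).1

variable [DecidableEq ι]

theorem posDef_conj_iff {g N : Matrix ι ι ℝ} (hg : IsUnit g) :
    (g * N * gᵀ).PosDef ↔ N.PosDef := by
  simpa [star_eq_conjTranspose, conjTranspose_eq_transpose_of_trivial] using
    Matrix.IsUnit.posDef_star_right_conjugate_iff (x := N) hg

theorem posSemidef_conj_iff {g N : Matrix ι ι ℝ} (hg : IsUnit g) :
    (g * N * gᵀ).PosSemidef ↔ N.PosSemidef := by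
  simpa [star_eq_conjTranspose, conjTranspose_eq_transpose_of_trivial] using
    Matrix.IsUnit.posSemidef_star_right_conjugate_iff (x := N) hg

open scoped MatrixOrder in
theorem _root_.Matrix.PosDef.exists_sqrt {N : Matrix ι ι ℝ} (hN : N.PosDef) :
    ∃ g : Matrix ι ι ℝ, g.PosDef ∧ N = g * g := by
  have h0 : (0 : Matrix ι ι ℝ) ≤ N := hN.posSemidef.nonneg
  refine ⟨CFC.sqrt N, ?_, (CFC.sqrt_mul_sqrt_self N h0).symm⟩
  exact (CFC.sqrt_nonneg N).posSemidef.posDef_iff_isUnit.2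
    ((CFC.isUnit_sqrt_iff N h0).2 hN.isUnit)

/-- Testing the form on `eᵢ ± eⱼ` gives `2|Nᵢⱼ| ≤ Nᵢᵢ + Nⱼⱼ`, and each diagonal entry is at most the
trace. -/
theorem _root_.Matrix.PosSemidef.abs_apply_le_trace {N : Matrix ι ι ℝ} (hN : N.PosSemidef)
    (i j : ι) : |N i j| ≤ N.trace := by
  obtain ⟨hsym, hq⟩ := posSemidef_real_iff.1 hN
  have hji : N j i = N i j := congrFun (congrFun hsym i) j
  have hdiag : ∀ k, 0 ≤ N k k := fun k => by simpa using hq (Pi.single k 1)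
  have hle : ∀ k, N k k ≤ N.trace := fun k =>
    Finset.single_le_sum (f := fun k => N k k) (fun k _ => hdiag k) (Finset.mem_univ k)
  have h1 := hq (Pi.single i 1 + Pi.single j 1)
  have h2 := hq (Pi.single i 1 - Pi.single j 1)
  simp only [mulVec_add, mulVec_sub, dotProduct_add, dotProduct_sub, add_dotProduct,
    sub_dotProduct, mulVec_single_one, single_one_dotProduct, col_apply] at h1 h2
  rw [abs_le]
  constructor <;> linarith [hle i, hle j]

/-- `N ↦ g N gᵗ` preserves the trace inequality `tr N ≤ tr (M N)` for `1 ≤ M`. -/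
theorem trace_le_trace_mul {M N : Matrix ι ι ℝ} (hM : (M - 1).PosSemidef) (hN : N.PosDef) :
    N.trace ≤ (M * N).trace := by
  obtain ⟨g, hg, rfl⟩ := hN.exists_sqrt
  have h1 := ((posSemidef_conj_iff hg.isUnit).2 hM).trace_nonneg
  rw [hg.transpose_eq] at h1
  rw [← mul_assoc, trace_mul_comm (M * g) g, ← mul_assoc]
  simp only [mul_sub, sub_mul, mul_one, trace_sub] at h1
  linarith

end RealPosDef

/-! ### Coordinates on symmetric matrices and the Jacobian of congruence. -/

section Sym

variable {n : ℕ}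

/-- The symmetric matrix with given entries. -/
def symMat (n : ℕ) : (Sym2 (Fin n) → ℝ) →ₗ[ℝ] Matrix (Fin n) (Fin n) ℝ where
  toFun v := .of fun i j => v s(i, j)
  map_add' _ _ := rfl
  map_smul' _ _ := rfl

/-- The entries of a symmetric matrix. -/
noncomputable def symVec (n : ℕ) : Matrix (Fin n) (Fin n) ℝ →ₗ[ℝ] (Sym2 (Fin n) → ℝ) where
  toFun N := Sym2.lift ⟨fun i j => (N i j + N j i) / 2, fun i j => by
    simp only [add_comm]⟩
  map_add' N M := by
    ext ⟨i, j⟩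
    simp
    ring
  map_smul' c N := by
    ext ⟨i, j⟩
    simp
    ring

@[simp] theorem symMat_apply (v : Sym2 (Fin n) → ℝ) (i j : Fin n) : symMat n v i j = v s(i, j) :=
  rfl

theorem symMat_transpose (v : Sym2 (Fin n) → ℝ) : (symMat n v)ᵀ = symMat n v := by
  ext i j
  simp [Sym2.eq_swap]

theorem symMat_symVec {N : Matrix (Fin n) (Fin n) ℝ} (hN : Nᵀ = N) :
    symMat n (symVec n N) = N := by
  ext i j
  have : N j i = N i j := congrFun (congrFun hN i) j
  simp [symVec, this]

theorem symMat_injective : Function.Injective (symMat n) := fun v w h => by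
  ext ⟨i, j⟩
  exact congrFun (congrFun h i) j

/-- The action `N ↦ g N gᵗ` on symmetric matrices. -/
noncomputable def symConj (g : Matrix (Fin n) (Fin n) ℝ) :
    (Sym2 (Fin n) → ℝ) →ₗ[ℝ] (Sym2 (Fin n) → ℝ) :=
  symVec n ∘ₗ (LinearMap.mulRight ℝ gᵀ ∘ₗ LinearMap.mulLeft ℝ g) ∘ₗ symMat n

theorem symMat_symConj (g : Matrix (Fin n) (Fin n) ℝ) (v : Sym2 (Fin n) → ℝ) :
    symMat n (symConj g v) = g * symMat n v * gᵀ := by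
  refine symMat_symVec ?_
  simp [symMat_transpose, mul_assoc]

theorem symConj_mul (g h : Matrix (Fin n) (Fin n) ℝ) :
    symConj (g * h) = symConj g ∘ₗ symConj h := by
  ext1 v
  refine LinearMap.ext fun x => symMat_injective ?_
  simp [symMat_symConj, mul_assoc]

theorem symConj_one : symConj (1 : Matrix (Fin n) (Fin n) ℝ) = LinearMap.id :=
  LinearMap.ext fun v => symMat_injective (by simp [symMat_symConj])

/-- Over ordered pairs, `i` is a first entry `n - i` times and a second entry `i + 1` times; the
diagonal pair counts in both. -/
theorem prod_sym2_mul (d : Fin n → ℝ) :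
    ∏ s : Sym2 (Fin n), (s.map d).mul = (∏ i, d i) ^ (n + 1) := by
  rw [← Equiv.prod_comp Sym2.sortEquiv.symm]
  have h1 : ∀ q : {q : Fin n × Fin n // q.1 ≤ q.2},
      ((Sym2.sortEquiv.symm q).map d).mul = d q.1.1 * d q.1.2 := fun q => rfl
  simp_rw [h1]
  rw [← Finset.prod_subtype (Finset.univ.filter fun q : Fin n × Fin n => q.1 ≤ q.2)
    (by simp) (fun q => d q.1 * d q.2), Finset.prod_mul_distrib]
  have h2 : ∀ f : Fin n × Fin n → ℝ,
      ∏ q ∈ Finset.univ.filter (fun q : Fin n × Fin n => q.1 ≤ q.2), f q =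
      ∏ i, ∏ j, if i ≤ j then f (i, j) else 1 := fun f => by
    rw [Finset.prod_filter, Fintype.prod_prod_type]
  rw [h2, h2, Finset.prod_comm (s := Finset.univ) (t := Finset.univ)
    (f := fun i j => if i ≤ j then d j else 1), ← Finset.prod_mul_distrib, ← Finset.prod_pow]
  refine Finset.prod_congr rfl fun i _ => ?_
  simp only [Finset.prod_ite, Finset.prod_const_one, mul_one, Finset.prod_const]
  rw [← pow_add]
  congr 1
  have h3 : (Finset.univ.filter fun j => i ≤ j) = Finset.Ici i := by ext; simp
  have h4 : (Finset.univ.filter fun j => j ≤ i) = Finset.Iic i := by ext; simp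
  rw [h3, h4, Fin.card_Ici, Fin.card_Iic]
  omega

theorem det_symConj_diagonal (d : Fin n → ℝ) :
    LinearMap.det (symConj (diagonal d)) = (∏ i, d i) ^ (n + 1) := by
  have h1 : symConj (diagonal d) = toLin' (diagonal fun s : Sym2 (Fin n) => (s.map d).mul) := by
    refine LinearMap.ext fun v => symMat_injective ?_
    rw [symMat_symConj]
    ext i j
    simp only [diagonal_transpose, mul_diagonal, diagonal_mul, symMat_apply,
      toLin'_apply, mulVec_diagonal, Sym2.map_mk, Sym2.mul_mk]
    ring
  rw [h1, LinearMap.det_toLin', det_diagonal, prod_sym2_mul]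

/-- Diagonalise `g`: congruences by the eigenvector matrix and its inverse have reciprocal
determinants, leaving the diagonal case. This is the Jacobian of `N ↦ gNgᵗ`. -/
theorem det_symConj {g : Matrix (Fin n) (Fin n) ℝ} (hg : g.IsHermitian) :
    LinearMap.det (symConj g) = g.det ^ (n + 1) := by
  set U : Matrix (Fin n) (Fin n) ℝ := (hg.eigenvectorUnitary : Matrix (Fin n) (Fin n) ℝ) with hU
  have hU1 : U * star U = 1 := Unitary.coe_mul_star_self _
  have h1 : g = U * diagonal hg.eigenvalues * star U := by
    conv_lhs => rw [hg.spectral_theorem, Unitary.conjStarAlgAut_apply]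
    rfl
  have h2 : LinearMap.det (symConj U) * LinearMap.det (symConj (star U)) = 1 := by
    rw [← LinearMap.det_comp, ← symConj_mul, hU1, symConj_one, LinearMap.det_id]
  have h3 : g.det = ∏ i, hg.eigenvalues i := by simpa using hg.det_eq_prod_eigenvalues
  rw [h3, ← det_symConj_diagonal]
  conv_lhs => rw [h1, symConj_mul, symConj_mul, LinearMap.det_comp, LinearMap.det_comp]
  rw [mul_right_comm, h2, one_mul]

theorem continuous_symMat : Continuous (symMat n) :=
  continuous_matrix fun i j => by simpa using continuous_apply s(i, j)

theorem isOpen_posDef {V : Type*} [TopologicalSpace V] {f : V → Matrix (Fin n) (Fin n) ℝ}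
    (hf : Continuous f) (hsym : ∀ v, (f v)ᵀ = f v) : IsOpen {v | (f v).PosDef} := by
  have h1 : {v | (f v).PosDef} =
      {v | ∀ x ∈ Metric.sphere (0 : Fin n → ℝ) 1, 0 < x ⬝ᵥ f v *ᵥ x} := by
    ext v
    rw [mem_ofPred_eq, posDef_real_iff]
    refine ⟨fun h x hx => h.2 x ?_, fun h => ⟨hsym v, fun x hx => ?_⟩⟩
    · rintro rfl
      simp at hx
    · have hn : 0 < ‖x‖ := norm_pos_iff.2 hx
      have h2 := h (‖x‖⁻¹ • x) (by simp [norm_smul, hn.ne'])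
      rw [mulVec_smul, smul_dotProduct, dotProduct_smul, smul_eq_mul, smul_eq_mul] at h2
      have := inv_pos.2 hn
      by_contra hc
      nlinarith [mul_pos this this]
  rw [h1, isOpen_iff_mem_nhds]
  intro v hv
  -- By compactness of the sphere, positivity near each point of it gives one neighbourhood of `v`
  -- valid for all unit vectors.
  refine (isCompact_sphere (0 : Fin n → ℝ) 1).eventually_forall_of_forall_eventually
    (P := fun v x => 0 < x ⬝ᵥ f v *ᵥ x) fun x hx => ?_
  have hc : Continuous fun z : V × (Fin n → ℝ) => z.2 ⬝ᵥ f z.1 *ᵥ z.2 := by fun_prop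
  exact hc.continuousAt.eventually (lt_mem_nhds (hv x hx))

theorem isClosed_posSemidef {V : Type*} [TopologicalSpace V] {f : V → Matrix (Fin n) (Fin n) ℝ}
    (hf : Continuous f) (hsym : ∀ v, (f v)ᵀ = f v) : IsClosed {v | (f v).PosSemidef} := by
  simp only [posSemidef_real_iff, hsym, true_and, ofPred_forall]
  exact isClosed_iInter fun x => isClosed_le continuous_const (by fun_prop)

end Sym

/-! ### Changes of variables and the invariant measure on the positive definite cone. -/

section Disintegration

theorem lintegral_comp_linearMap {E : Type*} [NormedAddCommGroup E] [NormedSpace ℝ E]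
    [MeasurableSpace E] [BorelSpace E] [FiniteDimensional ℝ E] (μ : Measure E)
    [μ.IsAddHaarMeasure] {f : E →ₗ[ℝ] E} (hf : 0 < LinearMap.det f) {F : E → ℝ≥0∞}
    (hF : Measurable F) :
    ∫⁻ x, F (f x) ∂μ = .ofReal (LinearMap.det f)⁻¹ * ∫⁻ x, F x ∂μ := by
  rw [← lintegral_map hF (LinearMap.continuous_of_finiteDimensional f).measurable,
    Measure.map_linearMap_addHaar_eq_smul_addHaar μ hf.ne', lintegral_smul_measure,
    abs_of_pos (inv_pos.2 hf), smul_eq_mul]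

variable {n p : ℕ}

theorem lintegral_symConj {g : Matrix (Fin n) (Fin n) ℝ} (hg : g.PosDef)
    {F : (Sym2 (Fin n) → ℝ) → ℝ≥0∞} (hF : Measurable F) :
    ∫⁻ v, F (symConj g v) = .ofReal (g.det ^ (n + 1))⁻¹ * ∫⁻ v, F v := by
  have h := det_symConj hg.1
  rw [← h]
  exact lintegral_comp_linearMap volume (by rw [h]; exact pow_pos hg.det_pos _) hF

theorem lintegral_mul_right {g : Matrix (Fin n) (Fin n) ℝ} (hg : g.PosDef)
    {F : Matrix (Fin p) (Fin n) ℝ → ℝ≥0∞} (hF : Measurable F) :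
    ∫⁻ Z : Matrix (Fin p) (Fin n) ℝ, F (Z * g) = .ofReal (g.det ^ p)⁻¹ * ∫⁻ Z, F Z := by
  -- Right multiplication acts on each of the `p` rows separately, whence the Jacobian `det g ^ p`.
  set f : (Fin p → Fin n → ℝ) →ₗ[ℝ] (Fin p → Fin n → ℝ) :=
    LinearMap.pi fun i => toLin' gᵀ ∘ₗ LinearMap.proj (φ := fun _ : Fin p => Fin n → ℝ) i with hf
  have hdet : LinearMap.det f = g.det ^ p :=
    (LinearMap.det_pi fun _ : Fin p => toLin' gᵀ).trans (by simp)
  have hfun : ∀ Z : Matrix (Fin p) (Fin n) ℝ, Z * g = f Z := fun Z => by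
    ext i j
    rw [Matrix.mul_apply_eq_vecMul, ← mulVec_transpose]
    rfl
  simp_rw [hfun]
  rw [← hdet]
  have : (volume : Measure (Fin p → Fin n → ℝ)).IsAddHaarMeasure := matrixIsAddHaarMeasure _ _
  exact lintegral_comp_linearMap (E := Fin p → Fin n → ℝ) volume
    (by rw [hdet]; exact pow_pos hg.det_pos _) hF

/-- The matrices `N` with `N ≤ M ≤ 2 N`. -/
def loewnerSet (M : Matrix (Fin n) (Fin n) ℝ) : Set (Sym2 (Fin n) → ℝ) :=
  {v | (M - symMat n v).PosSemidef ∧ ((2 : ℝ) • symMat n v - M).PosSemidef}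

theorem posDef_of_mem_loewnerSet {M : Matrix (Fin n) (Fin n) ℝ} (hM : M.PosDef)
    {v : Sym2 (Fin n) → ℝ} (hv : v ∈ loewnerSet M) : (symMat n v).PosDef := by
  have h := (hM.add_posSemidef hv.2).smul (show (0 : ℝ) < 1 / 2 by norm_num)
  rwa [add_sub_cancel, smul_smul, show (1 / 2 : ℝ) * 2 = 1 by norm_num, one_smul] at h

theorem isClosed_loewnerSet : IsClosed
    {q : Matrix (Fin p) (Fin n) ℝ × (Sym2 (Fin n) → ℝ) | q.2 ∈ loewnerSet (q.1ᵀ * q.1)} := by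
  have h := continuous_symMat (n := n)
  refine IsClosed.inter
    (isClosed_posSemidef (f := fun q : Matrix (Fin p) (Fin n) ℝ × (Sym2 (Fin n) → ℝ) =>
      q.1ᵀ * q.1 - symMat n q.2) (by fun_prop) fun q => ?_)
    (isClosed_posSemidef (f := fun q : Matrix (Fin p) (Fin n) ℝ × (Sym2 (Fin n) → ℝ) =>
      (2 : ℝ) • symMat n q.2 - q.1ᵀ * q.1) (by fun_prop) fun q => ?_) <;>
  simp [symMat_transpose]

theorem symConj_mem_loewnerSet_iff {g M : Matrix (Fin n) (Fin n) ℝ} (hg : IsUnit g)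
    (v : Sym2 (Fin n) → ℝ) : symConj g v ∈ loewnerSet (g * M * gᵀ) ↔ v ∈ loewnerSet M := by
  simp only [loewnerSet, mem_ofPred_eq, symMat_symConj]
  rw [← posSemidef_conj_iff hg (N := M - symMat n v),
    ← posSemidef_conj_iff hg (N := (2 : ℝ) • symMat n v - M)]
  simp only [mul_sub, sub_mul, mul_smul_comm, smul_mul_assoc]

/-- `N ≤ 1` bounds the trace by `n`, and the trace bounds every entry. -/
theorem isCompact_loewnerSet_one : IsCompact (loewnerSet (1 : Matrix (Fin n) (Fin n) ℝ)) := by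
  refine Metric.isCompact_of_isClosed_isBounded ?_ ?_
  · have h := continuous_symMat (n := n)
    refine IsClosed.inter
      (isClosed_posSemidef (f := fun v => 1 - symMat n v) (by fun_prop) fun q => ?_)
      (isClosed_posSemidef (f := fun v => (2 : ℝ) • symMat n v - 1) (by fun_prop) fun q => ?_) <;>
    simp [symMat_transpose]
  · refine (Metric.isBounded_closedBall (x := (0 : Sym2 (Fin n) → ℝ)) (r := n)).subset
      fun v hv => ?_
    rw [mem_closedBall_zero_iff, pi_norm_le_iff_of_nonneg (by positivity)]
    rintro ⟨i, j⟩
    refine ((posDef_of_mem_loewnerSet .one hv).posSemidef.abs_apply_le_trace i j).trans ?_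
    have := hv.1.trace_nonneg
    simpa using this

/-- The mass of `{N | N ≤ M ≤ 2 N}` for the invariant measure on positive definite matrices. -/
noncomputable def loewnerMass (M : Matrix (Fin n) (Fin n) ℝ) : ℝ≥0∞ :=
  ∫⁻ v in {v | (symMat n v).PosDef},
    (loewnerSet M).indicator (fun v => .ofReal ((symMat n v).det ^ (-(n + 1 : ℝ) / 2))) v

theorem measurableSet_posDef : MeasurableSet {v : Sym2 (Fin n) → ℝ | (symMat n v).PosDef} :=
  (isOpen_posDef continuous_symMat symMat_transpose).measurableSet

theorem measurable_det_symMat : Measurable fun v : Sym2 (Fin n) → ℝ => (symMat n v).det :=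
  (continuous_symMat.matrix_det).measurable

theorem measurableSet_loewnerSet (M : Matrix (Fin n) (Fin n) ℝ) (hM : Mᵀ = M) :
    MeasurableSet (loewnerSet M) := by
  have h := continuous_symMat (n := n)
  refine (IsClosed.inter
    (isClosed_posSemidef (f := fun v => M - symMat n v) (by fun_prop) fun q => ?_)
    (isClosed_posSemidef (f := fun v => (2 : ℝ) • symMat n v - M) (by fun_prop)
      fun q => ?_)).measurableSet <;>
  simp [symMat_transpose, hM]

/-- The measure `det N^(-(n+1)/2) dN` is invariant under congruence, and congruence by `√M` carries
the set for `1` onto the set for `M`. -/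
theorem loewnerMass_eq {M : Matrix (Fin n) (Fin n) ℝ} (hM : M.PosDef) :
    loewnerMass M = loewnerMass (1 : Matrix (Fin n) (Fin n) ℝ) := by
  obtain ⟨g, hg, rfl⟩ := hM.exists_sqrt
  have hd := hg.det_pos
  set F : Matrix (Fin n) (Fin n) ℝ → (Sym2 (Fin n) → ℝ) → ℝ≥0∞ := fun M =>
    {v | (symMat n v).PosDef}.indicator ((loewnerSet M).indicator
      fun v => .ofReal ((symMat n v).det ^ (-(n + 1 : ℝ) / 2))) with hF
  have hmass : ∀ M, loewnerMass M = ∫⁻ v, F M v := fun M =>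
    (lintegral_indicator measurableSet_posDef _).symm
  have hmeas : Measurable (F (g * g)) :=
    ((measurable_det_symMat.pow_const _).ennreal_ofReal.indicator
      (measurableSet_loewnerSet _ hM.transpose_eq)).indicator measurableSet_posDef
  have h1 := lintegral_symConj hg hmeas
  have h2 : ∀ v, F (g * g) (symConj g v) = .ofReal (g.det ^ (n + 1))⁻¹ * F 1 v := by
    intro v
    have e1 : (symMat n (symConj g v)).PosDef ↔ (symMat n v).PosDef := by
      rw [symMat_symConj, posDef_conj_iff hg.isUnit]
    have e2 : symConj g v ∈ loewnerSet (g * g) ↔ v ∈ loewnerSet 1 := by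
      rw [← symConj_mem_loewnerSet_iff hg.isUnit (M := 1), mul_one, hg.transpose_eq]
    by_cases hv : (symMat n v).PosDef
    · by_cases hv' : v ∈ loewnerSet 1
      · simp only [hF, indicator_of_mem (show symConj g v ∈ {v | (symMat n v).PosDef} from e1.2 hv),
          indicator_of_mem (show v ∈ {v | (symMat n v).PosDef} from hv),
          indicator_of_mem (e2.2 hv'), indicator_of_mem hv']
        rw [← ENNReal.ofReal_mul (by positivity), symMat_symConj, det_mul, det_mul, det_transpose]
        congr 1
        rw [Real.mul_rpow (mul_pos hd hv.det_pos).le hd.le, Real.mul_rpow hd.le hv.det_pos.le,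
          mul_right_comm, ← Real.rpow_add hd, ← Real.rpow_natCast, ← Real.rpow_neg hd.le]
        congr 2
        push_cast
        ring
      · simp only [hF, indicator_of_mem (show symConj g v ∈ {v | (symMat n v).PosDef} from e1.2 hv),
          indicator_of_mem (show v ∈ {v | (symMat n v).PosDef} from hv),
          indicator_of_notMem (mt e2.1 hv'), indicator_of_notMem hv', mul_zero]
    · simp [hF, hv, e1]
  simp_rw [h2] at h1
  rw [lintegral_const_mul'] at h1
  · rw [hmass, hmass]
    refine ((ENNReal.mul_right_inj ?_ ENNReal.ofReal_ne_top).1 h1).symm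
    simpa using pow_pos hd _
  · exact ENNReal.ofReal_ne_top

theorem loewnerMass_one_ne_top : loewnerMass (1 : Matrix (Fin n) (Fin n) ℝ) ≠ ∞ := by
  have hc : ContinuousOn (fun v => (symMat n v).det ^ (-(n + 1 : ℝ) / 2))
      (loewnerSet (1 : Matrix (Fin n) (Fin n) ℝ)) :=
    ContinuousOn.rpow_const continuous_symMat.matrix_det.continuousOn fun v hv =>
      .inl (posDef_of_mem_loewnerSet .one hv).det_pos.ne'
  have h1 := hc.integrableOn_compact (μ := volume) isCompact_loewnerSet_one
  refine ne_of_lt (lt_of_le_of_lt (setLIntegral_le_lintegral _ _) ?_)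
  rw [lintegral_indicator (measurableSet_loewnerSet _ transpose_one)]
  exact lt_of_le_of_lt (lintegral_mono fun s => Real.ofReal_le_enorm _) h1.2

theorem loewnerMass_one_ne_zero : loewnerMass (1 : Matrix (Fin n) (Fin n) ℝ) ≠ 0 := by
  have hcont := continuous_symMat (n := n)
  set U : Set (Sym2 (Fin n) → ℝ) :=
    {v | (1 - symMat n v).PosDef} ∩ {v | ((2 : ℝ) • symMat n v - 1).PosDef} with hU
  have hUo : IsOpen U :=
    (isOpen_posDef (by fun_prop) (by simp [symMat_transpose])).inter
      (isOpen_posDef (by fun_prop) (by simp [symMat_transpose]))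
  have hUne : U.Nonempty := by
    -- Any scalar strictly between `1/2` and `1` gives an interior point.
    refine ⟨symVec n ((3 / 4 : ℝ) • 1), ?_, ?_⟩
    · rw [mem_ofPred_eq, symMat_symVec (by simp)]
      have : (1 : Matrix (Fin n) (Fin n) ℝ) - (3 / 4 : ℝ) • 1 = (1 / 4 : ℝ) • 1 := by
        module
      rw [this]
      exact PosDef.one.smul (by norm_num)
    · rw [mem_ofPred_eq, symMat_symVec (by simp)]
      have : (2 : ℝ) • (3 / 4 : ℝ) • (1 : Matrix (Fin n) (Fin n) ℝ) - 1 = (1 / 2 : ℝ) • 1 := by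
        module
      rw [this]
      exact PosDef.one.smul (by norm_num)
  have hUs : U ⊆ loewnerSet 1 := fun v hv => ⟨hv.1.posSemidef, hv.2.posSemidef⟩
  intro h0
  rw [loewnerMass, lintegral_eq_zero_iff] at h0
  · rw [EventuallyEq, ae_restrict_iff' measurableSet_posDef, ae_iff] at h0
    refine (hUo.measure_pos volume hUne).ne' (measure_mono_null (fun v hv => ?_) h0)
    have hv' := posDef_of_mem_loewnerSet .one (hUs hv)
    simp only [mem_ofPred_eq, hv', forall_const, indicator_of_mem (hUs hv), Pi.zero_apply,
      ENNReal.ofReal_eq_zero, not_le]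
    exact Real.rpow_pos_of_pos hv'.det_pos _
  · exact (measurable_det_symMat.pow_const _).ennreal_ofReal.indicator
      (measurableSet_loewnerSet _ transpose_one)

end Disintegration

/-! ### Almost every sample has full rank and simple spectrum. -/

section Generic

variable {n p : ℕ}

/-- A polynomial in the entries of `X` whose nonvanishing forces `Xᵗ X` to be invertible with
simple spectrum. -/
def krylovDet {R : Type*} [CommRing R] (X : Matrix (Fin p) (Fin n) R) : R :=
  (Xᵀ * X).det * (Matrix.of fun i j : Fin n => ((Xᵀ * X) ^ (j : ℕ) *ᵥ 1) i).det

/-- Applied to evaluation `ℝ[X] → ℝ`, this shows that the function is polynomial along every line.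
-/
theorem krylovDet_map {R S : Type*} [CommRing R] [CommRing S] (f : R →+* S)
    (X : Matrix (Fin p) (Fin n) R) : f (krylovDet X) = krylovDet (X.map f) := by
  have h1 : (X.map f)ᵀ * X.map f = (Xᵀ * X).map f := by
    rw [Matrix.map_mul, transpose_map]
  rw [krylovDet, krylovDet, map_mul, RingHom.map_det, RingHom.map_det, h1]
  congr 2
  ext i j
  have h2 : (1 : Fin n → S) = f ∘ (1 : Fin n → R) := by
    ext
    simp
  have h3 : ((Xᵀ * X).map f) ^ (j : ℕ) = ((Xᵀ * X) ^ (j : ℕ)).map f :=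
    ((f.mapMatrix).map_pow (Xᵀ * X) j).symm
  rw [of_apply, h2, h3, ← RingHom.map_mulVec]
  rfl

/-- With columns `(j+1) eⱼ` the Gram matrix is diagonal with distinct entries, and the Krylov matrix
of the vector `1` becomes a Vandermonde matrix. -/
theorem exists_krylovDet_ne_zero (hnp : n ≤ p) :
    ∃ X : Matrix (Fin p) (Fin n) ℝ, krylovDet X ≠ 0 := by
  set X : Matrix (Fin p) (Fin n) ℝ :=
    .of fun i j => if i = Fin.castLE hnp j then (j : ℝ) + 1 else 0 with hX
  set d : Fin n → ℝ := fun j => ((j : ℝ) + 1) ^ 2 with hd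
  have h1 : Xᵀ * X = diagonal d := by
    ext i j
    simp only [hX, mul_apply, transpose_apply, of_apply, mul_ite, ite_mul, zero_mul, mul_zero,
      Finset.sum_ite_eq', Finset.mem_univ, if_true, diagonal_apply,
      (Fin.castLE_injective hnp).eq_iff]
    rcases eq_or_ne i j with rfl | hij
    · simp [hd, sq]
    · simp [hij, hij.symm]
  have h2 : (Matrix.of fun i j : Fin n => ((Xᵀ * X) ^ (j : ℕ) *ᵥ 1) i) = vandermonde d := by
    ext i j
    simp [h1, diagonal_pow, mulVec_diagonal, vandermonde_apply]
  refine ⟨X, ?_⟩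
  rw [krylovDet, h2, h1, det_diagonal]
  refine mul_ne_zero (Finset.prod_ne_zero_iff.2 fun i _ => ?_)
    (det_vandermonde_ne_zero_iff.2 fun i j hij => ?_)
  · simp only [hd]
    positivity
  · have h3 := (sq_eq_sq₀ (by positivity) (by positivity)).1 hij
    exact Fin.ext (by exact_mod_cast add_right_cancel h3)

theorem measurable_krylovDet :
    Measurable (krylovDet : Matrix (Fin p) (Fin n) ℝ → ℝ) := by
  refine Continuous.measurable ?_
  unfold krylovDet
  refine Continuous.mul (by fun_prop) (Continuous.matrix_det (continuous_matrix fun i j => ?_))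
  simp only [of_apply]
  fun_prop

open Polynomial in
-- A polynomial along every line through `A⁻¹X`, where it is nonzero, vanishes only on a null set.
theorem ae_krylovDet_ne_zero (hnp : n ≤ p) {A : Matrix (Fin p) (Fin p) ℝ} (hA : IsUnit A) :
    ∀ᵐ Z : Matrix (Fin p) (Fin n) ℝ, krylovDet (A * Z) ≠ 0 := by
  obtain ⟨X, hX⟩ := exists_krylovDet_ne_zero hnp
  have hm : Measurable fun Z : Matrix (Fin p) (Fin n) ℝ => krylovDet (A * Z) :=
    measurable_krylovDet.comp (Continuous.measurable (by fun_prop))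
  have : (volume : Measure (Fin p → Fin n → ℝ)).IsAddHaarMeasure := matrixIsAddHaarMeasure _ _
  refine ae_ne_zero_of_polynomial_lines (V := Fin p → Fin n → ℝ) volume hm
    (x₀ := (A⁻¹ * X : Matrix (Fin p) (Fin n) ℝ)) ?_ fun (Y : Matrix (Fin p) (Fin n) ℝ) => ?_
  · rwa [← Matrix.mul_assoc, mul_nonsing_inv _ ((isUnit_iff_isUnit_det A).1 hA), Matrix.one_mul]
  · refine ⟨krylovDet ((A * (A⁻¹ * X)).map C + (Polynomial.X : ℝ[X]) •
      (A * Y).map C), fun t => ?_⟩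
    change evalRingHom t _ = _
    rw [krylovDet_map]
    congr 1
    have : A * ((A⁻¹ * X : Matrix (Fin p) (Fin n) ℝ) + t • Y) =
      A * (A⁻¹ * X) + t • (A * Y) := by
      rw [Matrix.mul_add, Matrix.mul_smul]
    refine Eq.trans ?_ this.symm
    generalize A * (A⁻¹ * X) = B₁
    generalize A * Y = B₂
    ext i j
    simp
    exact mul_comm _ _

theorem posDef_of_krylovDet_ne_zero {X : Matrix (Fin p) (Fin n) ℝ} (hX : krylovDet X ≠ 0) :
    (Xᵀ * X).PosDef := by
  have h1 : (Xᵀ * X).PosSemidef := by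
    simpa [conjTranspose_eq_transpose_of_trivial] using posSemidef_conjTranspose_mul_self X
  exact h1.posDef_iff_det_ne_zero.2 (left_ne_zero_of_mul hX)

theorem ae_posDef_transpose_mul_self (hnp : n ≤ p) :
    ∀ᵐ Z : Matrix (Fin p) (Fin n) ℝ, (Zᵀ * Z).PosDef := by
  filter_upwards [ae_krylovDet_ne_zero hnp isUnit_one] with Z hZ
  rw [Matrix.one_mul] at hZ
  exact posDef_of_krylovDet_ne_zero hZ

end Generic

/-! ### Disintegration of the Gaussian weight. -/

section Disintegration

variable {n p : ℕ}

/-- The matrices `Z` with `1 ≤ Zᵗ Z ≤ 2`. -/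
def frameShell (p n : ℕ) : Set (Matrix (Fin p) (Fin n) ℝ) :=
  {Z | (Zᵀ * Z - 1).PosSemidef ∧ ((2 : ℝ) • 1 - Zᵀ * Z).PosSemidef}

theorem isClosed_frameShell : IsClosed (frameShell p n) := by
  refine IsClosed.inter
    (isClosed_posSemidef (f := fun Z : Matrix (Fin p) (Fin n) ℝ => Zᵀ * Z - 1)
      (by fun_prop) fun q => ?_)
    (isClosed_posSemidef (f := fun Z : Matrix (Fin p) (Fin n) ℝ => (2 : ℝ) • 1 - Zᵀ * Z)
      (by fun_prop) fun q => ?_) <;>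
  simp

theorem posDef_of_mem_frameShell {Z : Matrix (Fin p) (Fin n) ℝ} (hZ : Z ∈ frameShell p n) :
    (Zᵀ * Z).PosDef := by
  have := PosDef.one.add_posSemidef hZ.1
  rwa [add_sub_cancel] at this

/-- Congruence by `g = √N` turns `1 ≤ ZᵗZ ≤ 2` into `N ≤ (Zg)ᵗ(Zg) ≤ 2N`, so the shell becomes a
condition on `N` relative to the new variable `Zg`. -/
theorem mem_frameShell_iff {g : Matrix (Fin n) (Fin n) ℝ} (hg : g.PosDef)
    {v : Sym2 (Fin n) → ℝ} (hv : symMat n v = g * g) (Z : Matrix (Fin p) (Fin n) ℝ) :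
    Z ∈ frameShell p n ↔ v ∈ loewnerSet ((Z * g)ᵀ * (Z * g)) := by
  simp only [frameShell, loewnerSet, mem_ofPred_eq, hv]
  rw [← posSemidef_conj_iff hg.isUnit (N := Zᵀ * Z - 1),
    ← posSemidef_conj_iff hg.isUnit (N := (2 : ℝ) • 1 - Zᵀ * Z)]
  simp only [mul_sub, sub_mul, mul_smul_comm, smul_mul_assoc, transpose_mul, hg.transpose_eq,
    mul_one, Matrix.mul_assoc]

/-- Disintegration of the standard Gaussian weight along `Z ↦ Z √N`. -/
theorem loewnerMass_mul_lintegral_gauss (hnp : n ≤ p) {G : Matrix (Fin p) (Fin n) ℝ → ℝ≥0∞}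
    {G₂ : Matrix (Fin p) (Fin n) ℝ → (Sym2 (Fin n) → ℝ) → ℝ≥0∞} (hG : Measurable G)
    (hG₂ : Measurable (Function.uncurry G₂))
    (h : ∀ Z v g, g.PosDef → symMat n v = g * g → G₂ Z v = G (Z * g)) :
    loewnerMass (1 : Matrix (Fin n) (Fin n) ℝ) *
      ∫⁻ Z, .ofReal (Real.exp (-(Zᵀ * Z).trace / 2)) * G Z =
    ∫⁻ Z in frameShell p n, ∫⁻ v in {v | (symMat n v).PosDef},
      .ofReal (Real.exp (-(Zᵀ * Z * symMat n v).trace / 2) *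
        (symMat n v).det ^ (((p : ℝ) - n - 1) / 2)) * G₂ Z v := by
  have hcont := continuous_symMat (n := n)
  have hk : Measurable fun q : Matrix (Fin p) (Fin n) ℝ × (Sym2 (Fin n) → ℝ) =>
      ENNReal.ofReal (Real.exp (-(q.1ᵀ * q.1 * symMat n q.2).trace / 2) *
        (symMat n q.2).det ^ (((p : ℝ) - n - 1) / 2)) := by
    refine Measurable.ennreal_ofReal (Measurable.mul ?_ ?_)
    · exact Continuous.measurable (by fun_prop)
    · exact (measurable_det_symMat.comp measurable_snd).pow_const _
  have he : Measurable fun Z : Matrix (Fin p) (Fin n) ℝ =>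
      ENNReal.ofReal (Real.exp (-(Zᵀ * Z).trace / 2)) * G Z :=
    (Continuous.measurable (by fun_prop)).ennreal_ofReal.mul hG
  rw [lintegral_lintegral_swap (hk.mul hG₂).aemeasurable]
  -- For fixed `N = g²`, substitute `Z ↦ Zg`.
  have hstep : ∀ v ∈ {v : Sym2 (Fin n) → ℝ | (symMat n v).PosDef},
      ∫⁻ Z in frameShell p n, .ofReal (Real.exp (-(Zᵀ * Z * symMat n v).trace / 2) *
        (symMat n v).det ^ (((p : ℝ) - n - 1) / 2)) * G₂ Z v =
      ∫⁻ Z : Matrix (Fin p) (Fin n) ℝ, .ofReal (Real.exp (-(Zᵀ * Z).trace / 2)) * G Z *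
        (loewnerSet (Zᵀ * Z)).indicator
          (fun v => .ofReal ((symMat n v).det ^ (-(n + 1 : ℝ) / 2))) v := by
    intro v hv
    obtain ⟨g, hg, hvg⟩ := PosDef.exists_sqrt hv
    have hd := hg.det_pos
    have hD := PosDef.det_pos hv
    set S : Set (Matrix (Fin p) (Fin n) ℝ) := {Z | v ∈ loewnerSet (Zᵀ * Z)} with hS
    have hSm : MeasurableSet S :=
      ((isClosed_loewnerSet (p := p) (n := n)).preimage (Continuous.prodMk_left v)).measurableSet
    set H : Matrix (Fin p) (Fin n) ℝ → ℝ≥0∞ := S.indicator fun Z =>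
      .ofReal ((symMat n v).det ^ (((p : ℝ) - n - 1) / 2)) *
        (.ofReal (Real.exp (-(Zᵀ * Z).trace / 2)) * G Z) with hH
    have hHm : Measurable H := (he.const_mul _).indicator hSm
    have h1 : ∫⁻ Z in frameShell p n, .ofReal (Real.exp (-(Zᵀ * Z * symMat n v).trace / 2) *
        (symMat n v).det ^ (((p : ℝ) - n - 1) / 2)) * G₂ Z v =
        ∫⁻ Z : Matrix (Fin p) (Fin n) ℝ, H (Z * g) := by
      rw [← lintegral_indicator isClosed_frameShell.measurableSet]
      refine lintegral_congr fun Z => ?_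
      have h2 := mem_frameShell_iff hg hvg Z
      by_cases hZ : Z ∈ frameShell p n
      · have h3 : Zᵀ * Z * symMat n v = (Zᵀ * Z * g) * g := by rw [hvg, mul_assoc]
        rw [indicator_of_mem hZ, hH, indicator_of_mem (show Z * g ∈ S from h2.1 hZ),
          h Z v g hg hvg, h3, trace_mul_comm (Zᵀ * Z * g) g, transpose_mul, hg.transpose_eq,
          mul_comm (Real.exp _), ENNReal.ofReal_mul (Real.rpow_nonneg hD.le _)]
        simp only [mul_assoc, Matrix.mul_assoc]
      · rw [indicator_of_notMem hZ, hH, indicator_of_notMem (show Z * g ∉ S from mt h2.2 hZ)]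
    rw [h1, lintegral_mul_right hg hHm, ← lintegral_const_mul _ hHm]
    refine lintegral_congr fun Z => ?_
    by_cases hZ : v ∈ loewnerSet (Zᵀ * Z)
    · rw [hH, indicator_of_mem (show Z ∈ S from hZ), indicator_of_mem hZ, ← mul_assoc,
        ← ENNReal.ofReal_mul (by positivity), mul_comm (_ * G Z)]
      congr 2
      -- The Jacobian is `det N^(-p/2)`, and `(p-n-1)/2 - p/2 = -(n+1)/2` is the exponent of the
      -- invariant measure.
      rw [hvg, det_mul, Real.mul_rpow hd.le hd.le, Real.mul_rpow hd.le hd.le,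
        ← Real.rpow_add hd, ← Real.rpow_add hd, ← Real.rpow_natCast, ← Real.rpow_neg hd.le,
        ← Real.rpow_add hd]
      congr 1
      ring
    · rw [hH, indicator_of_notMem (show Z ∉ S from hZ), indicator_of_notMem hZ, mul_zero, mul_zero]
  -- After exchanging again, the inner integral is the invariant mass attached to `ZᵗZ`, which is
  -- the same constant for almost every `Z`.
  rw [setLIntegral_congr_fun measurableSet_posDef hstep, lintegral_lintegral_swap]
  · rw [← lintegral_const_mul _ he]
    refine lintegral_congr_ae ?_
    filter_upwards [ae_posDef_transpose_mul_self hnp] with Z hZ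
    have hm : Measurable ((loewnerSet (Zᵀ * Z)).indicator
        (fun v => ENNReal.ofReal ((symMat n v).det ^ (-(n + 1 : ℝ) / 2)))) :=
      (measurable_det_symMat.pow_const _).ennreal_ofReal.indicator
        (measurableSet_loewnerSet _ hZ.transpose_eq)
    rw [lintegral_const_mul _ hm, ← loewnerMass_eq hZ, mul_comm]
    rfl
  · refine Measurable.aemeasurable ((he.comp measurable_snd).mul ?_)
    have hset : MeasurableSet {q : (Sym2 (Fin n) → ℝ) × Matrix (Fin p) (Fin n) ℝ |
        q.1 ∈ loewnerSet (q.2ᵀ * q.2)} :=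
      ((isClosed_loewnerSet (p := p) (n := n)).preimage continuous_swap).measurableSet
    exact ((measurable_det_symMat.comp measurable_fst).pow_const _).ennreal_ofReal.indicator hset

end Disintegration

/-! ### The Gaussian sample as a random matrix. -/

section Law

theorem pi_gaussianReal_eq_withDensity (ι : Type*) [Fintype ι] :
    Measure.pi (fun _ : ι => gaussianReal 0 1) =
      (volume : Measure (ι → ℝ)).withDensity fun x => .ofReal (∏ i, gaussianPDFReal 0 1 (x i)) := by
  refine Measure.pi_eq fun s hs => ?_
  have hI : ∀ i, Integrable (gaussianPDFReal 0 1) (volume.restrict (s i)) := fun i =>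
    (integrable_gaussianPDFReal 0 1).restrict
  rw [withDensity_apply _ (.univ_pi hs), volume_pi, Measure.restrict_pi_pi,
    ← ofReal_integral_eq_lintegral_ofReal (Integrable.fintype_prod hI)
      (.of_forall fun x => Finset.prod_nonneg fun i _ => gaussianPDFReal_nonneg 0 1 _),
    integral_fintype_prod_eq_prod (fun _ : ι => gaussianPDFReal 0 1), ENNReal.ofReal_prod_of_nonneg]
  · exact Finset.prod_congr rfl fun i _ => (gaussianReal_apply_eq_integral 0 one_ne_zero _).symm
  · exact fun i _ => integral_nonneg fun x => gaussianPDFReal_nonneg 0 1 x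

variable {n p : ℕ}

/-- The sample as a matrix with columns the observations. -/
def dataMat (X : Fin n → EuclideanSpace ℝ (Fin p)) : Matrix (Fin p) (Fin n) ℝ :=
  .of fun i j => X j i

theorem measurable_dataMat :
    Measurable (dataMat : (Fin n → EuclideanSpace ℝ (Fin p)) → Matrix (Fin p) (Fin n) ℝ) :=
  measurable_pi_iff.2 fun i => measurable_pi_iff.2 fun j => by
    change Measurable fun X : Fin n → EuclideanSpace ℝ (Fin p) => X j i
    fun_prop

theorem scatter_eq (X : Fin n → EuclideanSpace ℝ (Fin p)) :
    scatter X = dataMat X * (dataMat X)ᵀ := by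
  ext i j
  simp [scatter, dataMat, mul_apply, Matrix.sum_apply, vecMulVec_apply]

/-- A matrix from the list of its entries. -/
def ofEntries (p n : ℕ) : (Fin n × Fin p → ℝ) ≃L[ℝ] Matrix (Fin p) (Fin n) ℝ where
  toFun y := .of fun i j => y (j, i)
  invFun Z := fun q => Z q.2 q.1
  map_add' _ _ := rfl
  map_smul' _ _ := rfl
  left_inv _ := rfl
  right_inv _ := rfl
  continuous_toFun := continuous_matrix fun i j => continuous_apply _
  continuous_invFun := continuous_pi fun q => by fun_prop

@[simp] theorem ofEntries_apply (y : Fin n × Fin p → ℝ) (i : Fin p) (j : Fin n) :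
    ofEntries p n y i j = y (j, i) := rfl

theorem prod_gaussianPDFReal (y : Fin n × Fin p → ℝ) :
    ∏ q, gaussianPDFReal 0 1 (y q) = ((√(2 * Real.pi))⁻¹) ^ Fintype.card (Fin n × Fin p) *
      Real.exp (-((ofEntries p n y)ᵀ * ofEntries p n y).trace / 2) := by
  have h1 : ((ofEntries p n y)ᵀ * ofEntries p n y).trace = ∑ q, y q ^ 2 := by
    simp [trace, mul_apply, Fintype.sum_prod_type, sq]
  simp_rw [h1, gaussianPDFReal_def]
  rw [Finset.prod_mul_distrib, Finset.prod_const, ← Real.exp_sum, Finset.card_univ]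
  simp [neg_div, Finset.sum_div, Finset.sum_neg_distrib]

open scoped MatrixOrder in
-- The sample is `√Σ` times a standard Gaussian matrix. The constant `c` absorbs the normalisation
-- of the density and the scale between two Haar measures; only `0 < c < ∞` matters for
-- inequalities, finiteness and null sets.
theorem exists_lintegral_sampleLaw (n : ℕ) {Sig : Matrix (Fin p) (Fin p) ℝ} (hSig : Sig.PosDef) :
    ∃ A : Matrix (Fin p) (Fin p) ℝ, A.PosDef ∧ Sig = A * A ∧ ∃ c : ℝ≥0∞, c ≠ 0 ∧ c ≠ ∞ ∧
      ∀ F : Matrix (Fin p) (Fin n) ℝ → ℝ≥0∞, Measurable F →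
        ∫⁻ X, F (dataMat X) ∂sampleLaw n Sig =
          c * ∫⁻ Z : Matrix (Fin p) (Fin n) ℝ,
            .ofReal (Real.exp (-(Zᵀ * Z).trace / 2)) * F (A * Z) := by
  have h0 : (0 : Matrix (Fin p) (Fin p) ℝ) ≤ Sig := hSig.posSemidef.nonneg
  have hA : (CFC.sqrt Sig).PosDef := (CFC.sqrt_nonneg Sig).posSemidef.posDef_iff_isUnit.2
    ((CFC.isUnit_sqrt_iff Sig h0).2 hSig.isUnit)
  refine ⟨CFC.sqrt Sig, hA, (CFC.sqrt_mul_sqrt_self Sig h0).symm, ?_⟩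
  set A := CFC.sqrt Sig
  set e := ofEntries p n
  have hem : Measurable e := e.continuous.measurable
  set γ : Measure (Fin n × Fin p → ℝ) := Measure.pi fun _ => gaussianReal 0 1 with hγ
  have hγlaw : γ.map (fun y j => WithLp.toLp 2 (A *ᵥ fun i => y (j, i))) = sampleLaw n Sig := by
    have h1 : γ.map (MeasurableEquiv.curry (Fin n) (Fin p) ℝ) =
        Measure.pi fun _ : Fin n => Measure.pi fun _ : Fin p => gaussianReal 0 1 := by
      have := Measure.infinitePi_map_curry fun (_ : Fin n) (_ : Fin p) => gaussianReal 0 1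
      simpa only [Measure.infinitePi_eq_pi] using this
    have h2 : multivariateGaussian 0 Sig = (Measure.pi fun _ : Fin p => gaussianReal 0 1).map
        fun z => WithLp.toLp 2 (A *ᵥ z) := by
      rw [multivariateGaussian, ← map_pi_eq_stdGaussian,
        Measure.map_map (by fun_prop) (by fun_prop)]
      congr 1
      ext1 z
      simp [A]
    have hm : Measurable fun z : Fin p → ℝ => WithLp.toLp 2 (A *ᵥ z) := by fun_prop
    rw [sampleLaw, h2]
    have : IsProbabilityMeasure ((Measure.pi fun _ : Fin p => gaussianReal 0 1).map
        fun z => WithLp.toLp 2 (A *ᵥ z)) := Measure.isProbabilityMeasure_map hm.aemeasurable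
    rw [← Measure.pi_map_pi fun _ => hm.aemeasurable, ← h1,
      Measure.map_map (by fun_prop) (MeasurableEquiv.measurable _)]
    rfl
  have hHaar : (Measure.map e (volume : Measure (Fin n × Fin p → ℝ))).IsAddHaarMeasure :=
    e.isAddHaarMeasure_map volume
  have : LocallyCompactSpace (Matrix (Fin p) (Fin n) ℝ) :=
    inferInstanceAs (LocallyCompactSpace (Fin p → Fin n → ℝ))
  have : SecondCountableTopology (Matrix (Fin p) (Fin n) ℝ) :=
    inferInstanceAs (SecondCountableTopology (Fin p → Fin n → ℝ))
  have hvol := Measure.isAddLeftInvariant_eq_smul (Measure.map e volume)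
    (volume : Measure (Matrix (Fin p) (Fin n) ℝ))
  have hc₀ := Measure.addHaarScalarFactor_pos_of_isAddHaarMeasure (Measure.map e volume)
    (volume : Measure (Matrix (Fin p) (Fin n) ℝ))
  set c₀ := Measure.addHaarScalarFactor (Measure.map e volume)
    (volume : Measure (Matrix (Fin p) (Fin n) ℝ))
  set k : ℝ := ((√(2 * Real.pi))⁻¹) ^ Fintype.card (Fin n × Fin p) with hk
  have hk0 : 0 < k := by positivity
  refine ⟨.ofReal k * c₀, ?_, ?_, fun F hF => ?_⟩
  · exact mul_ne_zero (by simpa using hk0) (by simpa using hc₀.ne')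
  · exact ENNReal.mul_ne_top ENNReal.ofReal_ne_top ENNReal.coe_ne_top
  have hAm : Measurable fun Z : Matrix (Fin p) (Fin n) ℝ => A * Z :=
    Continuous.measurable (by fun_prop)
  have hH : Measurable fun Z : Matrix (Fin p) (Fin n) ℝ =>
      ENNReal.ofReal (Real.exp (-(Zᵀ * Z).trace / 2)) * F (A * Z) :=
    (Continuous.measurable (by fun_prop)).ennreal_ofReal.mul (hF.comp hAm)
  have hdata : ∀ y : Fin n × Fin p → ℝ,
      dataMat (fun j => WithLp.toLp 2 (A *ᵥ fun i => y (j, i))) = A * e y := fun y => by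
    ext i j
    simp [dataMat, e, mulVec, dotProduct, mul_apply]
  have hd : Measurable fun y : Fin n × Fin p → ℝ =>
      ENNReal.ofReal (∏ q, gaussianPDFReal 0 1 (y q)) := by
    refine (Finset.measurable_prod _ fun q _ => ?_).ennreal_ofReal
    exact (measurable_gaussianPDFReal 0 1).comp (measurable_pi_apply q)
  rw [← hγlaw, lintegral_map (f := fun X => F (dataMat X)) (hF.comp measurable_dataMat)
    (by fun_prop)]
  simp_rw [hdata]
  rw [hγ, pi_gaussianReal_eq_withDensity,
    lintegral_withDensity_eq_lintegral_mul (g := fun y => F (A * e y)) _ hd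
      (hF.comp (hAm.comp hem)), mul_assoc,
    ← smul_eq_mul (c₀ : ℝ≥0∞), ← ENNReal.smul_def, ← lintegral_smul_measure, ← hvol,
    lintegral_map hH hem, ← lintegral_const_mul' _ _ ENNReal.ofReal_ne_top]
  refine lintegral_congr fun y => ?_
  simp only [Pi.mul_apply, prod_gaussianPDFReal]
  rw [ENNReal.ofReal_mul hk0.le, mul_assoc]

end Law

/-! ### Bounds and monotonicity for the root of the defining equation. -/

section LamSol

variable {n : ℕ} {l : Fin n → ℝ} {β : ℝ}

theorem lamSol_eq (hl : ∀ j, 0 < l j) (h0 : 0 ≤ β) (hn : β < n) {x : ℝ} (hx : 0 ≤ x)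
    (hxβ : ∑ j, x / (l j + x) = β) : lamSol l β = x := by
  obtain ⟨y, -, hy⟩ := existsUnique_lam hl h0 hn
  have h1 : {lam : ℝ | 0 ≤ lam ∧ ∑ j, lam / (l j + lam) = β} = {x} := by
    ext z
    refine ⟨fun hz => (hy z hz).trans (hy x ⟨hx, hxβ⟩).symm, ?_⟩
    rintro rfl
    exact ⟨hx, hxβ⟩
  rw [lamSol, h1, csInf_singleton]

theorem lamSol_spec (hl : ∀ j, 0 < l j) (h0 : 0 ≤ β) (hn : β < n) :
    0 ≤ lamSol l β ∧ ∑ j, lamSol l β / (l j + lamSol l β) = β := by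
  obtain ⟨y, hy, -⟩ := existsUnique_lam hl h0 hn
  rw [lamSol_eq hl h0 hn hy.1 hy.2]
  exact hy

theorem lamSol_pos (hl : ∀ j, 0 < l j) (h0 : 0 < β) (hn : β < n) : 0 < lamSol l β := by
  obtain ⟨h1, h2⟩ := lamSol_spec hl h0.le hn
  refine h1.lt_of_ne fun h => ?_
  rw [← h] at h2
  simp at h2
  exact h0.ne h2

theorem div_add_le_div_add {a x y : ℝ} (ha : 0 < a) (hx : 0 ≤ x) (hxy : x ≤ y) :
    x / (a + x) ≤ y / (a + y) := by
  rw [div_le_div_iff₀ (by linarith) (by linarith)]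
  nlinarith

theorem div_add_lt_div_add {a x y : ℝ} (ha : 0 < a) (hx : 0 ≤ x) (hxy : x < y) :
    x / (a + x) < y / (a + y) := by
  rw [div_lt_div_iff₀ (by linarith) (by linarith)]
  nlinarith

theorem lamSol_lt_iff (hl : ∀ j, 0 < l j) (h0 : 0 ≤ β) (hn : β < n) {x : ℝ} (hx : 0 ≤ x) :
    lamSol l β < x ↔ β < ∑ j, x / (l j + x) := by
  obtain ⟨h1, h2⟩ := lamSol_spec hl h0 hn
  constructor
  · intro h
    have : 0 < n := by exact_mod_cast h0.trans_lt hn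
    have hne : (Finset.univ : Finset (Fin n)).Nonempty := ⟨⟨0, this⟩, Finset.mem_univ _⟩
    conv_lhs => rw [← h2]
    exact Finset.sum_lt_sum_of_nonempty hne fun j _ => div_add_lt_div_add (hl j) h1 h
  · intro h
    by_contra hc
    rw [← h2] at h
    exact h.not_ge (Finset.sum_le_sum fun j _ => div_add_le_div_add (hl j) hx (not_lt.1 hc))

theorem lamSol_le_of_le (hl : ∀ j, 0 < l j) (h0 : 0 ≤ β) (hn : β < n) {x : ℝ} (hx : 0 ≤ x)
    (h : β ≤ ∑ j, x / (l j + x)) : lamSol l β ≤ x := by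
  obtain ⟨h1, h2⟩ := lamSol_spec hl h0 hn
  by_contra hc
  have : 0 < n := by exact_mod_cast h0.trans_lt hn
  have hne : (Finset.univ : Finset (Fin n)).Nonempty := ⟨⟨0, this⟩, Finset.mem_univ _⟩
  rw [← h2] at h
  exact h.not_gt (Finset.sum_lt_sum_of_nonempty hne fun j _ =>
    div_add_lt_div_add (hl j) hx (not_le.1 hc))

/-- One summand is at most the whole sum, and `x ↦ x/(1+x)` is increasing. With `c = c_*` this is
the role of `b_* = c_*/(1+c_*)`. -/
theorem lamSol_le_mul (hl : ∀ j, 0 < l j) (h0 : 0 ≤ β) (hn : β < n) {c : ℝ} (hc : 0 ≤ c)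
    (hβ : β ≤ c / (1 + c)) (i : Fin n) : lamSol l β ≤ c * l i := by
  obtain ⟨h1, h2⟩ := lamSol_spec hl h0 hn
  have h3 : lamSol l β / (l i + lamSol l β) ≤ c / (1 + c) := by
    refine le_trans ?_ (h2.trans_le hβ)
    exact Finset.single_le_sum (f := fun j => lamSol l β / (l j + lamSol l β))
      (fun j _ => div_nonneg h1 (by linarith [hl j])) (Finset.mem_univ i)
  rw [div_le_div_iff₀ (by linarith [hl i]) (by linarith)] at h3
  linarith

/-- Each summand is at most `λ/m`. This lower bound later controls `log λ̂`. -/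
theorem mul_le_lamSol (hl : ∀ j, 0 < l j) (h0 : 0 ≤ β) (hn : β < n) {m : ℝ} (hm : 0 < m)
    (hml : ∀ j, m ≤ l j) : β * m ≤ n * lamSol l β := by
  obtain ⟨h1, h2⟩ := lamSol_spec hl h0 hn
  have h3 : β ≤ ∑ _j : Fin n, lamSol l β / m := by
    conv_lhs => rw [← h2]
    refine Finset.sum_le_sum fun j _ => div_le_div_of_nonneg_left h1 hm ?_
    linarith [hml j]
  rw [Finset.sum_const, Finset.card_univ, Fintype.card_fin, nsmul_eq_mul, ← mul_div_assoc,
    le_div_iff₀ hm] at h3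
  exact h3

/-- If `β` decreases while the `ℓⱼ` increase by a common shift, then `lamSol / ∏ ℓⱼ` decreases. -/
theorem lamSol_div_prod_le {l' : Fin n → ℝ} {β' : ℝ} (hl : ∀ j, 0 < l j) (hll : ∀ j, l j ≤ l' j)
    (h0 : 0 ≤ β') (hβ : β' ≤ β) (hn : β < n) :
    lamSol l' β' / ∏ j, l' j ≤ lamSol l β / ∏ j, l j := by
  have hl' : ∀ j, 0 < l' j := fun j => (hl j).trans_le (hll j)
  obtain ⟨h1, h2⟩ := lamSol_spec hl (h0.trans hβ) hn
  have hP : 0 < ∏ j, l j := Finset.prod_pos fun j _ => hl j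
  have hP' : 0 < ∏ j, l' j := Finset.prod_pos fun j _ => hl' j
  rw [div_le_iff₀ hP', div_mul_eq_mul_div, mul_div_assoc, ← Finset.prod_div_distrib]
  set r := ∏ j, l' j / l j with hr
  -- All ratios are at least `1`, so their product `r` dominates each of them. Thus `l' ≤ r l`, the
  -- sum for `l'` at `r λ` is at least `β`, and the new root is at most `r λ`.
  have hr1 : ∀ i, l' i / l i ≤ r := fun i => by
    rw [hr, ← Finset.mul_prod_erase _ _ (Finset.mem_univ i)]
    refine le_mul_of_one_le_right (div_nonneg (hl' i).le (hl i).le) ?_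
    calc (1 : ℝ) = ∏ _j ∈ Finset.univ.erase i, (1 : ℝ) := by simp
      _ ≤ _ := Finset.prod_le_prod (fun _ _ => zero_le_one) fun j _ => (one_le_div (hl j)).2 (hll j)
  have hr0 : 0 ≤ r := Finset.prod_nonneg fun j _ => div_nonneg (hl' j).le (hl j).le
  refine lamSol_le_of_le hl' h0 (hβ.trans_lt hn) (mul_nonneg h1 hr0) (hβ.trans ?_)
  conv_lhs => rw [← h2]
  refine Finset.sum_le_sum fun j _ => ?_
  have h3 := (div_le_iff₀ (hl j)).1 (hr1 j)
  rw [div_le_div_iff₀ (by linarith [hl j]) (by have := hl' j; positivity)]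
  nlinarith

end LamSol

/-! ### Eigenvalue decompositions and lines of symmetric matrices. -/

section Decomposition

variable {n p : ℕ}

/-- The `p - n` null directions contribute `1` each. The sum in the equation for `λ̂` is thereby a
function of `S` alone, which yields both independence of the decomposition and measurability. -/
theorem IsEigDecomp.trace_resolvent {S : Matrix (Fin p) (Fin p) ℝ} {H : Matrix (Fin p) (Fin n) ℝ}
    {l : Fin n → ℝ} (h : IsEigDecomp S H l) {c : ℝ} (hc : 0 < c) :
    c * ((c • 1 + S)⁻¹).trace = p - n + ∑ j, c / (l j + c) := by
  have hpos := h.pos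
  have hHS : Hᵀ * (H * diagonal l * Hᵀ) = diagonal l * Hᵀ := by
    rw [← Matrix.mul_assoc, ← Matrix.mul_assoc, h.orthonormal, Matrix.one_mul]
  have h1 : (c • 1 + S) * (c⁻¹ • (1 - H * Hᵀ) + H * diagonal (fun j => (l j + c)⁻¹) * Hᵀ) = 1 := by
    have e1 : S * (H * Hᵀ) = S := by
      rw [h.eq]
      simp only [Matrix.mul_assoc]
      rw [← Matrix.mul_assoc Hᵀ H Hᵀ, h.orthonormal, Matrix.one_mul]
    have e2 : S * (H * diagonal (fun j => (l j + c)⁻¹) * Hᵀ) =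
        H * diagonal (fun j => l j * (l j + c)⁻¹) * Hᵀ := by
      rw [h.eq]
      simp only [Matrix.mul_assoc]
      rw [← Matrix.mul_assoc Hᵀ H, h.orthonormal, Matrix.one_mul, ← Matrix.mul_assoc (diagonal l),
        diagonal_mul_diagonal]
    have e3 : c • (H * diagonal (fun j => (l j + c)⁻¹) * Hᵀ) +
        H * diagonal (fun j => l j * (l j + c)⁻¹) * Hᵀ = H * Hᵀ := by
      rw [← Matrix.smul_mul, ← Matrix.mul_smul, ← Matrix.add_mul, ← Matrix.mul_add]
      have : c • diagonal (fun j => (l j + c)⁻¹) + diagonal (fun j => l j * (l j + c)⁻¹) =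
          (1 : Matrix (Fin n) (Fin n) ℝ) := by
        rw [← diagonal_smul, diagonal_add, ← diagonal_one]
        congr 1
        ext j
        have : l j + c ≠ 0 := by linarith [hpos j]
        simp only [Pi.smul_apply, smul_eq_mul]
        field_simp
        ring
      rw [this, Matrix.mul_one]
    rw [add_mul, mul_add, mul_add, e2, mul_smul_comm, mul_smul_comm, mul_sub, mul_sub, e1, mul_one,
      mul_one, sub_self, smul_zero, zero_add, smul_mul_assoc, smul_mul_assoc, one_mul, one_mul,
      add_assoc, e3, ← smul_sub, smul_smul, inv_mul_cancel₀ hc.ne', one_smul, sub_add_cancel]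
  rw [inv_eq_right_inv h1, trace_add, trace_smul, trace_sub, trace_mul_comm H, h.orthonormal,
    trace_one, trace_one, trace_mul_comm _ Hᵀ, ← Matrix.mul_assoc, h.orthonormal, Matrix.one_mul,
    trace_diagonal, smul_eq_mul, mul_add, mul_inv_cancel_left₀ hc.ne', Finset.mul_sum]
  simp [div_eq_mul_inv]

theorem isEigDecomp_eigDecomp {S : Matrix (Fin p) (Fin p) ℝ} (hS : S ∈ scatterDomain n p) :
    IsEigDecomp S (eigDecomp n S).1 (eigDecomp n S).2 := by
  obtain ⟨H, l, h⟩ := hS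
  have h' : ∃ d : Matrix (Fin p) (Fin n) ℝ × (Fin n → ℝ), IsEigDecomp S d.1 d.2 := ⟨(H, l), h⟩
  rw [eigDecomp, dif_pos h']
  exact h'.choose_spec

/-- Two decompositions of `S` give the same defining equation, by the resolvent trace, so any one of
them may be used in place of the chosen one. -/
theorem lamHat_eq {b : Matrix (Fin p) (Fin p) ℝ → ℝ} {S : Matrix (Fin p) (Fin p) ℝ}
    {H : Matrix (Fin p) (Fin n) ℝ} {l : Fin n → ℝ} (h : IsEigDecomp S H l) (h0 : 0 < b S)
    (hn : b S < n) : lamHat n b S = lamSol l (b S) := by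
  have h' := isEigDecomp_eigDecomp (n := n) ⟨H, l, h⟩
  have hpos := lamSol_pos h.pos h0 hn
  obtain ⟨h1, h2⟩ := lamSol_spec h.pos h0.le hn
  refine lamSol_eq h'.pos h0.le hn h1 ?_
  have e1 := h.trace_resolvent hpos
  have e2 := h'.trace_resolvent hpos
  linarith

/-- The coordinates of `T` in the frame `H`. -/
theorem IsEigDecomp.exists_coords {T : Matrix (Fin p) (Fin n) ℝ} {N : Matrix (Fin n) (Fin n) ℝ}
    {H : Matrix (Fin p) (Fin n) ℝ} {l : Fin n → ℝ} (h : IsEigDecomp (T * N * Tᵀ) H l)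
    (hT : (Tᵀ * T).PosDef) (hN : N.PosDef) :
    ∃ W : Matrix (Fin n) (Fin n) ℝ, IsUnit W ∧ T = H * W ∧ W * N * Wᵀ = diagonal l ∧
      W * (Tᵀ * T)⁻¹ * Wᵀ = 1 := by
  set W := Hᵀ * T with hW
  have e1 : H * Hᵀ * (T * N * Tᵀ) = T * N * Tᵀ := by
    rw [h.eq]
    simp only [Matrix.mul_assoc]
    rw [← Matrix.mul_assoc Hᵀ H, h.orthonormal, Matrix.one_mul]
  -- Cancelling this factor from `HHᵗ TN(TᵗT) = TN(TᵗT)` shows that `HHᵗ` fixes the columns of `T`.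
  have hu : IsUnit (N * (Tᵀ * T)) := hN.isUnit.mul hT.isUnit
  have hTW : T = H * W := by
    have e2 : H * W * (N * (Tᵀ * T)) = T * (N * (Tᵀ * T)) := by
      have := congrArg (· * T) e1
      simp only [Matrix.mul_assoc] at this
      rw [hW]
      simpa only [Matrix.mul_assoc] using this
    have e3 := congrArg (· * (N * (Tᵀ * T))⁻¹) e2
    simp only [Matrix.mul_assoc (H * W), Matrix.mul_assoc T] at e3
    rw [mul_nonsing_inv _ ((isUnit_iff_isUnit_det _).1 hu), Matrix.mul_one, Matrix.mul_one] at e3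
    exact e3.symm
  have hWW : Wᵀ * W = Tᵀ * T := by
    rw [hTW]
    clear_value W
    rw [transpose_mul, Matrix.mul_assoc, ← Matrix.mul_assoc Hᵀ, h.orthonormal, Matrix.one_mul]
  have hWu : IsUnit W := by
    have h1 : IsUnit (Wᵀ * W).det := (isUnit_iff_isUnit_det _).1 (hWW ▸ hT.isUnit)
    rw [det_mul, det_transpose] at h1
    exact (isUnit_iff_isUnit_det _).2 (isUnit_of_mul_isUnit_right h1)
  refine ⟨W, hWu, hTW, ?_, ?_⟩
  · have e4 : W * N * Wᵀ = Hᵀ * (T * N * Tᵀ) * H := by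
      rw [hW, transpose_mul, transpose_transpose]
      simp only [Matrix.mul_assoc]
    rw [e4, h.eq]
    simp only [Matrix.mul_assoc]
    rw [h.orthonormal, ← Matrix.mul_assoc Hᵀ H, h.orthonormal, Matrix.one_mul, Matrix.mul_one]
  · have hd := (isUnit_iff_isUnit_det _).1 hWu
    rw [← hWW, Matrix.mul_inv_rev, ← mul_assoc, mul_nonsing_inv _ hd, one_mul,
      nonsing_inv_mul _ (by rwa [det_transpose])]

/-- One congruence `W` takes `N` to `diag ℓ` and `(TᵗT)⁻¹` to the identity, so the whole line
becomes `diag (ℓ + s)` in the fixed frame `H`. -/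
theorem isEigDecomp_line {T : Matrix (Fin p) (Fin n) ℝ} {N : Matrix (Fin n) (Fin n) ℝ}
    {H : Matrix (Fin p) (Fin n) ℝ} {l : Fin n → ℝ} (h : IsEigDecomp (T * N * Tᵀ) H l)
    (hT : (Tᵀ * T).PosDef) (hN : N.PosDef) (s : ℝ) :
    ((N + s • (Tᵀ * T)⁻¹).PosDef ↔ ∀ j, 0 < l j + s) ∧
    (T * (N + s • (Tᵀ * T)⁻¹) * Tᵀ = H * diagonal (fun j => l j + s) * Hᵀ) ∧
    (N + s • (Tᵀ * T)⁻¹).det * (Tᵀ * T).det = ∏ j, (l j + s) ∧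
    ((∀ j, 0 < l j + s) →
      ((N + s • (Tᵀ * T)⁻¹)⁻¹ * (Tᵀ * T)⁻¹).trace = ∑ j, (l j + s)⁻¹) := by
  obtain ⟨W, hWu, hTW, hWN, hWK⟩ := h.exists_coords hT hN
  set K := (Tᵀ * T)⁻¹ with hK
  have hd := (isUnit_iff_isUnit_det _).1 hWu
  have e1 : W * (N + s • K) * Wᵀ = diagonal fun j => l j + s := by
    rw [mul_add, add_mul, hWN, mul_smul_comm, smul_mul_assoc, hWK, ← diagonal_one, ← diagonal_smul,
      diagonal_add]
    congr 1
    ext j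
    simp
  have hWd : W.det * W.det = (Tᵀ * T).det := by
    have h1 := congrArg Matrix.det hWK
    rw [det_mul, det_mul, det_transpose, hK, det_nonsing_inv, Ring.inverse_eq_inv', det_one] at h1
    have := hT.det_pos.ne'
    field_simp at h1
    linarith
  refine ⟨?_, ?_, ?_, fun hs => ?_⟩
  · rw [← posDef_conj_iff hWu, e1, posDef_diagonal_iff]
  · rw [← e1]
    conv_lhs => rw [hTW]
    rw [transpose_mul]
    simp only [Matrix.mul_assoc]
  · rw [← hWd, ← det_diagonal, ← e1, det_mul, det_mul, det_transpose]
    ring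
  · have e2 : (N + s • K)⁻¹ = Wᵀ * diagonal (fun j => (l j + s)⁻¹) * W := by
      have e3 : (diagonal fun j => l j + s) * diagonal (fun j => (l j + s)⁻¹) = 1 := by
        rw [diagonal_mul_diagonal, ← diagonal_one]
        congr 1
        ext j
        exact mul_inv_cancel₀ (hs j).ne'
      rw [← e1] at e3
      refine inv_eq_right_inv ?_
      have e4 : W * ((N + s • K) * (Wᵀ * diagonal (fun j => (l j + s)⁻¹) * W)) = W := by
        simp only [← mul_assoc] at e3 ⊢
        rw [e3, one_mul]
      have e5 := congrArg (W⁻¹ * ·) e4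
      simpa only [← mul_assoc, nonsing_inv_mul _ hd, one_mul] using e5
    rw [e2, mul_assoc _ W K, trace_mul_comm, ← mul_assoc (W * K), hWK, one_mul, trace_diagonal]

end Decomposition

/-! ### The domain of `S`, measurability of `λ̂`, and `b` along shifts. -/

section Domain

variable {n p : ℕ}

/-- A repeated eigenvalue has an eigenvector orthogonal to the vector `1`, hence orthogonal to every
`M^k 1`, so the Krylov matrix would be singular. -/
theorem eigenvalues_injective_of_krylovDet_ne_zero {X : Matrix (Fin p) (Fin n) ℝ}
    (hX : krylovDet X ≠ 0) (hM : (Xᵀ * X).IsHermitian) : Function.Injective hM.eigenvalues := by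
  intro i j hij
  by_contra hne
  set M := Xᵀ * X with hMdef
  set U : Matrix (Fin n) (Fin n) ℝ := (hM.eigenvectorUnitary : Matrix (Fin n) (Fin n) ℝ) with hU
  have hU2 : Uᵀ * U = 1 := by
    simpa [star_eq_conjTranspose, conjTranspose_eq_transpose_of_trivial] using
      Unitary.coe_star_mul_self hM.eigenvectorUnitary
  have hUM : M * U = U * diagonal hM.eigenvalues := by
    have h1 : M = U * diagonal hM.eigenvalues * Uᵀ := by
      conv_lhs => rw [hM.spectral_theorem, Unitary.conjStarAlgAut_apply]
      rfl
    calc M * U = U * diagonal hM.eigenvalues * Uᵀ * U := congrArg (· * U) h1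
      _ = _ := by rw [mul_assoc, hU2, mul_one]
  obtain ⟨w, hw0, hwd, hw1⟩ : ∃ w : Fin n → ℝ, w ≠ 0 ∧
      diagonal hM.eigenvalues *ᵥ w = hM.eigenvalues i • w ∧ (1 ᵥ* U) ⬝ᵥ w = 0 := by
    have hsingle : ∀ α β : ℝ, diagonal hM.eigenvalues *ᵥ (Pi.single i α + Pi.single j β) =
        hM.eigenvalues i • (Pi.single i α + Pi.single j β) := fun α β => by
      rw [mulVec_add, diagonal_mulVec_single, diagonal_mulVec_single, ← hij, smul_add,
        ← Pi.single_smul, ← Pi.single_smul, smul_eq_mul, smul_eq_mul]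
    -- Find a nonzero vector in the two-dimensional coordinate plane that is orthogonal to `Uᵗ1`.
    by_cases hs : (1 ᵥ* U) i = 0
    · refine ⟨Pi.single i 1 + Pi.single j 0, fun h => ?_, hsingle 1 0, ?_⟩
      · simpa using congrFun h i
      · simp [hs]
    · refine ⟨Pi.single i ((1 ᵥ* U) j) + Pi.single j (-(1 ᵥ* U) i), fun h => ?_, hsingle _ _, ?_⟩
      · have := congrFun h j
        simp [Ne.symm hne] at this
        exact hs this
      · simp
        ring
  have hMw : M *ᵥ (U *ᵥ w) = hM.eigenvalues i • (U *ᵥ w) := by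
    rw [mulVec_mulVec, hUM, ← mulVec_mulVec, hwd, mulVec_smul]
  have hpow : ∀ k : ℕ, M ^ k *ᵥ (U *ᵥ w) = hM.eigenvalues i ^ k • (U *ᵥ w) := fun k => by
    induction k with
    | zero => simp
    | succ k ih => rw [pow_succ, ← mulVec_mulVec, hMw, mulVec_smul, ih, smul_smul, pow_succ']
  have hMT : ∀ k : ℕ, (M ^ k)ᵀ = M ^ k := fun k => by
    rw [transpose_pow, hMdef, transpose_mul, transpose_transpose]
  refine right_ne_zero_of_mul hX (exists_vecMul_eq_zero_iff.1 ⟨U *ᵥ w, fun h => hw0 ?_, ?_⟩)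
  · have := congrArg (Uᵀ *ᵥ ·) h
    simpa [mulVec_mulVec, hU2] using this
  · ext k
    change (U *ᵥ w) ⬝ᵥ (M ^ (k : ℕ) *ᵥ 1) = 0
    rw [dotProduct_mulVec, ← mulVec_transpose, hMT, hpow, smul_dotProduct, dotProduct_comm,
      dotProduct_mulVec, hw1, smul_zero]

/-- Singular value decomposition: `H = X O L^(-1/2)`, where the columns of `O` are eigenvectors of
`XᵗX` in decreasing order of eigenvalue. -/
theorem mem_scatterDomain_of_krylovDet_ne_zero {X : Matrix (Fin p) (Fin n) ℝ}
    (hX : krylovDet X ≠ 0) : X * Xᵀ ∈ scatterDomain n p := by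
  have hMp := posDef_of_krylovDet_ne_zero hX
  have hM := hMp.1
  set σ := Tuple.sort fun i => -hM.eigenvalues i with hσ
  set l : Fin n → ℝ := fun i => hM.eigenvalues (σ i) with hl
  have hpos : ∀ i, 0 < l i := fun i => hMp.eigenvalues_pos _
  have hanti : StrictAnti l := by
    have h1 : Antitone l := fun i j hij => by
      have := Tuple.monotone_sort (fun i => -hM.eigenvalues i) hij
      simpa [← hσ] using this
    exact h1.strictAnti_of_injective
      ((eigenvalues_injective_of_krylovDet_ne_zero hX hM).comp σ.injective)
  set U : Matrix (Fin n) (Fin n) ℝ := (hM.eigenvectorUnitary : Matrix (Fin n) (Fin n) ℝ) with hU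
  have hU1 : U * Uᵀ = 1 := by
    simpa [star_eq_conjTranspose, conjTranspose_eq_transpose_of_trivial] using
      Unitary.coe_mul_star_self hM.eigenvectorUnitary
  have hU2 : Uᵀ * U = 1 := mul_eq_one_comm.1 hU1
  have hUM : Xᵀ * X = U * diagonal hM.eigenvalues * Uᵀ := by
    conv_lhs => rw [hM.spectral_theorem, Unitary.conjStarAlgAut_apply]
    rfl
  set O : Matrix (Fin n) (Fin n) ℝ := U.submatrix id σ with hO
  have hO1 : O * Oᵀ = 1 := by
    rw [hO, transpose_submatrix, submatrix_mul_equiv, hU1, submatrix_id_id]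
  have hO2 : Oᵀ * (Xᵀ * X) * O = diagonal l := by
    have h1 : Oᵀ * (Xᵀ * X) * O = (Uᵀ * (Xᵀ * X) * U).submatrix σ σ := by
      ext i j
      simp [hO, mul_apply]
    have h2 : Uᵀ * (Xᵀ * X) * U = diagonal hM.eigenvalues := by
      calc Uᵀ * (Xᵀ * X) * U = Uᵀ * (U * diagonal hM.eigenvalues * Uᵀ) * U :=
            congrArg (Uᵀ * · * U) hUM
        _ = _ := by rw [← mul_assoc, ← mul_assoc, hU2, one_mul, mul_assoc, hU2, mul_one]
    rw [h1, h2, submatrix_diagonal_equiv]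
    rfl
  set r : Fin n → ℝ := fun i => (√(l i))⁻¹ with hr
  have hr2 : ∀ i, r i * l i * r i = 1 := fun i => by
    have h1 := Real.mul_self_sqrt (hpos i).le
    have h2 : √(l i) ≠ 0 := (Real.sqrt_pos.2 (hpos i)).ne'
    simp only [hr]
    field_simp
    linarith
  refine ⟨X * O * diagonal r, l, ?_, hanti, hpos, ?_⟩
  · have h1 : (X * O * diagonal r)ᵀ * (X * O * diagonal r) =
        diagonal r * (Oᵀ * (Xᵀ * X) * O) * diagonal r := by
      simp only [transpose_mul, diagonal_transpose, Matrix.mul_assoc]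
    rw [h1, hO2, diagonal_mul_diagonal, diagonal_mul_diagonal, ← diagonal_one]
    congr 1
    ext i
    exact hr2 i
  · have h1 : X * O * diagonal r * diagonal l * (X * O * diagonal r)ᵀ =
        X * (O * (diagonal r * diagonal l * diagonal r) * Oᵀ) * Xᵀ := by
      simp only [transpose_mul, diagonal_transpose, Matrix.mul_assoc]
    have h2 : diagonal r * diagonal l * diagonal r = (1 : Matrix (Fin n) (Fin n) ℝ) := by
      rw [diagonal_mul_diagonal, diagonal_mul_diagonal, ← diagonal_one]
      congr 1
      ext i
      exact hr2 i
    rw [h1, h2, mul_one, hO1, Matrix.mul_one]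

/-- The admissible pairs `(H, ℓ)` form a locally closed, hence σ-compact, set; so does their
continuous image have a countable cover by compact subsets whose union is the image. -/
theorem measurableSet_scatterDomain : MeasurableSet (scatterDomain n p) := by
  set C : Set (Matrix (Fin p) (Fin n) ℝ × (Fin n → ℝ)) := {q | q.1ᵀ * q.1 = 1} with hC
  set U : Set (Matrix (Fin p) (Fin n) ℝ × (Fin n → ℝ)) :=
    {q | (∀ i j, i < j → q.2 j < q.2 i) ∧ ∀ i, 0 < q.2 i} with hU
  have hCc : IsClosed C := isClosed_eq (by fun_prop) continuous_const
  have hUo : IsOpen U := by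
    simp only [hU, ofPred_and, ofPred_forall]
    refine IsOpen.inter ?_ ?_
    · exact isOpen_iInter_of_finite fun i => isOpen_iInter_of_finite fun j =>
        isOpen_iInter_of_finite fun _ => isOpen_lt (by fun_prop) (by fun_prop)
    · exact isOpen_iInter_of_finite fun i => isOpen_lt (by fun_prop) (by fun_prop)
  have : LocallyCompactSpace (Matrix (Fin p) (Fin n) ℝ) :=
    inferInstanceAs (LocallyCompactSpace (Fin p → Fin n → ℝ))
  have : SecondCountableTopology (Matrix (Fin p) (Fin n) ℝ) :=
    inferInstanceAs (SecondCountableTopology (Fin p → Fin n → ℝ))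
  have hloc : IsLocallyClosed (U ∩ C) := ⟨U, C, hUo, hCc, rfl⟩
  have := hloc.locallyCompactSpace
  have hσ : IsSigmaCompact (U ∩ C) := isSigmaCompact_iff_sigmaCompactSpace.2 inferInstance
  have himg : scatterDomain n p = (fun q : Matrix (Fin p) (Fin n) ℝ × (Fin n → ℝ) =>
      q.1 * diagonal q.2 * q.1ᵀ) '' (U ∩ C) := by
    ext S
    constructor
    · rintro ⟨H, l, h⟩
      exact ⟨(H, l), ⟨⟨fun i j hij => h.strictAnti hij, h.pos⟩, h.orthonormal⟩, h.eq.symm⟩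
    · rintro ⟨⟨H, l⟩, ⟨⟨h1, h2⟩, h3⟩, rfl⟩
      exact ⟨H, l, h3, fun i j hij => h1 i j hij, h2, rfl⟩
  obtain ⟨K, hK, hKU⟩ := hσ.image (f := fun q : Matrix (Fin p) (Fin n) ℝ × (Fin n → ℝ) =>
      q.1 * diagonal q.2 * q.1ᵀ) (by fun_prop)
  rw [himg, ← hKU]
  exact .iUnion fun k => (hK k).isClosed.measurableSet

theorem measurable_matrix_inv : Measurable fun A : Matrix (Fin n) (Fin n) ℝ => A⁻¹ := by
  simp_rw [inv_def, Ring.inverse_eq_inv']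
  refine measurable_pi_iff.2 fun i => measurable_pi_iff.2 fun j => ?_
  have h1 : Measurable fun A : Matrix (Fin n) (Fin n) ℝ => A.det :=
    (continuous_id.matrix_det).measurable
  have h2 : Measurable fun A : Matrix (Fin n) (Fin n) ℝ => A.adjugate i j :=
    ((continuous_id.matrix_adjugate).matrix_elem i j).measurable
  exact h1.inv.mul h2

open scoped Classical in
-- By monotonicity `λ̂ < c` means `b(S) < ∑ c/(ℓⱼ+c)`, and the resolvent trace makes the right side
-- measurable in `S`. No measurable choice of eigenvectors is needed.
theorem measurable_lamHat {b : Matrix (Fin p) (Fin p) ℝ → ℝ}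
    (hb : ContinuousOn b (scatterDomain n p))
    (hb0 : ∀ S ∈ scatterDomain n p, 0 < b S) (hbn : ∀ S ∈ scatterDomain n p, b S < n) :
    Measurable ((scatterDomain n p).indicator (lamHat n b)) := by
  have hD := measurableSet_scatterDomain (n := n) (p := p)
  have hbm : Measurable ((scatterDomain n p).indicator b) := by
    have := hb.measurable_piecewise (continuousOn_const (c := (0 : ℝ))) hD
    rwa [show (scatterDomain n p).piecewise b (fun _ => 0) = (scatterDomain n p).indicator b from
      piecewise_eq_indicator] at this
  refine measurable_of_Iio fun c => ?_
  rcases le_or_gt c 0 with hc | hc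
  · convert MeasurableSet.empty
    refine eq_empty_of_forall_notMem fun S hS => ?_
    refine (lt_of_lt_of_le hS hc).not_ge (indicator_nonneg (fun S hS => ?_) S)
    obtain ⟨H, l, h⟩ := hS
    rw [lamHat_eq h (hb0 S ⟨H, l, h⟩) (hbn S ⟨H, l, h⟩)]
    exact (lamSol_pos h.pos (hb0 S ⟨H, l, h⟩) (hbn S ⟨H, l, h⟩)).le
  · have h1 : (scatterDomain n p).indicator (lamHat n b) ⁻¹' Iio c =
        (scatterDomain n p)ᶜ ∪ (scatterDomain n p ∩ {S | (scatterDomain n p).indicator b S <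
          c * ((c • 1 + S)⁻¹).trace - (p - n)}) := by
      ext S
      by_cases hS : S ∈ scatterDomain n p
      · obtain ⟨H, l, h⟩ := hS
        have hS : S ∈ scatterDomain n p := ⟨H, l, h⟩
        simp only [mem_preimage, indicator_of_mem hS, mem_Iio, mem_union, mem_compl_iff, hS,
          not_true_eq_false, mem_inter_iff, true_and, false_or, mem_ofPred_eq]
        rw [lamHat_eq h (hb0 S hS) (hbn S hS), lamSol_lt_iff h.pos (hb0 S hS).le (hbn S hS) hc.le,
          h.trace_resolvent hc, add_sub_cancel_left]
      · simp [hS, hc]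
    rw [h1]
    refine hD.compl.union (hD.inter (measurableSet_lt hbm ?_))
    have h2 : Measurable fun S : Matrix (Fin p) (Fin p) ℝ => (c • 1 + S)⁻¹ :=
      measurable_matrix_inv.comp (Continuous.measurable (by fun_prop))
    have h3 : Measurable fun A : Matrix (Fin p) (Fin p) ℝ => A.trace :=
      Continuous.measurable (by fun_prop)
    exact ((h3.comp h2).const_mul c).sub_const _

/-- Along the eigenvalue shift `ℓ + s` the function `b` decreases. -/
theorem antitoneOn_shift {b : Matrix (Fin p) (Fin p) ℝ → ℝ}
    (hb : DifferentiableOn ℝ b (scatterDomain n p))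
    (hderiv : ∀ (S : Matrix (Fin p) (Fin p) ℝ) (H : Matrix (Fin p) (Fin n) ℝ) (l : Fin n → ℝ),
      IsEigDecomp S H l → ∑ i, partialEig b H l i ≤ 0)
    {H : Matrix (Fin p) (Fin n) ℝ} {l : Fin n → ℝ} (hH : Hᵀ * H = 1) (hl : StrictAnti l) {a : ℝ}
    (ha : ∀ s ∈ Ioi a, ∀ j, 0 < l j + s) :
    AntitoneOn (fun s => b (H * diagonal (fun j => l j + s) * Hᵀ)) (Ioi a) := by
  set U : Set (Fin n → ℝ) := {m | (∀ i j, i < j → m j < m i) ∧ ∀ i, 0 < m i} with hU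
  have hUo : IsOpen U := by
    simp only [hU, ofPred_and, ofPred_forall]
    refine IsOpen.inter ?_ ?_
    · exact isOpen_iInter_of_finite fun i => isOpen_iInter_of_finite fun j =>
        isOpen_iInter_of_finite fun _ => isOpen_lt (by fun_prop) (by fun_prop)
    · exact isOpen_iInter_of_finite fun i => isOpen_lt (by fun_prop) (by fun_prop)
  have hdec : ∀ m ∈ U, IsEigDecomp (H * diagonal m * Hᵀ) H m := fun m hm =>
    ⟨hH, fun i j hij => hm.1 i j hij, hm.2, rfl⟩
  set g : (Fin n → ℝ) → ℝ := fun m => b (H * diagonal m * Hᵀ) with hg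
  -- Differentiability of `b` is only relative to the domain. The polynomial map `m ↦ H diag(m) Hᵗ`
  -- sends the open set `U` into it, so the composite is genuinely differentiable.
  have hgd : ∀ m ∈ U, DifferentiableAt ℝ g m := by
    intro m hm
    set f : (Fin n → ℝ) → (Fin p → Fin p → ℝ) :=
      fun m i j => (H * diagonal m * Hᵀ) i j with hf
    have hfd : Differentiable ℝ f := by
      refine differentiable_pi.2 fun i => differentiable_pi.2 fun j => ?_
      have : (fun m : Fin n → ℝ => f m i j) = fun m => ∑ k, H i k * m k * H j k := by
        ext m
        simp only [hf]
        rw [mul_apply]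
        simp [mul_diagonal]
      rw [this]
      fun_prop
    have hb' : DifferentiableOn ℝ (E := Fin p → Fin p → ℝ) b (scatterDomain n p) := hb
    have h1 : DifferentiableWithinAt ℝ (b ∘ f) U m :=
      (hb' (f m) ⟨H, m, hdec m hm⟩).comp m (hfd m).differentiableWithinAt
        fun m' hm' => ⟨H, m', hdec m' hm'⟩
    exact h1.differentiableAt (hUo.mem_nhds hm)
  have hmem : ∀ s ∈ Ioi a, (fun j => l j + s) ∈ U := fun s hs =>
    ⟨fun i j hij => by simpa using hl hij, ha s hs⟩
  have hder : ∀ s ∈ Ioi a, HasDerivAt (fun s => b (H * diagonal (fun j => l j + s) * Hᵀ))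
      (∑ i, partialEig b H (fun j => l j + s) i) s := by
    intro s hs
    set m : Fin n → ℝ := fun j => l j + s with hm
    have hF := (hgd m (hmem s hs)).hasFDerivAt
    have h1 : HasDerivAt (fun s j => l j + s : ℝ → Fin n → ℝ) (fun _ => 1) s :=
      hasDerivAt_pi.2 fun j => (hasDerivAt_id s).const_add (l j)
    have h2 := hF.comp_hasDerivAt s h1
    have h3 : ∀ i, partialEig b H m i = fderiv ℝ g m (Pi.single i 1) := fun i => by
      have h4 := hasDerivAt_update m i (m i)
      have h5 : HasFDerivAt g (fderiv ℝ g m) (Function.update m i (m i)) := by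
        rwa [Function.update_eq_self]
      exact (h5.comp_hasDerivAt (m i) h4).deriv
    -- The sum of the partial derivatives is the derivative in the direction `(1, …, 1)` of the
    -- shift.
    have h6 : ∑ i, partialEig b H m i = fderiv ℝ g m fun _ => 1 := by
      rw [Finset.sum_congr rfl fun i _ => h3 i, ← map_sum]
      congr 1
      ext j
      simp [Finset.sum_apply, Pi.single_apply]
    rw [h6]
    exact h2
  refine antitoneOn_of_deriv_nonpos (convex_Ioi a)
    (fun s hs => (hder s hs).continuousAt.continuousWithinAt) ?_ ?_
  · rw [interior_Ioi]
    exact fun s hs => (hder s hs).differentiableAt.differentiableWithinAt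
  · rw [interior_Ioi]
    intro s hs
    rw [(hder s hs).deriv]
    exact hderiv _ H _ (hdec _ (hmem s hs))

end Domain

/-! ### The Stein–Haff inequality on a line. -/

section Haff

variable {n p : ℕ}

theorem hasDerivAt_prod_shift (l : Fin n → ℝ) {s : ℝ} (hs : ∀ j, 0 < l j + s) :
    HasDerivAt (fun s => ∏ j, (l j + s)) ((∏ j, (l j + s)) * ∑ j, (l j + s)⁻¹) s := by
  have h1 : HasDerivAt (fun s => ∏ j, (l j + s))
      (∑ i, (∏ j ∈ Finset.univ.erase i, (l j + s)) • (1 : ℝ)) s :=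
    HasDerivAt.fun_finsetProd fun j _ => (hasDerivAt_id s).const_add (l j)
  convert h1 using 1
  rw [Finset.mul_sum]
  refine Finset.sum_congr rfl fun i _ => ?_
  rw [← Finset.mul_prod_erase _ _ (Finset.mem_univ i), smul_eq_mul, mul_one]
  have := (hs i).ne'
  field_simp

/-- The one-dimensional inequality along an eigenvalue shift. -/
theorem lintegral_neg_shift_le {l : Fin n → ℝ} {a : ℝ} (ha : ∀ s, (∀ j, 0 < l j + s) ↔ a < s)
    (ha0 : ∃ j, l j + a = 0) {α β κ d : ℝ} (hκ : 0 < κ) (hd : 0 < d) {h : ℝ → ℝ}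
    (hh : AntitoneOn h (Ioi a)) (h0 : ∀ s ∈ Ioi a, 0 ≤ h s) :
    ∫⁻ s in Ioi a, .ofReal (-(h s * (Real.exp (-(α + s * β) / 2) *
        ((∏ j, (l j + s)) / d) ^ (κ - 1) *
        ((∏ j, (l j + s)) * (2 * κ * ∑ j, (l j + s)⁻¹ - β))))) ≤
    ∫⁻ s in Ioi a, .ofReal (h s * (Real.exp (-(α + s * β) / 2) *
        ((∏ j, (l j + s)) / d) ^ (κ - 1) *
        ((∏ j, (l j + s)) * (2 * κ * ∑ j, (l j + s)⁻¹ - β)))) := by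
  have hpos : ∀ s ∈ Ioi a, 0 < ∏ j, (l j + s) := fun s hs =>
    Finset.prod_pos fun j _ => (ha s).2 hs j
  have hPc : Continuous fun s => ∏ j, (l j + s) := by fun_prop
  -- Chosen so that `w'` is the factor multiplying `h`. Raising the exponent to `κ` makes `w` vanish
  -- at `a`, since `κ > 0`.
  set w : ℝ → ℝ := fun s =>
    2 * d * (Real.exp (-(α + s * β) / 2) * ((∏ j, (l j + s)) / d) ^ κ) with hw
  refine lintegral_neg_antitone_mul_deriv_le (w := w) (fun s hs => ?_) ?_ (fun s hs => ?_) ?_ hh h0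
  · have hP := hpos s hs
    have h1 : HasDerivAt (fun s => Real.exp (-(α + s * β) / 2))
        (Real.exp (-(α + s * β) / 2) * (-β / 2)) s := by
      refine HasDerivAt.exp ?_
      simpa using ((((hasDerivAt_id s).mul_const β).const_add α).fun_neg).div_const 2
    have h2 := ((hasDerivAt_prod_shift l ((ha s).2 hs)).div_const d).rpow_const
      (p := κ) (.inl (div_pos hP hd).ne')
    have h3 := (h1.mul h2).const_mul (2 * d)
    refine h3.congr_deriv ?_
    rw [show ((∏ j, (l j + s)) / d) ^ κ =
        ((∏ j, (l j + s)) / d) ^ (κ - 1) * ((∏ j, (l j + s)) / d) by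
      rw [← Real.rpow_add_one (div_pos hP hd).ne', sub_add_cancel]]
    field_simp
    ring
  · refine ContinuousOn.mul (ContinuousOn.mul (by fun_prop) ?_) (hPc.continuousOn.mul ?_)
    · exact ContinuousOn.rpow_const (by fun_prop) fun s hs => .inl (div_pos (hpos s hs) hd).ne'
    · refine (continuousOn_const.mul (continuousOn_finsetSum _ fun j _ => ?_)).sub
        continuousOn_const
      exact ContinuousOn.inv₀ (by fun_prop) fun s hs => ((ha s).2 hs j).ne'
  · have := hpos s hs
    positivity
  · have hc : Continuous w := by
      have h1 : Continuous fun s => ((∏ j, (l j + s)) / d) ^ κ :=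
        Continuous.rpow_const (by fun_prop) fun s => .inr hκ.le
      fun_prop
    obtain ⟨j, hj⟩ := ha0
    have h1 : w a = 0 := by
      have h2 : ∏ j, (l j + a) = 0 := Finset.prod_eq_zero (Finset.mem_univ j) hj
      simp [hw, h2, Real.zero_rpow hκ.ne']
    rw [← h1]
    exact hc.continuousAt.tendsto.mono_left nhdsWithin_le_nhds

theorem exists_shift_bound [NeZero n] (l : Fin n → ℝ) :
    ∃ a, (∀ s, (∀ j, 0 < l j + s) ↔ a < s) ∧ ∃ j, l j + a = 0 := by
  obtain ⟨j, hj⟩ := Finite.exists_min l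
  refine ⟨-l j, fun s => ⟨fun h => by linarith [h j], fun h i => by linarith [hj i]⟩, j, by simp⟩

/-- The integrand of the Stein-Haff inequality. -/
noncomputable def haffTerm (b : Matrix (Fin p) (Fin p) ℝ → ℝ) (Sig : Matrix (Fin p) (Fin p) ℝ)
    (X : Matrix (Fin p) (Fin n) ℝ) : ℝ :=
  (scatterDomain n p).indicator (lamHat n b) (X * Xᵀ) *
    (((p : ℝ) - n + 1) * ((Xᵀ * X)⁻¹).trace - (Sig⁻¹ * (X * (Xᵀ * X)⁻¹ * Xᵀ)).trace)

variable {b : Matrix (Fin p) (Fin p) ℝ → ℝ} {T : Matrix (Fin p) (Fin n) ℝ}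

/-- The Stein-Haff integrand inequality along a line of symmetric matrices. -/
theorem lintegral_neg_line_le [NeZero n] (hnp : n ≤ p)
    (hb : DifferentiableOn ℝ b (scatterDomain n p))
    (hb0 : ∀ S ∈ scatterDomain n p, 0 < b S) (hbn : ∀ S ∈ scatterDomain n p, b S < n)
    (hderiv : ∀ (S : Matrix (Fin p) (Fin p) ℝ) (H : Matrix (Fin p) (Fin n) ℝ) (l : Fin n → ℝ),
      IsEigDecomp S H l → ∑ i, partialEig b H l i ≤ 0)
    (hT : (Tᵀ * T).PosDef) (B : Matrix (Fin n) (Fin n) ℝ) {q : ℝ → Matrix (Fin n) (Fin n) ℝ → ℝ}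
    (hq : ∀ ε N, q ε N = ε * (Real.exp (-(B * N).trace / 2) *
      N.det ^ (((p : ℝ) - n - 1) / 2) *
      ((scatterDomain n p).indicator (lamHat n b) (T * N * Tᵀ) *
        (((p : ℝ) - n + 1) * (N⁻¹ * (Tᵀ * T)⁻¹).trace - (B * (Tᵀ * T)⁻¹).trace))))
    (N : Matrix (Fin n) (Fin n) ℝ) :
    ∫⁻ s : ℝ, {N : Matrix (Fin n) (Fin n) ℝ | N.PosDef}.indicator (fun N => .ofReal (q (-1) N))
        (N + s • (Tᵀ * T)⁻¹) ≤
      ∫⁻ s : ℝ, {N : Matrix (Fin n) (Fin n) ℝ | N.PosDef}.indicator (fun N => .ofReal (q 1 N))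
        (N + s • (Tᵀ * T)⁻¹) := by
  set K := (Tᵀ * T)⁻¹ with hK
  -- If the positive definite part of the line misses the domain, the indicator makes the integrand
  -- zero; otherwise rebase the line at a point in the domain.
  by_cases hex : ∃ s₀ : ℝ, (N + s₀ • K).PosDef ∧ T * (N + s₀ • K) * Tᵀ ∈ scatterDomain n p
  swap
  · refine le_trans (le_of_eq ?_) (zero_le)
    rw [← lintegral_zero]
    refine lintegral_congr fun s => ?_
    by_cases hs : (N + s • K).PosDef
    · have hs' : T * (N + s • K) * Tᵀ ∉ scatterDomain n p := fun h => hex ⟨s, hs, h⟩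
      rw [indicator_of_mem (show N + s • K ∈ {N : Matrix (Fin n) (Fin n) ℝ | N.PosDef} from hs), hq,
        indicator_of_notMem hs']
      simp
    · exact indicator_of_notMem (s := {N : Matrix (Fin n) (Fin n) ℝ | N.PosDef}) hs _
  obtain ⟨s₀, hN₁, H, l, hdec⟩ := hex
  set N₁ := N + s₀ • K with hN₁def
  have hshift : ∀ f : Matrix (Fin n) (Fin n) ℝ → ℝ≥0∞,
      ∫⁻ s : ℝ, f (N + s • K) = ∫⁻ s : ℝ, f (N₁ + s • K) := fun f => by
    rw [← lintegral_add_left_eq_self (fun s : ℝ => f (N + s • K)) s₀]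
    simp only [add_smul, ← add_assoc, hN₁def]
  rw [hshift, hshift]
  obtain ⟨a, ha, ha0⟩ := exists_shift_bound l
  have hline := isEigDecomp_line hdec hT hN₁
  simp only [← hK] at hline
  set d := (Tᵀ * T).det with hd
  have hd0 : 0 < d := hT.det_pos
  have hdecs : ∀ s ∈ Ioi a, IsEigDecomp (T * (N₁ + s • K) * Tᵀ) H fun j => l j + s := fun s hs =>
    ⟨hdec.orthonormal, fun i j hij => by simpa using hdec.strictAnti hij, (ha s).2 hs,
      (hline s).2.1⟩
  -- The root itself may increase with `s`; dividing by the product makes it antitone, and the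
  -- compensating product completes `w'`. Eigenvalue gaps are constant along the line, so the whole
  -- ray stays in the domain.
  set h : ℝ → ℝ := fun s =>
    lamSol (fun j => l j + s) (b (T * (N₁ + s • K) * Tᵀ)) / ∏ j, (l j + s) with hh
  have hmem : ∀ s ∈ Ioi a, T * (N₁ + s • K) * Tᵀ ∈ scatterDomain n p := fun s hs =>
    ⟨H, _, hdecs s hs⟩
  have hP : ∀ s ∈ Ioi a, 0 < ∏ j, (l j + s) := fun s hs =>
    Finset.prod_pos fun j _ => (ha s).2 hs j
  have h0 : ∀ s ∈ Ioi a, 0 ≤ h s := fun s hs => div_nonneg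
    (lamSol_pos ((ha s).2 hs) (hb0 _ (hmem s hs)) (hbn _ (hmem s hs))).le (hP s hs).le
  have hanti : AntitoneOn h (Ioi a) := by
    intro s hs t ht hst
    refine lamSol_div_prod_le ((ha s).2 hs) (fun j => by linarith) (hb0 _ (hmem t ht)).le ?_
      (hbn _ (hmem s hs))
    have h1 := antitoneOn_shift hb hderiv hdec.orthonormal hdec.strictAnti
      (fun s hs => (ha s).2 hs) hs ht hst
    rw [(hline s).2.1, (hline t).2.1]
    exact h1
  have hκ : 0 < ((p : ℝ) - n + 1) / 2 := by
    have : (n : ℝ) ≤ p := by exact_mod_cast hnp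
    linarith
  have key := lintegral_neg_shift_le ha ha0 (α := (B * N₁).trace) (β := (B * K).trace) hκ hd0
    hanti h0
  have hval : ∀ s ∈ Ioi a, ∀ ε, q ε (N₁ + s • K) = ε * (h s * (Real.exp
      (-((B * N₁).trace + s * (B * K).trace) / 2) *
        ((∏ j, (l j + s)) / d) ^ (((p : ℝ) - n + 1) / 2 - 1) *
        ((∏ j, (l j + s)) * (2 * (((p : ℝ) - n + 1) / 2) * ∑ j, (l j + s)⁻¹ -
          (B * K).trace)))) := by
    intro s hs ε
    rw [hq, indicator_of_mem (hmem s hs), (hline s).2.2.2 ((ha s).2 hs),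
      lamHat_eq (hdecs s hs) (hb0 _ (hmem s hs)) (hbn _ (hmem s hs)),
      show (N₁ + s • K).det = (∏ j, (l j + s)) / d by
        rw [← (hline s).2.2.1, mul_div_cancel_right₀ _ hd0.ne'],
      mul_add, trace_add, mul_smul_comm, trace_smul, smul_eq_mul,
      show ((p : ℝ) - n - 1) / 2 = ((p : ℝ) - n + 1) / 2 - 1 by ring]
    simp only [hh]
    have := (hP s hs).ne'
    field_simp
  have hind : ∀ ε, ∫⁻ s : ℝ, {N : Matrix (Fin n) (Fin n) ℝ | N.PosDef}.indicator
      (fun N => .ofReal (q ε N)) (N₁ + s • K) = ∫⁻ s in Ioi a, .ofReal (q ε (N₁ + s • K)) := by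
    intro ε
    rw [← lintegral_indicator measurableSet_Ioi]
    refine lintegral_congr fun s => ?_
    have h1 : (N₁ + s • K).PosDef ↔ a < s := (hline s).1.trans (ha s)
    by_cases hs : a < s
    · rw [indicator_of_mem (show N₁ + s • K ∈ {N : Matrix (Fin n) (Fin n) ℝ | N.PosDef} from
        h1.2 hs), indicator_of_mem (show s ∈ Ioi a from hs)]
    · rw [indicator_of_notMem (show N₁ + s • K ∉ {N : Matrix (Fin n) (Fin n) ℝ | N.PosDef} from
        fun h => hs (h1.1 h)), indicator_of_notMem (show s ∉ Ioi a from hs)]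
  rw [hind, hind]
  refine (le_of_eq ?_).trans (key.trans (le_of_eq ?_))
  · refine setLIntegral_congr_fun measurableSet_Ioi fun s hs => ?_
    simp only [hval s hs, neg_one_mul]
  · refine setLIntegral_congr_fun measurableSet_Ioi fun s hs => ?_
    simp only [hval s hs, one_mul]

end Haff

/-! ### The Stein–Haff inequality for the sample. -/

section HaffIntegral

variable {n p : ℕ} {b : Matrix (Fin p) (Fin p) ℝ → ℝ}

theorem _root_.Measurable.matrix_mul_trace {α : Type*} [MeasurableSpace α] {m k : ℕ}
    {f : α → Matrix (Fin m) (Fin k) ℝ} {g : α → Matrix (Fin k) (Fin m) ℝ} (hf : Measurable f)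
    (hg : Measurable g) : Measurable fun x => (f x * g x).trace := by
  have : SecondCountableTopology (Matrix (Fin m) (Fin k) ℝ) :=
    inferInstanceAs (SecondCountableTopology (Fin m → Fin k → ℝ))
  exact (Continuous.measurable (f := fun q : Matrix (Fin m) (Fin k) ℝ × Matrix (Fin k) (Fin m) ℝ =>
    (q.1 * q.2).trace) (by fun_prop)).comp (hf.prodMk hg)

theorem trace_inv_mul_mul (A : Matrix (Fin p) (Fin p) ℝ) (T : Matrix (Fin p) (Fin n) ℝ)
    (K : Matrix (Fin n) (Fin n) ℝ) : (A * (T * K * Tᵀ)).trace = (Tᵀ * A * T * K).trace := by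
  rw [← Matrix.mul_assoc, trace_mul_comm]
  simp only [Matrix.mul_assoc]

theorem posDef_conj_gram {A : Matrix (Fin p) (Fin p) ℝ} (hA : IsUnit A)
    {Z : Matrix (Fin p) (Fin n) ℝ} (hZ : (Zᵀ * Z).PosDef) : ((A * Z)ᵀ * (A * Z)).PosDef := by
  have hAA : (Aᵀ * A).PosDef := by
    have := (posDef_conj_iff (g := Aᵀ) (N := 1) (isUnit_transpose A |>.2 hA)).2 PosDef.one
    simpa using this
  rw [posDef_real_iff] at hAA hZ ⊢
  refine ⟨by simp, fun x hx => ?_⟩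
  have hZx : Z *ᵥ x ≠ 0 := fun h => by
    have := hZ.2 x hx
    rw [← mulVec_mulVec, h] at this
    simp at this
  have := hAA.2 _ hZx
  have e : (A * Z)ᵀ * (A * Z) = Zᵀ * (Aᵀ * A) * Z := by
    rw [transpose_mul]
    simp only [Matrix.mul_assoc]
  rwa [e, ← mulVec_mulVec, ← mulVec_mulVec, dotProduct_mulVec, ← mulVec_transpose,
    transpose_transpose]

/-- The projection `X(XᵗX)⁻¹Xᵗ` depends only on the column space, which `T` and `Tg` share; its
trace term is therefore constant in `N = g²`. -/
theorem haffTerm_mul (Sig : Matrix (Fin p) (Fin p) ℝ) (T : Matrix (Fin p) (Fin n) ℝ)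
    {g : Matrix (Fin n) (Fin n) ℝ} (hg : g.PosDef) :
    haffTerm b Sig (T * g) =
      (scatterDomain n p).indicator (lamHat n b) (T * (g * g) * Tᵀ) *
        (((p : ℝ) - n + 1) * ((g * g)⁻¹ * (Tᵀ * T)⁻¹).trace -
          (Tᵀ * Sig⁻¹ * T * (Tᵀ * T)⁻¹).trace) := by
  have hgT := hg.transpose_eq
  have hgd := (isUnit_iff_isUnit_det _).1 hg.isUnit
  have e1 : T * g * (T * g)ᵀ = T * (g * g) * Tᵀ := by
    rw [transpose_mul, hgT]
    simp only [Matrix.mul_assoc]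
  have e2 : ((T * g)ᵀ * (T * g))⁻¹ = g⁻¹ * (Tᵀ * T)⁻¹ * g⁻¹ := by
    have : (T * g)ᵀ * (T * g) = g * (Tᵀ * T) * g := by
      rw [transpose_mul, hgT]
      simp only [Matrix.mul_assoc]
    rw [this, Matrix.mul_inv_rev, Matrix.mul_inv_rev, mul_assoc]
  have e3 : T * g * (g⁻¹ * (Tᵀ * T)⁻¹ * g⁻¹) * (T * g)ᵀ = T * (Tᵀ * T)⁻¹ * Tᵀ := by
    have : T * g * (g⁻¹ * (Tᵀ * T)⁻¹ * g⁻¹) * (T * g)ᵀ =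
        T * ((g * g⁻¹) * (Tᵀ * T)⁻¹ * (g⁻¹ * g)) * Tᵀ := by
      rw [transpose_mul, hgT]
      simp only [Matrix.mul_assoc]
    rw [this, mul_nonsing_inv _ hgd, nonsing_inv_mul _ hgd, one_mul, mul_one]
  rw [haffTerm, e1, e2, e3, trace_inv_mul_mul, trace_mul_comm _ g⁻¹, ← mul_assoc,
    ← Matrix.mul_inv_rev]

theorem measurable_haffTerm (Sig : Matrix (Fin p) (Fin p) ℝ)
    (hlam : Measurable ((scatterDomain n p).indicator (lamHat n b))) :
    Measurable (haffTerm b Sig : Matrix (Fin p) (Fin n) ℝ → ℝ) := by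
  have h1 : Measurable fun X : Matrix (Fin p) (Fin n) ℝ => X * Xᵀ :=
    Continuous.measurable (by fun_prop)
  have h2 : Measurable fun X : Matrix (Fin p) (Fin n) ℝ => (Xᵀ * X)⁻¹ :=
    measurable_matrix_inv.comp (Continuous.measurable (by fun_prop))
  have h3 : Measurable fun X : Matrix (Fin p) (Fin n) ℝ => ((Xᵀ * X)⁻¹).trace := by
    simpa using h2.matrix_mul_trace (measurable_const (a := (1 : Matrix (Fin n) (Fin n) ℝ)))
  have h4 : Measurable fun X : Matrix (Fin p) (Fin n) ℝ =>
      (Sig⁻¹ * (X * (Xᵀ * X)⁻¹ * Xᵀ)).trace := by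
    simp_rw [trace_inv_mul_mul]
    exact Measurable.matrix_mul_trace (Continuous.measurable (by fun_prop)) h2
  exact (hlam.comp h1).mul ((h3.const_mul _).sub h4)

/-- Integrate the line inequality over all lines in the cone parallel to `(TᵗT)⁻¹`. The signs `-1`
and `1` in `q` select the negative and positive parts. -/
theorem setLIntegral_posDef_neg_le [NeZero n] (hnp : n ≤ p)
    (hb : DifferentiableOn ℝ b (scatterDomain n p))
    (hb0 : ∀ S ∈ scatterDomain n p, 0 < b S) (hbn : ∀ S ∈ scatterDomain n p, b S < n)
    (hderiv : ∀ (S : Matrix (Fin p) (Fin p) ℝ) (H : Matrix (Fin p) (Fin n) ℝ) (l : Fin n → ℝ),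
      IsEigDecomp S H l → ∑ i, partialEig b H l i ≤ 0)
    {T : Matrix (Fin p) (Fin n) ℝ} (hT : (Tᵀ * T).PosDef) (B : Matrix (Fin n) (Fin n) ℝ)
    {q : ℝ → Matrix (Fin n) (Fin n) ℝ → ℝ}
    (hq : ∀ ε N, q ε N = ε * (Real.exp (-(B * N).trace / 2) *
      N.det ^ (((p : ℝ) - n - 1) / 2) *
      ((scatterDomain n p).indicator (lamHat n b) (T * N * Tᵀ) *
        (((p : ℝ) - n + 1) * (N⁻¹ * (Tᵀ * T)⁻¹).trace - (B * (Tᵀ * T)⁻¹).trace))))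
    (hqm : ∀ ε, Measurable fun v : Sym2 (Fin n) → ℝ => q ε (symMat n v)) :
    ∫⁻ v in {v | (symMat n v).PosDef}, .ofReal (q (-1) (symMat n v)) ≤
      ∫⁻ v in {v | (symMat n v).PosDef}, .ofReal (q 1 (symMat n v)) := by
  have hKT : ((Tᵀ * T)⁻¹)ᵀ = (Tᵀ * T)⁻¹ := hT.inv.transpose_eq
  have hk0 : symVec n (Tᵀ * T)⁻¹ ≠ 0 := fun h0 => by
    have h3 := symMat_symVec hKT
    rw [h0, map_zero] at h3
    have := hT.inv.trace_pos
    rw [← h3] at this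
    simp at this
  rw [← lintegral_indicator measurableSet_posDef, ← lintegral_indicator measurableSet_posDef]
  refine lintegral_mono_of_lines volume hk0 ((hqm _).ennreal_ofReal.indicator measurableSet_posDef)
    ((hqm _).ennreal_ofReal.indicator measurableSet_posDef) fun v => ?_
  have h5 := lintegral_neg_line_le hnp hb hb0 hbn hderiv hT B hq (symMat n v)
  have h6 : ∀ s : ℝ, symMat n (v + s • symVec n (Tᵀ * T)⁻¹) = symMat n v + s • (Tᵀ * T)⁻¹ :=
    fun s => by rw [map_add, map_smul, symMat_symVec hKT]
  simp only [← h6] at h5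
  exact h5

/-- After multiplication by the finite nonzero invariant mass both sides disintegrate, and the
inequality holds frame by frame with `T = AZ` and `B = ZᵗZ`. -/
theorem lintegral_neg_haffTerm_le [NeZero n] (hnp : n ≤ p)
    (hb : DifferentiableOn ℝ b (scatterDomain n p))
    (hb0 : ∀ S ∈ scatterDomain n p, 0 < b S) (hbn : ∀ S ∈ scatterDomain n p, b S < n)
    (hderiv : ∀ (S : Matrix (Fin p) (Fin p) ℝ) (H : Matrix (Fin p) (Fin n) ℝ) (l : Fin n → ℝ),
      IsEigDecomp S H l → ∑ i, partialEig b H l i ≤ 0)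
    {Sig : Matrix (Fin p) (Fin p) ℝ} (hSig : Sig.PosDef) :
    ∫⁻ X, .ofReal (-haffTerm b Sig (dataMat X)) ∂sampleLaw n Sig ≤
      ∫⁻ X, .ofReal (haffTerm b Sig (dataMat X)) ∂sampleLaw n Sig := by
  have hlam := measurable_lamHat hb.continuousOn hb0 hbn
  obtain ⟨A, hA, hSA, c, -, -, hF⟩ := exists_lintegral_sampleLaw n hSig
  have hmeas := measurable_haffTerm (n := n) Sig hlam
  rw [hF (fun X => .ofReal (-haffTerm b Sig X)) hmeas.neg.ennreal_ofReal,
    hF (fun X => .ofReal (haffTerm b Sig X)) hmeas.ennreal_ofReal]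
  refine mul_le_mul_right ?_ c
  rw [← ENNReal.mul_le_mul_iff_right (loewnerMass_one_ne_zero (n := n)) loewnerMass_one_ne_top]
  obtain ⟨G₂, hG₂⟩ : ∃ G₂ : ℝ → Matrix (Fin p) (Fin n) ℝ → Matrix (Fin n) (Fin n) ℝ → ℝ,
      ∀ ε Z N, G₂ ε Z N =
        ε * ((scatterDomain n p).indicator (lamHat n b) (A * Z * N * (A * Z)ᵀ) *
          (((p : ℝ) - n + 1) * (N⁻¹ * ((A * Z)ᵀ * (A * Z))⁻¹).trace -
            (Zᵀ * Z * ((A * Z)ᵀ * (A * Z))⁻¹).trace)) := ⟨_, fun _ _ _ => rfl⟩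
  have hcont := continuous_symMat (n := n)
  have hG₂m : ∀ ε, Measurable (Function.uncurry fun (Z : Matrix (Fin p) (Fin n) ℝ)
      (v : Sym2 (Fin n) → ℝ) => G₂ ε Z (symMat n v)) := by
    intro ε
    have h1 : Measurable fun q : Matrix (Fin p) (Fin n) ℝ × (Sym2 (Fin n) → ℝ) =>
        A * q.1 * symMat n q.2 * (A * q.1)ᵀ := Continuous.measurable (by fun_prop)
    have h2 : Measurable fun q : Matrix (Fin p) (Fin n) ℝ × (Sym2 (Fin n) → ℝ) =>
        ((A * q.1)ᵀ * (A * q.1))⁻¹ :=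
      measurable_matrix_inv.comp (Continuous.measurable (by fun_prop))
    have h3 : Measurable fun q : Matrix (Fin p) (Fin n) ℝ × (Sym2 (Fin n) → ℝ) =>
        (symMat n q.2)⁻¹ := measurable_matrix_inv.comp (Continuous.measurable (by fun_prop))
    have h4 : Measurable fun q : Matrix (Fin p) (Fin n) ℝ × (Sym2 (Fin n) → ℝ) =>
        q.1ᵀ * q.1 := Continuous.measurable (by fun_prop)
    simp only [Function.uncurry_def, hG₂]
    exact ((hlam.comp h1).mul (((h3.matrix_mul_trace h2).const_mul _).sub
      (h4.matrix_mul_trace h2))).const_mul ε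
  have hA' := (isUnit_iff_isUnit_det _).1 hA.isUnit
  have hdis := fun ε : ℝ => loewnerMass_mul_lintegral_gauss hnp
    (G := fun Z => .ofReal (ε * haffTerm b Sig (A * Z)))
    (G₂ := fun Z v => .ofReal (G₂ ε Z (symMat n v)))
    ((hmeas.comp (Continuous.measurable (by fun_prop))).const_mul ε).ennreal_ofReal
    (hG₂m ε).ennreal_ofReal
    (fun Z v g hg hv => by
      -- Since `Σ = A²`, the matrix in the `Σ⁻¹` trace equals the one in the Gaussian exponent; this
      -- is why that trace appears as the derivative of the exponential.
      have e : (A * Z)ᵀ * Sig⁻¹ * (A * Z) = Zᵀ * Z := by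
        have : (A * Z)ᵀ * Sig⁻¹ * (A * Z) = Zᵀ * ((A * A⁻¹) * (A⁻¹ * A)) * Z := by
          rw [hSA, Matrix.mul_inv_rev, transpose_mul, hA.transpose_eq]
          simp only [Matrix.mul_assoc]
        rw [this, mul_nonsing_inv _ hA', nonsing_inv_mul _ hA', mul_one, Matrix.mul_one]
      rw [← Matrix.mul_assoc, haffTerm_mul _ _ hg, e, hG₂, hv])
  have h1 := hdis 1
  have h2 := hdis (-1)
  simp only [one_mul, neg_one_mul] at h1 h2
  rw [h1, h2]
  refine setLIntegral_mono' isClosed_frameShell.measurableSet fun Z hZ => ?_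
  have hT : ((A * Z)ᵀ * (A * Z)).PosDef :=
    posDef_conj_gram hA.isUnit (posDef_of_mem_frameShell hZ)
  refine (le_of_eq ?_).trans ((setLIntegral_posDef_neg_le hnp hb hb0 hbn hderiv hT (Zᵀ * Z)
    (q := fun ε N => (Real.exp (-(Zᵀ * Z * N).trace / 2) * N.det ^ (((p : ℝ) - n - 1) / 2)) *
      G₂ ε Z N) (fun ε N => ?_) fun ε => ?_).trans (le_of_eq ?_))
  · refine setLIntegral_congr_fun measurableSet_posDef fun v hv => (ENNReal.ofReal_mul ?_).symm
    exact mul_nonneg (Real.exp_pos _).le (Real.rpow_nonneg hv.det_pos.le _)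
  · simp only [hG₂]
    ring
  · have hwm : Measurable fun v : Sym2 (Fin n) → ℝ => Real.exp (-(Zᵀ * Z * symMat n v).trace / 2) *
        (symMat n v).det ^ (((p : ℝ) - n - 1) / 2) :=
      (Continuous.measurable (by fun_prop)).mul (measurable_det_symMat.pow_const _)
    exact hwm.mul ((hG₂m ε).comp (measurable_const.prodMk measurable_id))
  · refine setLIntegral_congr_fun measurableSet_posDef fun v hv => ENNReal.ofReal_mul ?_
    exact mul_nonneg (Real.exp_pos _).le (Real.rpow_nonneg hv.det_pos.le _)

end HaffIntegral

/-! ### Moments of the determinant and the trace. -/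

section Moments

variable {n p : ℕ}

theorem isCompact_frameShell : IsCompact (frameShell p n) := by
  have h1 : IsCompact (univ.pi fun _ : Fin p => univ.pi fun _ : Fin n => Icc (-2 : ℝ) 2) :=
    isCompact_univ_pi fun _ => isCompact_univ_pi fun _ => isCompact_Icc
  refine h1.of_isClosed_subset isClosed_frameShell
    fun (Z : Matrix (Fin p) (Fin n) ℝ) hZ i _ j _ => ?_
  have h2 : (Zᵀ * Z) j j ≤ 2 := by
    have := hZ.2.diag_nonneg (i := j)
    simpa using this
  have h3 : Z i j * Z i j ≤ (Zᵀ * Z) j j := by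
    rw [mul_apply]
    exact Finset.single_le_sum (f := fun i => Zᵀ j i * Z i j)
      (fun i _ => mul_self_nonneg (Z i j)) (Finset.mem_univ i)
  constructor <;> nlinarith

theorem integrable_exp_neg_mul_abs {c : ℝ} (hc : 0 < c) :
    Integrable fun x : ℝ => Real.exp (-(c * |x|)) := by
  rw [← integrableOn_univ, ← Iic_union_Ioi (a := (0 : ℝ))]
  refine IntegrableOn.union ?_ ?_
  · refine (integrableOn_exp_mul_Iic hc 0).congr_fun (fun x hx => ?_) measurableSet_Iic
    simp only [abs_of_nonpos (mem_Iic.1 hx), mul_neg, neg_neg]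
  · refine (integrableOn_exp_mul_Ioi (neg_neg_of_pos hc) 0).congr_fun (fun x hx => ?_)
      measurableSet_Ioi
    simp only [abs_of_pos (mem_Ioi.1 hx), neg_mul]

/-- The trace bounds every entry, so on the cone the integrand is at most a product of integrable
one-variable exponentials. The `+ 1` in the constant keeps it positive also for `n = 0`. -/
theorem lintegral_exp_neg_trace_lt_top :
    ∫⁻ v in {v | (symMat n v).PosDef}, .ofReal (Real.exp (-(symMat n v).trace / 2)) < ∞ := by
  set c : ℝ := (2 * (Fintype.card (Sym2 (Fin n)) + 1 : ℝ))⁻¹ with hc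
  have hc0 : 0 < c := by positivity
  have hI : Integrable fun v : Sym2 (Fin n) → ℝ => ∏ s, Real.exp (-(c * |v s|)) :=
    Integrable.fintype_prod fun _ => integrable_exp_neg_mul_abs hc0
  refine lt_of_le_of_lt ?_ hI.2
  refine le_trans (setLIntegral_mono' measurableSet_posDef fun v hv => ?_)
    (setLIntegral_le_lintegral _ _)
  refine le_trans (ENNReal.ofReal_le_ofReal ?_) (Real.ofReal_le_enorm _)
  beta_reduce
  rw [← Real.exp_sum, Real.exp_le_exp, Finset.sum_neg_distrib, neg_div, neg_le_neg_iff,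
    ← Finset.mul_sum]
  have h1 : ∑ s, |v s| ≤ Fintype.card (Sym2 (Fin n)) * (symMat n v).trace := by
    rw [← nsmul_eq_mul, ← Finset.card_univ, ← Finset.sum_const]
    refine Finset.sum_le_sum fun s _ => ?_
    induction s with
    | _ i j => exact PosSemidef.abs_apply_le_trace (PosDef.posSemidef hv) i j
  have h2 : 0 ≤ (symMat n v).trace := (PosDef.posSemidef hv).trace_nonneg
  rw [hc, inv_mul_le_iff₀ (by positivity)]
  nlinarith

/-- In the disintegration `det N^(-ε)` cancels the weight `det N^ε`. On the shell `ZᵗZ ≥ 1` leaves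
at most `exp(-tr N/2)`, and the factor depending on `Z` is bounded by compactness. -/
theorem lintegral_det_rpow_lt_top (hnp : n ≤ p) {Sig : Matrix (Fin p) (Fin p) ℝ}
    (hSig : Sig.PosDef) :
    ∫⁻ X, .ofReal (((dataMat X)ᵀ * dataMat X).det ^ (-(((p : ℝ) - n - 1) / 2))) ∂sampleLaw n Sig <
      ∞ := by
  obtain ⟨A, hA, hSA, c, -, hc, hF⟩ := exists_lintegral_sampleLaw n hSig
  have hm : Measurable fun X : Matrix (Fin p) (Fin n) ℝ => (Xᵀ * X).det :=
    Continuous.measurable (by fun_prop)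
  have hcont := continuous_symMat (n := n)
  have hAZ : Measurable fun Z : Matrix (Fin p) (Fin n) ℝ => A * Z :=
    Continuous.measurable (by fun_prop)
  rw [hF (fun X => .ofReal ((Xᵀ * X).det ^ (-(((p : ℝ) - n - 1) / 2))))
    (hm.pow_const _).ennreal_ofReal]
  refine ENNReal.mul_lt_top hc.lt_top ?_
  set ε := ((p : ℝ) - n - 1) / 2 with hε
  set D : Matrix (Fin p) (Fin n) ℝ → ℝ := fun Z => ((A * Z)ᵀ * (A * Z)).det ^ (-ε) with hD
  have hDm : Measurable D := (hm.comp hAZ).pow_const _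
  have hdis := loewnerMass_mul_lintegral_gauss hnp
    (G := fun Z => .ofReal (D Z))
    (G₂ := fun Z v => .ofReal (D Z * (symMat n v).det ^ (-ε)))
    hDm.ennreal_ofReal
    ((hDm.comp measurable_fst).mul
      ((measurable_det_symMat.comp measurable_snd).pow_const _)).ennreal_ofReal
    (fun Z v g hg hv => by
      have hd := hg.det_pos
      have h0 : 0 ≤ ((A * Z)ᵀ * (A * Z)).det := by
        have := posSemidef_conjTranspose_mul_self (A * Z)
        rw [conjTranspose_eq_transpose_of_trivial] at this
        exact this.det_nonneg
      have e : (A * (Z * g))ᵀ * (A * (Z * g)) = g * ((A * Z)ᵀ * (A * Z)) * g := by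
        rw [← Matrix.mul_assoc A Z g, transpose_mul (A * Z) g, hg.transpose_eq]
        simp only [Matrix.mul_assoc]
      simp only [hD]
      rw [e, det_mul, det_mul, hv, det_mul, Real.mul_rpow hd.le hd.le,
        Real.mul_rpow (mul_nonneg hd.le h0) hd.le, Real.mul_rpow hd.le h0]
      congr 1
      ring)
  have hDc : ContinuousOn D (frameShell p n) :=
    ContinuousOn.rpow_const (by fun_prop) fun Z hZ =>
      .inl (posDef_conj_gram hA.isUnit (posDef_of_mem_frameShell hZ)).det_pos.ne'
  obtain ⟨C, hC⟩ := isCompact_frameShell.exists_bound_of_continuousOn hDc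
  have hle : ∀ Z ∈ frameShell p n, ∫⁻ v in {v | (symMat n v).PosDef},
      .ofReal (Real.exp (-(Zᵀ * Z * symMat n v).trace / 2) * (symMat n v).det ^ ε) *
        .ofReal (D Z * (symMat n v).det ^ (-ε)) ≤
      .ofReal C * ∫⁻ v in {v | (symMat n v).PosDef},
        .ofReal (Real.exp (-(symMat n v).trace / 2)) := by
    intro Z hZ
    rw [← lintegral_const_mul' _ _ ENNReal.ofReal_ne_top]
    refine setLIntegral_mono' measurableSet_posDef fun v hv => ?_
    have hd := PosDef.det_pos hv
    have hC0 : 0 ≤ C := (norm_nonneg _).trans (hC Z hZ)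
    rw [← ENNReal.ofReal_mul (by positivity), ← ENNReal.ofReal_mul hC0]
    refine ENNReal.ofReal_le_ofReal ?_
    have h1 : (symMat n v).det ^ ε * (symMat n v).det ^ (-ε) = 1 := by
      rw [← Real.rpow_add hd, add_neg_cancel, Real.rpow_zero]
    calc Real.exp (-(Zᵀ * Z * symMat n v).trace / 2) * (symMat n v).det ^ ε *
          (D Z * (symMat n v).det ^ (-ε))
        = D Z * Real.exp (-(Zᵀ * Z * symMat n v).trace / 2) *
          ((symMat n v).det ^ ε * (symMat n v).det ^ (-ε)) := by ring
      _ ≤ C * Real.exp (-(symMat n v).trace / 2) := by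
        rw [h1, mul_one]
        refine mul_le_mul ((le_abs_self _).trans (hC Z hZ)) ?_ (Real.exp_pos _).le hC0
        rw [Real.exp_le_exp]
        have := trace_le_trace_mul hZ.1 hv
        linarith
  have hfin : loewnerMass (1 : Matrix (Fin n) (Fin n) ℝ) *
      ∫⁻ Z : Matrix (Fin p) (Fin n) ℝ, .ofReal (Real.exp (-(Zᵀ * Z).trace / 2)) * .ofReal (D Z) <
        ∞ := by
    rw [hdis]
    refine (setLIntegral_mono' isClosed_frameShell.measurableSet hle).trans_lt ?_
    rw [setLIntegral_const]
    exact ENNReal.mul_lt_top (ENNReal.mul_lt_top ENNReal.ofReal_lt_top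
      lintegral_exp_neg_trace_lt_top) isCompact_frameShell.measure_lt_top
  exact (ENNReal.lt_top_of_mul_ne_top_right hfin.ne loewnerMass_one_ne_zero)

theorem isProbabilityMeasure_sampleLaw (n : ℕ) (Sig : Matrix (Fin p) (Fin p) ℝ) :
    IsProbabilityMeasure (sampleLaw n Sig) := by
  unfold sampleLaw
  infer_instance

theorem integrable_det_rpow (hnp : n ≤ p) {Sig : Matrix (Fin p) (Fin p) ℝ} (hSig : Sig.PosDef) :
    Integrable (fun X => ((dataMat X)ᵀ * dataMat X).det ^ (-(((p : ℝ) - n - 1) / 2)))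
      (sampleLaw n Sig) := by
  have hm : Measurable fun X : Matrix (Fin p) (Fin n) ℝ => (Xᵀ * X).det :=
    Continuous.measurable (by fun_prop)
  refine ⟨((hm.comp measurable_dataMat).pow_const _).aestronglyMeasurable, ?_⟩
  rw [hasFiniteIntegral_iff_ofReal (.of_forall fun X => Real.rpow_nonneg ?_ _)]
  · exact lintegral_det_rpow_lt_top hnp hSig
  · have := posSemidef_conjTranspose_mul_self (dataMat X)
    rw [conjTranspose_eq_transpose_of_trivial] at this
    exact this.det_nonneg

theorem integrable_trace_scatter (n : ℕ) (Sig : Matrix (Fin p) (Fin p) ℝ) :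
    Integrable (fun X => (scatter X).trace) (sampleLaw n Sig) := by
  have h1 : ∀ X : Fin n → EuclideanSpace ℝ (Fin p), (scatter X).trace = ∑ j, ‖X j‖ ^ 2 := by
    intro X
    simp [scatter, trace_sum, trace_vecMulVec, EuclideanSpace.norm_sq_eq, dotProduct, ← sq]
  simp_rw [h1]
  refine integrable_finsetSum _ fun j _ => ?_
  have h2 : MemLp id 2 (multivariateGaussian 0 Sig) := IsGaussian.memLp_two_id
  have h3 := measurePreserving_eval (fun _ : Fin n => multivariateGaussian 0 Sig) j
  exact h3.integrable_comp_of_integrable (h2.integrable_norm_pow (by norm_num))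

theorem ae_krylovDet_dataMat_ne_zero (hnp : n ≤ p) {Sig : Matrix (Fin p) (Fin p) ℝ}
    (hSig : Sig.PosDef) : ∀ᵐ X ∂sampleLaw n Sig, krylovDet (dataMat X) ≠ 0 := by
  obtain ⟨A, hA, -, c, -, -, hF⟩ := exists_lintegral_sampleLaw n hSig
  have hm : MeasurableSet {X : Matrix (Fin p) (Fin n) ℝ | krylovDet X = 0} :=
    measurable_krylovDet (measurableSet_singleton 0)
  have h1 := hF ({X | krylovDet X = 0}.indicator 1) (measurable_one.indicator hm)
  have h2 : ∫⁻ Z : Matrix (Fin p) (Fin n) ℝ, .ofReal (Real.exp (-(Zᵀ * Z).trace / 2)) *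
      {X : Matrix (Fin p) (Fin n) ℝ | krylovDet X = 0}.indicator 1 (A * Z) = 0 := by
    rw [← lintegral_zero]
    refine lintegral_congr_ae ?_
    filter_upwards [ae_krylovDet_ne_zero hnp hA.isUnit] with Z hZ
    rw [indicator_of_notMem (show A * Z ∉ {X | krylovDet X = 0} from hZ), mul_zero]
  rw [h2, mul_zero] at h1
  have h3 := (lintegral_eq_zero_iff ((measurable_one.indicator hm).comp measurable_dataMat)).1 h1
  filter_upwards [h3] with X hX h0
  rw [Function.comp_apply, indicator_of_mem (show dataMat X ∈ {X | krylovDet X = 0} from h0)] at hX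
  exact one_ne_zero hX

end Moments

/-! ### Closed form and bounds for the Stein loss. -/

section Loss

variable {n p : ℕ}

/-- Sylvester's identity `det (1 + UV) = det (1 + VU)` reduces to size `n`. -/
theorem det_smul_one_add {H : Matrix (Fin p) (Fin n) ℝ} (hH : Hᵀ * H = 1) (d : Fin n → ℝ) {c : ℝ}
    (hc : c ≠ 0) :
    (c • (1 : Matrix (Fin p) (Fin p) ℝ) + H * diagonal d * Hᵀ).det =
      c ^ p * ∏ j, ((c + d j) / c) := by
  have h1 : c • (1 : Matrix (Fin p) (Fin p) ℝ) + H * diagonal d * Hᵀ =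
      c • (1 + H * (c⁻¹ • diagonal d * Hᵀ)) := by
    rw [smul_add, Matrix.smul_mul, Matrix.mul_smul, smul_smul, mul_inv_cancel₀ hc, one_smul,
      Matrix.mul_assoc]
  have h2 : (1 : Matrix (Fin n) (Fin n) ℝ) + c⁻¹ • diagonal d * Hᵀ * H =
      diagonal fun j => (c + d j) / c := by
    rw [Matrix.mul_assoc, hH, Matrix.mul_one, ← diagonal_smul, ← diagonal_one, diagonal_add]
    congr 1
    ext j
    simp only [Pi.smul_apply, smul_eq_mul]
    field_simp
  rw [h1, det_smul, det_one_add_mul_comm, h2, det_diagonal, Fintype.card_fin]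

theorem steinLoss_smul (hp : 0 < p) {Sig : Matrix (Fin p) (Fin p) ℝ} (hSig : Sig.PosDef)
    {H : Matrix (Fin p) (Fin n) ℝ} (hH : Hᵀ * H = 1) {d : Fin n → ℝ} {c : ℝ} (hc : 0 < c)
    (hd : ∀ j, 0 < c + d j) :
    steinLoss ((p : ℝ)⁻¹ • (c • (1 : Matrix (Fin p) (Fin p) ℝ) + H * diagonal d * Hᵀ)) Sig =
      (p : ℝ)⁻¹ * (Sig⁻¹ * (c • 1 + H * diagonal d * Hᵀ)).trace -
        (Real.log ((p : ℝ)⁻¹ ^ p * Sig⁻¹.det) + p * Real.log c +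
          ∑ j, (Real.log (c + d j) - Real.log c)) - p := by
  have hp' : (0 : ℝ) < (p : ℝ)⁻¹ := by positivity
  have hS := hSig.inv.det_pos
  rw [steinLoss, mul_smul_comm, trace_smul, smul_eq_mul, det_smul, det_mul, Fintype.card_fin,
    det_smul_one_add hH d hc.ne', ← mul_assoc, ← mul_assoc, Real.log_mul, Real.log_mul,
    Real.log_pow, Real.log_prod]
  · simp_rw [Real.log_div (hd _).ne' hc.ne']
  · exact fun j _ => (div_pos (hd j) hc).ne'
  · positivity
  · positivity
  · positivity
  · exact Finset.prod_ne_zero_iff.2 fun j _ => (div_pos (hd j) hc).ne'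

theorem abs_trace_mul_le (M : Matrix (Fin p) (Fin p) ℝ) {N : Matrix (Fin p) (Fin p) ℝ}
    (hN : N.PosSemidef) : |(M * N).trace| ≤ (∑ i, ∑ j, |M i j|) * N.trace := by
  simp only [trace, diag_apply, mul_apply]
  rw [Finset.sum_mul]
  refine (Finset.abs_sum_le_sum_abs _ _).trans (Finset.sum_le_sum fun i _ => ?_)
  rw [Finset.sum_mul]
  refine (Finset.abs_sum_le_sum_abs _ _).trans (Finset.sum_le_sum fun j _ => ?_)
  rw [abs_mul]
  exact mul_le_mul_of_nonneg_left (hN.abs_apply_le_trace j i) (abs_nonneg _)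

variable {S : Matrix (Fin p) (Fin p) ℝ} {H : Matrix (Fin p) (Fin n) ℝ} {l : Fin n → ℝ}

theorem IsEigDecomp.posSemidef (h : IsEigDecomp S H l) : S.PosSemidef := by
  have h1 : (diagonal l).PosSemidef := posSemidef_diagonal_iff.2 fun i => (h.pos i).le
  rw [h.eq]
  simpa [conjTranspose_eq_transpose_of_trivial] using h1.mul_mul_conjTranspose_same H

theorem posSemidef_mul_transpose (H : Matrix (Fin p) (Fin n) ℝ) : (H * Hᵀ).PosSemidef := by
  simpa [conjTranspose_eq_transpose_of_trivial] using posSemidef_self_mul_conjTranspose H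

theorem IsEigDecomp.trace_eq (h : IsEigDecomp S H l) : S.trace = ∑ j, l j := by
  rw [h.eq, trace_mul_comm, ← Matrix.mul_assoc, h.orthonormal, Matrix.one_mul, trace_diagonal]

theorem trace_mul_transpose_of_orthonormal (hH : Hᵀ * H = 1) : (H * Hᵀ).trace = n := by
  rw [trace_mul_comm, hH, trace_one, Fintype.card_fin]

/-- Bounds on the logarithms of positive numbers in terms of their sum and product. -/
theorem abs_log_le_of_pos (hl : ∀ j, 0 < l j) {ε : ℝ} (hε : 0 < ε) (i : Fin n) :
    |Real.log (l i)| ≤ ∑ j, l j + (∏ j, l j) ^ (-ε) / ε := by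
  have hP : 0 < ∏ j, l j := Finset.prod_pos fun j _ => hl j
  have h1 : Real.log (∏ j, l j) = Real.log (l i) + ∑ j ∈ Finset.univ.erase i, Real.log (l j) := by
    rw [Real.log_prod fun j _ => (hl j).ne', 
      Finset.add_sum_erase _ (fun j => Real.log (l j)) (Finset.mem_univ i)]
  -- This is `log x ≤ x^ε/ε` at `x = 1/∏ ℓⱼ`. Subtracting the other logarithms, each at most `ℓⱼ`,
  -- bounds `log ℓᵢ` below.
  have h2 : -Real.log (∏ j, l j) ≤ (∏ j, l j) ^ (-ε) / ε := by
    have := Real.log_le_rpow_div (inv_pos.2 hP).le hε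
    rwa [Real.log_inv, Real.inv_rpow hP.le, ← Real.rpow_neg hP.le] at this
  have h3 : ∑ j ∈ Finset.univ.erase i, Real.log (l j) ≤ ∑ j, l j := by
    refine (Finset.sum_le_sum fun j _ => Real.log_le_self (hl j).le).trans ?_
    exact Finset.sum_le_sum_of_subset_of_nonneg (Finset.erase_subset _ _) fun j _ _ => (hl j).le
  have h4 : Real.log (l i) ≤ ∑ j, l j :=
    (Real.log_le_self (hl i).le).trans
      (Finset.single_le_sum (f := l) (fun j _ => (hl j).le) (Finset.mem_univ i))
  have h5 : 0 ≤ (∏ j, l j) ^ (-ε) / ε := by positivity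
  rw [abs_le]
  constructor <;> linarith

/-- The line lemma at `N = 1`, `s = 0`: with `X = HW` and `W(XᵗX)⁻¹Wᵗ = 1`, the projection onto the
columns of `X` is `HHᵗ`. -/
theorem haffTerm_eq {b : Matrix (Fin p) (Fin p) ℝ → ℝ} (Sig : Matrix (Fin p) (Fin p) ℝ)
    {X : Matrix (Fin p) (Fin n) ℝ} (hX : (Xᵀ * X).PosDef) (h : IsEigDecomp (X * Xᵀ) H l) :
    X * (Xᵀ * X)⁻¹ * Xᵀ = H * Hᵀ ∧ (Xᵀ * X).det = ∏ j, l j ∧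
    haffTerm b Sig X = lamHat n b (X * Xᵀ) *
      (((p : ℝ) - n + 1) * ∑ j, (l j)⁻¹ - (Sig⁻¹ * (H * Hᵀ)).trace) := by
  have h' : IsEigDecomp (X * (1 : Matrix (Fin n) (Fin n) ℝ) * Xᵀ) H l := by rwa [Matrix.mul_one]
  obtain ⟨W, -, hXW, -, hWK⟩ := h'.exists_coords hX PosDef.one
  obtain ⟨-, -, h3, h4⟩ := isEigDecomp_line h' hX PosDef.one 0
  have e1 : X * (Xᵀ * X)⁻¹ * Xᵀ = H * Hᵀ := by
    have : X * (Xᵀ * X)⁻¹ * Xᵀ = H * (W * (Xᵀ * X)⁻¹ * Wᵀ) * Hᵀ := by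
      generalize (Xᵀ * X)⁻¹ = K
      rw [hXW, transpose_mul]
      simp only [Matrix.mul_assoc]
    rw [this, hWK, Matrix.mul_one]
  simp only [zero_smul, add_zero, det_one, one_mul, inv_one] at h3 h4
  refine ⟨e1, h3, ?_⟩
  rw [haffTerm, e1, h4 h.pos, indicator_of_mem (show X * Xᵀ ∈ scatterDomain n p from ⟨H, l, h⟩)]

/-- A path from `deltaEB` (`θ = 0`) to `deltaSH` (`θ = 1`). -/
noncomputable def interEst (n : ℕ) (b : Matrix (Fin p) (Fin p) ℝ → ℝ) (θ : ℝ)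
    (S : Matrix (Fin p) (Fin p) ℝ) : Matrix (Fin p) (Fin p) ℝ :=
  (p : ℝ)⁻¹ • (lamHat n b S • 1 +
    (S - (θ * lamHat n b S) • ((eigDecomp n S).1 * ((eigDecomp n S).1)ᵀ)))

theorem deltaEB_eq (n : ℕ) (b : Matrix (Fin p) (Fin p) ℝ → ℝ) :
    deltaEB n b = interEst n b 0 := by
  ext1 S
  rw [deltaEB, interEst, zero_mul, zero_smul, sub_zero, add_comm]

theorem deltaSH_eq (n : ℕ) (b : Matrix (Fin p) (Fin p) ℝ → ℝ) :
    deltaSH n b = interEst n b 1 := by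
  ext1 S
  rw [deltaSH, deltaEB, interEst, one_mul, mul_smul, ← smul_sub]
  congr 1
  abel

variable {b : Matrix (Fin p) (Fin p) ℝ → ℝ}

/-- Up to the factor `p⁻¹`, the estimator has eigenvalues `ℓⱼ + (1-θ)λ̂` on the range of `H` and
`λ̂` on its complement. -/
theorem steinLoss_interEst (hp : 0 < p) {Sig : Matrix (Fin p) (Fin p) ℝ} (hSig : Sig.PosDef)
    (hS : S ∈ scatterDomain n p) (hlam : 0 < lamHat n b S) {θ : ℝ} (hθ : θ ≤ 1) :
    steinLoss (interEst n b θ S) Sig =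
      (p : ℝ)⁻¹ * (lamHat n b S * Sig⁻¹.trace + (Sig⁻¹ * S).trace - θ * lamHat n b S *
        (Sig⁻¹ * ((eigDecomp n S).1 * ((eigDecomp n S).1)ᵀ)).trace) -
        (Real.log ((p : ℝ)⁻¹ ^ p * Sig⁻¹.det) + p * Real.log (lamHat n b S) +
          ∑ j, (Real.log ((eigDecomp n S).2 j + (1 - θ) * lamHat n b S) -
            Real.log (lamHat n b S))) - p := by
  have h := isEigDecomp_eigDecomp hS
  set H := (eigDecomp n S).1
  set l := (eigDecomp n S).2
  set c := lamHat n b S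
  have e : H * diagonal (fun j => l j - θ * c) * Hᵀ = S - (θ * c) • (H * Hᵀ) := by
    have : diagonal (fun j => l j - θ * c) =
        diagonal l - (θ * c) • (1 : Matrix (Fin n) (Fin n) ℝ) := by
      rw [← diagonal_one, ← diagonal_smul, diagonal_sub]
      congr 1
      ext j
      simp
    rw [this, Matrix.mul_sub, Matrix.sub_mul, ← h.eq, Matrix.mul_smul, Matrix.mul_one,
      Matrix.smul_mul]
  have hd : ∀ j, c + (l j - θ * c) = l j + (1 - θ) * c := fun j => by ring
  have h1 := steinLoss_smul hp hSig h.orthonormal (d := fun j => l j - θ * c) hlam fun j => by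
    rw [hd]
    have := h.pos j
    have := mul_nonneg (sub_nonneg.2 hθ) hlam.le
    linarith
  simp only [e, hd] at h1
  rw [interEst, h1, mul_add, mul_sub, trace_add, trace_sub, mul_smul_comm, mul_smul_comm,
    trace_smul, trace_smul, mul_one, smul_eq_mul, smul_eq_mul]
  ring

/-- Traces and upper logarithmic bounds use `λ̂ ≤ c ℓᵢ`. The lower bound on `log λ̂` uses `λ̂ ≥
(C₀/n) min ℓ`, which is where `C₀ > 0` enters. -/
theorem abs_steinLoss_interEst_le (hp : 0 < p) {Sig : Matrix (Fin p) (Fin p) ℝ}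
    (hSig : Sig.PosDef) {C₀ c ε : ℝ} (hC₀ : 0 < C₀) (hc : 0 ≤ c) (hε : 0 < ε)
    (hbn : ∀ S ∈ scatterDomain n p, b S < n) (hb0 : ∀ S ∈ scatterDomain n p, C₀ ≤ b S)
    (hbc : ∀ S ∈ scatterDomain n p, b S ≤ c / (1 + c)) {θ : ℝ} (hθ0 : 0 ≤ θ) (hθ : θ ≤ 1) :
    ∃ A₁ A₂ : ℝ, ∀ S ∈ scatterDomain n p,
      |steinLoss (interEst n b θ S) Sig| ≤ A₁ + A₂ *
        (∑ j, (eigDecomp n S).2 j + (∏ j, (eigDecomp n S).2 j) ^ (-ε) / ε) := by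
  set σ := ∑ i, ∑ j, |Sig⁻¹ i j| with hσ
  set k := |Real.log ((p : ℝ)⁻¹ ^ p * Sig⁻¹.det)| with hk
  set m := |Real.log (C₀ / n)| with hm
  refine ⟨k + (p + 2 * n) * m + p, (p : ℝ)⁻¹ * (σ * (c * p + 1 + c * n)) + (p + 2 * n) * (1 + c),
    fun S hS => ?_⟩
  have h := isEigDecomp_eigDecomp hS
  have hlamEq := lamHat_eq h (hC₀.trans_le (hb0 S hS)) (hbn S hS)
  have hlam : 0 < lamHat n b S := hlamEq ▸ lamSol_pos h.pos (hC₀.trans_le (hb0 S hS)) (hbn S hS)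
  have hle : ∀ i, lamHat n b S ≤ c * (eigDecomp n S).2 i := fun i =>
    hlamEq ▸ lamSol_le_mul h.pos (hC₀.le.trans (hb0 S hS)) (hbn S hS) hc (hbc S hS) i
  have hn : 0 < n := by
    have := (hC₀.trans_le (hb0 S hS)).trans (hbn S hS)
    exact_mod_cast this
  have : NeZero n := ⟨hn.ne'⟩
  obtain ⟨i, hi⟩ := Finite.exists_min (eigDecomp n S).2
  have hge := mul_le_lamSol h.pos (hC₀.le.trans (hb0 S hS)) (hbn S hS) (h.pos i) hi
  rw [← hlamEq] at hge
  rw [steinLoss_interEst hp hSig hS hlam hθ]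
  have htr := h.trace_eq
  have hlog := abs_log_le_of_pos h.pos hε
  have hS1 := abs_trace_mul_le Sig⁻¹ h.posSemidef
  have hS2 := abs_trace_mul_le Sig⁻¹ (posSemidef_mul_transpose (eigDecomp n S).1)
  have hS3 := abs_trace_mul_le Sig⁻¹ (PosSemidef.one (n := Fin p) (R := ℝ))
  rw [trace_mul_transpose_of_orthonormal h.orthonormal] at hS2
  rw [htr] at hS1
  rw [mul_one, trace_one, Fintype.card_fin] at hS3
  have hsum : ∀ j, (eigDecomp n S).2 j ≤ ∑ j, (eigDecomp n S).2 j := fun j =>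
    Finset.single_le_sum (fun j _ => (h.pos j).le) (Finset.mem_univ j)
  have hpos := h.pos
  have hP : 0 < ∏ j, (eigDecomp n S).2 j := Finset.prod_pos fun j _ => h.pos j
  have hr : 0 ≤ (∏ j, (eigDecomp n S).2 j) ^ (-ε) / ε := by positivity
  set l := (eigDecomp n S).2
  set t := ∑ j, l j
  set Φ := t + (∏ j, l j) ^ (-ε) / ε
  set x := lamHat n b S
  set τ := (Sig⁻¹ * ((eigDecomp n S).1 * ((eigDecomp n S).1)ᵀ)).trace
  have htΦ : t ≤ Φ := by simp only [Φ]; linarith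
  have ht0 : 0 < t := (hpos i).trans_le (hsum i)
  have hσ0 : 0 ≤ σ := Finset.sum_nonneg fun _ _ => Finset.sum_nonneg fun _ _ => abs_nonneg _
  have hxt : x ≤ c * t := (hle i).trans (mul_le_mul_of_nonneg_left (hsum i) hc)
  have hm0 : 0 ≤ m := abs_nonneg _
  have hΦ0 : 0 < Φ := ht0.trans_le htΦ
  have hlx : |Real.log x| ≤ m + (1 + c) * Φ := by
    have h1 : Real.log x ≤ x := Real.log_le_self hlam.le
    have h2 : Real.log (C₀ / n) + Real.log (l i) ≤ Real.log x := by
      have hn' : (0 : ℝ) < n := by exact_mod_cast hn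
      rw [← Real.log_mul (by positivity) (hpos i).ne']
      refine Real.log_le_log (mul_pos (by positivity) (hpos i)) ?_
      rw [div_mul_eq_mul_div, div_le_iff₀ hn', mul_comm x]
      exact (mul_le_mul_of_nonneg_right (hb0 S hS) (hpos i).le).trans hge
    have h3 := abs_le.1 (hlog i)
    have h4 := neg_abs_le (Real.log (C₀ / n))
    have h5 : c * t ≤ c * Φ := mul_le_mul_of_nonneg_left htΦ hc
    have h6 : 0 ≤ c * Φ := mul_nonneg hc hΦ0.le
    rw [abs_le]
    constructor <;> linarith [h3.1]
  have hlj : ∀ j, |Real.log (l j + (1 - θ) * x)| ≤ m + (1 + c) * Φ := fun j => by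
    have h0 : 0 ≤ (1 - θ) * x := mul_nonneg (sub_nonneg.2 hθ) hlam.le
    have h0' : (1 - θ) * x ≤ x := by nlinarith
    have h1 : Real.log (l j + (1 - θ) * x) ≤ l j + (1 - θ) * x :=
      Real.log_le_self (by linarith [hpos j])
    have h2 : Real.log (l j) ≤ Real.log (l j + (1 - θ) * x) :=
      Real.log_le_log (hpos j) (by linarith)
    have h3 := abs_le.1 (hlog j)
    have h5 : c * t ≤ c * Φ := mul_le_mul_of_nonneg_left htΦ hc
    have h6 : 0 ≤ c * Φ := mul_nonneg hc hΦ0.le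
    have h7 := hsum j
    rw [abs_le]
    constructor <;> linarith [h3.1]
  have hA : |(p : ℝ)⁻¹ * (x * Sig⁻¹.trace + (Sig⁻¹ * S).trace - θ * x * τ)| ≤
      (p : ℝ)⁻¹ * (σ * (c * p + 1 + c * n)) * Φ := by
    rw [abs_mul, abs_of_nonneg (by positivity : (0 : ℝ) ≤ (p : ℝ)⁻¹),
      mul_assoc (p : ℝ)⁻¹]
    refine mul_le_mul_of_nonneg_left ?_ (inv_nonneg.2 (Nat.cast_nonneg _))
    have h1 : |x * Sig⁻¹.trace| ≤ c * Φ * (σ * p) := by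
      rw [abs_mul, abs_of_pos hlam]
      exact mul_le_mul (hxt.trans (mul_le_mul_of_nonneg_left htΦ hc)) hS3 (abs_nonneg _)
        (mul_nonneg hc hΦ0.le)
    have h2 : |θ * x * τ| ≤ c * Φ * (σ * n) := by
      rw [abs_mul, abs_of_nonneg (mul_nonneg hθ0 hlam.le)]
      refine mul_le_mul ?_ hS2 (abs_nonneg _) (mul_nonneg hc hΦ0.le)
      exact (mul_le_of_le_one_left hlam.le hθ).trans
        (hxt.trans (mul_le_mul_of_nonneg_left htΦ hc))
    have h3 : |(Sig⁻¹ * S).trace| ≤ σ * Φ := hS1.trans (mul_le_mul_of_nonneg_left htΦ hσ0)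
    have h4 := (abs_sub (x * Sig⁻¹.trace + (Sig⁻¹ * S).trace) (θ * x * τ))
    have h5 := abs_add_le (x * Sig⁻¹.trace) (Sig⁻¹ * S).trace
    linarith
  have hB : |∑ j, (Real.log (l j + (1 - θ) * x) - Real.log x)| ≤ n * (2 * (m + (1 + c) * Φ)) := by
    refine (Finset.abs_sum_le_sum_abs _ _).trans ?_
    refine (Finset.sum_le_card_nsmul _ _ (2 * (m + (1 + c) * Φ)) fun j _ => ?_).trans
      (by simp)
    have := abs_sub (Real.log (l j + (1 - θ) * x)) (Real.log x)
    linarith [hlj j]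
  have hC : |p * Real.log x| ≤ p * (m + (1 + c) * Φ) := by
    rw [abs_mul, Nat.abs_cast]
    exact mul_le_mul_of_nonneg_left hlx (Nat.cast_nonneg _)
  have h1 := abs_le.1 hA
  have h2 := abs_le.1 hB
  have h3 := abs_le.1 hC
  have h4 := abs_le.1 hk.ge
  have hp0 : (0 : ℝ) ≤ p := Nat.cast_nonneg _
  rw [abs_le]
  constructor <;> linarith [h1.1, h1.2, h2.1, h2.2, h3.1, h3.2, h4.1, h4.2]

end Loss

/-! ### Integrability of the loss and the pointwise comparison. -/

section Risk

variable {n p : ℕ} {b : Matrix (Fin p) (Fin p) ℝ → ℝ}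

theorem ae_scatter_mem (hnp : n ≤ p) {Sig : Matrix (Fin p) (Fin p) ℝ} (hSig : Sig.PosDef) :
    ∀ᵐ X ∂sampleLaw n Sig, scatter X ∈ scatterDomain n p ∧ ((dataMat X)ᵀ * dataMat X).PosDef := by
  filter_upwards [ae_krylovDet_dataMat_ne_zero hnp hSig] with X hX
  rw [scatter_eq]
  exact ⟨mem_scatterDomain_of_krylovDet_ne_zero hX, posDef_of_krylovDet_ne_zero hX⟩

/-- The sum and the reciprocal power of the product of the eigenvalues are integrable. -/
theorem integrable_eigenvalue_bound (hnp : n ≤ p) {Sig : Matrix (Fin p) (Fin p) ℝ}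
    (hSig : Sig.PosDef) :
    Integrable (fun X => ∑ j, (eigDecomp n (scatter X)).2 j +
      (∏ j, (eigDecomp n (scatter X)).2 j) ^ (-(((p : ℝ) - n - 1) / 2)) / (((p : ℝ) - n - 1) / 2))
      (sampleLaw n Sig) := by
  refine ((integrable_trace_scatter n Sig).add
    ((integrable_det_rpow hnp hSig).div_const (((p : ℝ) - n - 1) / 2))).congr ?_
  filter_upwards [ae_scatter_mem hnp hSig] with X hX
  have h := isEigDecomp_eigDecomp hX.1
  have h2 := h
  rw [scatter_eq] at h2
  rw [Pi.add_apply, h.trace_eq, (haffTerm_eq (b := fun _ => 0) Sig hX.2 h2).2.1, ← scatter_eq]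

/-- Replacing `HHᵗ` by `X(XᵗX)⁻¹Xᵗ` almost surely removes the arbitrary choice of frame. -/
theorem aestronglyMeasurable_steinLoss_interEst (hnp : n ≤ p)
    (hlam : Measurable ((scatterDomain n p).indicator (lamHat n b)))
    {Sig : Matrix (Fin p) (Fin p) ℝ} (hSig : Sig.PosDef) (θ : ℝ) :
    AEStronglyMeasurable (fun X => steinLoss (interEst n b θ (scatter X)) Sig)
      (sampleLaw n Sig) := by
  have : SecondCountableTopology (Matrix (Fin p) (Fin n) ℝ) :=
    inferInstanceAs (SecondCountableTopology (Fin p → Fin n → ℝ))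
  have : SecondCountableTopology (Matrix (Fin n) (Fin n) ℝ) :=
    inferInstanceAs (SecondCountableTopology (Fin n → Fin n → ℝ))
  set E : ℝ × Matrix (Fin p) (Fin n) ℝ × Matrix (Fin n) (Fin n) ℝ → Matrix (Fin p) (Fin p) ℝ :=
    fun q => Sig⁻¹ * ((p : ℝ)⁻¹ • (q.1 • 1 +
      (q.2.1 * q.2.1ᵀ - (θ * q.1) • (q.2.1 * q.2.2 * q.2.1ᵀ)))) with hE
  have hEc : Continuous E := by fun_prop
  have hEt : Measurable fun q => (E q).trace := (hEc.matrix_trace).measurable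
  have hEd : Measurable fun q => (E q).det := (hEc.matrix_det).measurable
  have h1 : Measurable fun X : Matrix (Fin p) (Fin n) ℝ => (Xᵀ * X)⁻¹ :=
    measurable_matrix_inv.comp (Continuous.measurable (by fun_prop))
  have h2 : Measurable fun X : Matrix (Fin p) (Fin n) ℝ => X * Xᵀ :=
    Continuous.measurable (by fun_prop)
  have h3 : Measurable fun X : Matrix (Fin p) (Fin n) ℝ =>
      ((scatterDomain n p).indicator (lamHat n b) (X * Xᵀ), X, (Xᵀ * X)⁻¹) :=
    (hlam.comp h2).prodMk (measurable_id.prodMk h1)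
  have h4 : Measurable fun q => (E q).trace - Real.log (E q).det - p :=
    (hEt.sub (Real.measurable_log.comp hEd)).sub_const _
  refine ((h4.comp (h3.comp measurable_dataMat)).aestronglyMeasurable).congr ?_
  filter_upwards [ae_scatter_mem hnp hSig] with X hX
  have h := isEigDecomp_eigDecomp hX.1
  rw [scatter_eq] at h
  have h5 := (haffTerm_eq (b := fun _ => 0) Sig hX.2 h).1
  have h6 := hX.1
  rw [scatter_eq] at h6
  simp only [Function.comp_apply, hE, scatter_eq, h5, indicator_of_mem h6]
  rfl

theorem haffTerm_dataMat {Sig : Matrix (Fin p) (Fin p) ℝ}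
    {X : Fin n → EuclideanSpace ℝ (Fin p)} (hS : scatter X ∈ scatterDomain n p)
    (hX : ((dataMat X)ᵀ * dataMat X).PosDef) :
    haffTerm b Sig (dataMat X) = lamHat n b (scatter X) *
      (((p : ℝ) - n + 1) * ∑ j, ((eigDecomp n (scatter X)).2 j)⁻¹ -
        (Sig⁻¹ * ((eigDecomp n (scatter X)).1 * ((eigDecomp n (scatter X)).1)ᵀ)).trace) := by
  have h := isEigDecomp_eigDecomp hS
  rw [scatter_eq] at h ⊢
  exact (haffTerm_eq Sig hX h).2.2

/-- The pointwise inequality between the loss difference and the integrand `haffTerm`. -/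
theorem steinLoss_sub_add_haffTerm_neg (hp : 0 < p) (hn : 0 < n) {Sig : Matrix (Fin p) (Fin p) ℝ}
    (hSig : Sig.PosDef) (hnp : n ≤ p) {X : Fin n → EuclideanSpace ℝ (Fin p)}
    (hS : scatter X ∈ scatterDomain n p) (hX : ((dataMat X)ᵀ * dataMat X).PosDef)
    (hlam : 0 < lamHat n b (scatter X))
    (hle : ∀ j, lamHat n b (scatter X) ≤ cStar n p * (eigDecomp n (scatter X)).2 j) :
    p * (steinLoss (interEst n b 0 (scatter X)) Sig - steinLoss (interEst n b 1 (scatter X)) Sig) +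
      haffTerm b Sig (dataMat X) < 0 := by
  rw [haffTerm_dataMat hS hX, steinLoss_interEst hp hSig hS hlam zero_le_one,
    steinLoss_interEst hp hSig hS hlam le_rfl]
  have hpos := (isEigDecomp_eigDecomp hS).pos
  set l := (eigDecomp n (scatter X)).2
  set x := lamHat n b (scatter X)
  have hp' : (0 : ℝ) < p := by exact_mod_cast hp
  have hm : (0 : ℝ) < (p : ℝ) - n + 1 := by
    have : (n : ℝ) ≤ p := by exact_mod_cast hnp
    linarith
  have key : ∀ j, ((p : ℝ) - n + 1) * (x * (l j)⁻¹) - p * (Real.log (l j + x) - Real.log (l j)) <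
      0 := fun j => by
    have hl := hpos j
    set y := x * (l j)⁻¹ with hy
    have hy0 : 0 < y := mul_pos hlam (inv_pos.2 hl)
    have hyc : y ≤ cStar n p := by
      rw [hy, ← div_eq_mul_inv, div_le_iff₀ hl]
      exact hle j
    have h1 : Real.log (l j + x) - Real.log (l j) = Real.log (1 + y) := by
      rw [← Real.log_div (by linarith) hl.ne', hy]
      congr 1
      field_simp
    have h2 := Real.lt_log_one_add_of_pos hy0
    -- Equivalent to `(p-n+1)(y+2) ≤ 2p`, that is `y ≤ 2(n-1)/(p-n+1) = c_*`.
    have h3 : ((p : ℝ) - n + 1) * y ≤ p * (2 * y / (y + 2)) := by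
      rw [cStar, le_div_iff₀ hm] at hyc
      rw [mul_div_assoc', le_div_iff₀ (by linarith)]
      nlinarith
    rw [h1]
    nlinarith
  have hne : (Finset.univ : Finset (Fin n)).Nonempty := ⟨⟨0, hn⟩, Finset.mem_univ _⟩
  have hsum := Finset.sum_lt_sum_of_nonempty hne fun j _ => key j
  rw [Finset.sum_sub_distrib, ← Finset.mul_sum, ← Finset.mul_sum, ← Finset.mul_sum,
    Finset.sum_sub_distrib, Finset.sum_const_zero] at hsum
  simp only [Finset.sum_sub_distrib, sub_zero, one_mul, sub_self, zero_mul, add_zero]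
  have e : (p : ℝ) * (p : ℝ)⁻¹ = 1 := mul_inv_cancel₀ hp'.ne'
  -- The trace against `Σ⁻¹` cancels between the loss difference and the Haff term.
  generalize (Sig⁻¹ * ((eigDecomp n (scatter X)).1 * ((eigDecomp n (scatter X)).1)ᵀ)).trace = τ
  refine lt_of_eq_of_lt ?_ hsum
  linear_combination (x * τ) * e

/-- `λ̂ ≤ c ℓⱼ` bounds `λ̂ ∑ 1/ℓⱼ` by `cn`, however small the eigenvalues are, and bounds `λ̂`
itself by `c tr S`. -/
theorem abs_haffTerm_le {c : ℝ} (hc : 0 ≤ c) (hnp : n ≤ p) {Sig : Matrix (Fin p) (Fin p) ℝ}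
    {X : Fin n → EuclideanSpace ℝ (Fin p)}
    (hS : scatter X ∈ scatterDomain n p) (hX : ((dataMat X)ᵀ * dataMat X).PosDef)
    (hn : 0 < n) (hlam : 0 < lamHat n b (scatter X))
    (hle : ∀ j, lamHat n b (scatter X) ≤ c * (eigDecomp n (scatter X)).2 j) :
    |haffTerm b Sig (dataMat X)| ≤ ((p : ℝ) - n + 1) * (c * n) +
      (c * n * ∑ i, ∑ j, |Sig⁻¹ i j|) * (scatter X).trace := by
  rw [haffTerm_dataMat hS hX]
  have h := isEigDecomp_eigDecomp hS
  have hτ := abs_trace_mul_le Sig⁻¹ (posSemidef_mul_transpose (eigDecomp n (scatter X)).1)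
  rw [trace_mul_transpose_of_orthonormal h.orthonormal] at hτ
  rw [h.trace_eq]
  have hpos := h.pos
  set l := (eigDecomp n (scatter X)).2
  set x := lamHat n b (scatter X)
  set σ := ∑ i, ∑ j, |Sig⁻¹ i j|
  set τ := (Sig⁻¹ * ((eigDecomp n (scatter X)).1 * ((eigDecomp n (scatter X)).1)ᵀ)).trace
  have hm : (0 : ℝ) ≤ (p : ℝ) - n + 1 := by
    have : (n : ℝ) ≤ p := by exact_mod_cast hnp
    linarith
  have h1 : x * ∑ j, (l j)⁻¹ ≤ c * n := by
    rw [Finset.mul_sum]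
    refine (Finset.sum_le_card_nsmul _ _ c fun j _ => ?_).trans (by simp [mul_comm])
    rw [← div_eq_mul_inv, div_le_iff₀ (hpos j)]
    exact hle j
  have h2 : 0 ≤ x * ∑ j, (l j)⁻¹ :=
    mul_nonneg hlam.le (Finset.sum_nonneg fun j _ => (inv_pos.2 (hpos j)).le)
  have h3 : x ≤ c * ∑ j, l j := (hle ⟨0, hn⟩).trans (mul_le_mul_of_nonneg_left
    (Finset.single_le_sum (f := l) (fun j _ => (hpos j).le) (Finset.mem_univ _)) hc)
  have h4 : |x * τ| ≤ c * (∑ j, l j) * (σ * n) := by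
    rw [abs_mul, abs_of_pos hlam]
    exact mul_le_mul h3 hτ (abs_nonneg _) (hlam.le.trans h3)
  have h5 := abs_le.1 h4
  have h6 := mul_le_mul_of_nonneg_left h1 hm
  have h7 := mul_nonneg hm h2
  have h8 := mul_nonneg hm (h2.trans h1)
  rw [abs_le]
  constructor <;> linarith [h5.1, h5.2]

end Risk

/-! ### Comparison of the risks. -/

section Domination

variable {n p : ℕ} {b : Matrix (Fin p) (Fin p) ℝ → ℝ}

theorem integral_nonneg_of_lintegral_neg_le {α : Type*} [MeasurableSpace α] {μ : Measure α}
    {f : α → ℝ} (hf : Integrable f μ)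
    (h : ∫⁻ x, .ofReal (-f x) ∂μ ≤ ∫⁻ x, .ofReal (f x) ∂μ) : 0 ≤ ∫ x, f x ∂μ := by
  rw [integral_eq_lintegral_pos_part_sub_lintegral_neg_part hf, sub_nonneg]
  exact ENNReal.toReal_mono hf.lintegral_lt_top.ne h

theorem cStar_nonneg (hn : 0 < n) (hnp : n ≤ p) : 0 ≤ cStar n p := by
  have h1 : (1 : ℝ) ≤ n := by exact_mod_cast hn
  have h2 : (n : ℝ) ≤ p := by exact_mod_cast hnp
  exact div_nonneg (by linarith) (by linarith)

/-- `p` times the loss difference plus the Haff term is almost surely negative, while the Haff term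
has nonnegative mean; the risk difference is therefore negative. -/
theorem risk_interEst_lt (hn : 0 < n) (hnp : n + 1 < p)
    (hb : DifferentiableOn ℝ b (scatterDomain n p)) {C₀ : ℝ} (hC₀ : 0 < C₀)
    (hbound : ∀ S ∈ scatterDomain n p, C₀ ≤ b S ∧ b S ≤ bStar n p)
    (hderiv : ∀ (S : Matrix (Fin p) (Fin p) ℝ) (H : Matrix (Fin p) (Fin n) ℝ) (l : Fin n → ℝ),
      IsEigDecomp S H l → ∑ i, partialEig b H l i ≤ 0)
    {Sig : Matrix (Fin p) (Fin p) ℝ} (hSig : Sig.PosDef) :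
    HasFiniteRisk n (interEst n b 0) Sig ∧ HasFiniteRisk n (interEst n b 1) Sig ∧
      risk n (interEst n b 0) Sig < risk n (interEst n b 1) Sig := by
  have hnp' : n ≤ p := by omega
  have hp : 0 < p := by omega
  have : NeZero n := ⟨hn.ne'⟩
  have := isProbabilityMeasure_sampleLaw n Sig
  have hc := cStar_nonneg hn hnp'
  have hε : 0 < ((p : ℝ) - n - 1) / 2 := by
    have : (n : ℝ) + 1 < p := by exact_mod_cast hnp
    linarith
  have hb0 : ∀ S ∈ scatterDomain n p, 0 < b S := fun S hS => hC₀.trans_le (hbound S hS).1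
  have hbn : ∀ S ∈ scatterDomain n p, b S < n := fun S hS => by
    refine (hbound S hS).2.trans_lt (lt_of_lt_of_le ?_ (by exact_mod_cast hn : (1 : ℝ) ≤ n))
    rw [bStar, div_lt_one (by linarith)]
    linarith
  have hlam := measurable_lamHat hb.continuousOn hb0 hbn
  have hpos : ∀ S ∈ scatterDomain n p, 0 < lamHat n b S := fun S hS => by
    have h := isEigDecomp_eigDecomp hS
    rw [lamHat_eq h (hb0 S hS) (hbn S hS)]
    exact lamSol_pos h.pos (hb0 S hS) (hbn S hS)
  have hle : ∀ S ∈ scatterDomain n p, ∀ j, lamHat n b S ≤ cStar n p * (eigDecomp n S).2 j :=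
    fun S hS j => by
      have h := isEigDecomp_eigDecomp hS
      rw [lamHat_eq h (hb0 S hS) (hbn S hS)]
      exact lamSol_le_mul h.pos (hb0 S hS).le (hbn S hS) hc (hbound S hS).2 j
  have hae := ae_scatter_mem hnp' hSig
  have hfin : ∀ θ, 0 ≤ θ → θ ≤ 1 → HasFiniteRisk n (interEst n b θ) Sig := fun θ h0 h1 => by
    obtain ⟨A₁, A₂, hA⟩ := abs_steinLoss_interEst_le hp hSig hC₀ hc hε hbn
      (fun S hS => (hbound S hS).1) (fun S hS => (hbound S hS).2) h0 h1
    refine Integrable.mono' ((integrable_const A₁).add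
      ((integrable_eigenvalue_bound hnp' hSig).const_mul A₂))
      (aestronglyMeasurable_steinLoss_interEst hnp' hlam hSig θ) ?_
    filter_upwards [hae] with X hX
    exact hA _ hX.1
  have hf0 := hfin 0 le_rfl zero_le_one
  have hf1 := hfin 1 zero_le_one le_rfl
  have hhaff : Integrable (fun X => haffTerm b Sig (dataMat X)) (sampleLaw n Sig) := by
    refine Integrable.mono' ((integrable_const (((p : ℝ) - n + 1) * (cStar n p * n))).add
      ((integrable_trace_scatter n Sig).const_mul (cStar n p * n * ∑ i, ∑ j, |Sig⁻¹ i j|)))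
      ((measurable_haffTerm Sig hlam).comp measurable_dataMat).aestronglyMeasurable ?_
    filter_upwards [hae] with X hX
    exact abs_haffTerm_le hc hnp' hX.1 hX.2 hn (hpos _ hX.1) (hle _ hX.1)
  have hhaff0 := integral_nonneg_of_lintegral_neg_le hhaff
    (lintegral_neg_haffTerm_le hnp' hb hb0 hbn hderiv hSig)
  refine ⟨hf0, hf1, ?_⟩
  set g : (Fin n → EuclideanSpace ℝ (Fin p)) → ℝ := fun X =>
    p * (steinLoss (interEst n b 0 (scatter X)) Sig - steinLoss (interEst n b 1 (scatter X)) Sig) +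
      haffTerm b Sig (dataMat X) with hg
  have hgI : Integrable g (sampleLaw n Sig) := ((hf0.sub hf1).const_mul _).add hhaff
  have hgneg : ∀ᵐ X ∂sampleLaw n Sig, g X < 0 := by
    filter_upwards [hae] with X hX
    exact steinLoss_sub_add_haffTerm_neg hp hn hSig hnp' hX.1 hX.2 (hpos _ hX.1) (hle _ hX.1)
  have hgint : ∫ X, g X ∂sampleLaw n Sig =
      p * (risk n (interEst n b 0) Sig - risk n (interEst n b 1) Sig) +
        ∫ X, haffTerm b Sig (dataMat X) ∂sampleLaw n Sig := by
    rw [risk, risk, ← integral_sub hf0 hf1, ← integral_const_mul]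
    exact integral_add ((hf0.sub hf1).const_mul _) hhaff
  have hlt : ∫ X, g X ∂sampleLaw n Sig < 0 := by
    have h1 : 0 < ∫ X, -g X ∂sampleLaw n Sig := by
      refine (integral_pos_iff_support_of_nonneg_ae ?_ hgI.neg).2 ?_
      swap
      · have h2 : Function.support (-g) =ᵐ[sampleLaw n Sig] univ := by
          rw [eventuallyEq_univ]
          filter_upwards [hgneg] with X hX
          exact (neg_pos.2 hX).ne'
        rw [measure_congr h2, measure_univ]
        exact one_pos
      · filter_upwards [hgneg] with X hX
        exact (neg_pos.2 hX).le
    rw [integral_neg] at h1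
    linarith
  rw [hgint] at hlt
  have hp' : (0 : ℝ) < p := by exact_mod_cast hp
  by_contra hcon
  have := mul_nonneg hp'.le (sub_nonneg.2 (not_lt.1 hcon))
  linarith

end Domination

end SteinCov

theorem mainTheorem2 (n p : ℕ) (hn : 2 ≤ n) (hp : 0 < (p : ℤ) - n - 1)
    (b : Matrix (Fin p) (Fin p) ℝ → ℝ)
    (hb : DifferentiableOn ℝ b (SteinCov.scatterDomain n p))
    (C₀ : ℝ) (hC₀ : 0 < C₀)
    (hbound : ∀ S ∈ SteinCov.scatterDomain n p, C₀ ≤ b S ∧ b S ≤ SteinCov.bStar n p)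
    (hderiv : ∀ (S : Matrix (Fin p) (Fin p) ℝ) (H : Matrix (Fin p) (Fin n) ℝ) (l : Fin n → ℝ),
      SteinCov.IsEigDecomp S H l → ∑ i, SteinCov.partialEig b H l i ≤ 0) :
    SteinCov.Dominates n (SteinCov.deltaEB n b) (SteinCov.deltaSH n b) := by
  have hnp : n + 1 < p := by omega
  have key := fun (Sig : Matrix (Fin p) (Fin p) ℝ) (hSig : Sig.PosDef) =>
    SteinCov.risk_interEst_lt (by omega) hnp hb hC₀ hbound hderiv hSig
  rw [SteinCov.deltaEB_eq, SteinCov.deltaSH_eq]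
  -- The inequality is strict at every `Σ`, so the identity is an arbitrary witness.
  exact ⟨fun Sig hSig => ⟨(key Sig hSig).1, (key Sig hSig).2.1, (key Sig hSig).2.2.le⟩,
    1, PosDef.one, (key 1 PosDef.one).2.2⟩
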